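/- Let $\mathbb T^2=(\mathbb R/\mathbb Z)^2$ and, for $s\ge 0$, let $H^s=H^s(\mathbb T^2)$ be the $L^2$-based Sobolev space. Let $S_t=e^{t\Delta}$ be the heat semigroup. For a scalar field $\omega$ on $\mathbb T^2$ let $u=K*\omega:=\nabla^\perp\Delta^{-1}\big(\omega-\int_{\mathbb T^2}\omega\big)$ be its Biot–Savart velocity; it is divergence-free, and $\operatorname{curl}u=\omega$ when $\omega$ has zero mean. Let $H\in(1/2,1)$, let $W^H=(W^H_t)_{t\ge0}$ be a fractional Brownian motion with Hurst parameter $H$ (with almost surely continuous paths) on a probability space $(\Omega,\mathcal F,\mathbb P)$, let $\gamma\in(1/2,H)$ and $\alpha>1$. Let $\xi\in C^\infty(\mathbb T^2;\mathbb R^2)$ be divergence-free and let $\omega_0\in H^{2\alpha}(\mathbb T^2;\mathbb R)$. For $T>0$ put $$V^T:=C([0,T];H^{2\alpha})\cap C^\gamma([0,T];H^{2\alpha-2\gamma})$$ (spaces of real-valued fields). A path $\omega\in V^T$ is called a mild solution on $[0,T]$ (along a given path of $W^H$) of $$d\omega_t+u_t\cdot\nabla\omega_t\,dt+\xi\cdot\nabla\omega_t\,dW^H_t=\Delta\omega_t\,dt,\qquad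 u_t=K*\omega_t,$$ with initial condition $\omega_0$ if for every $t\in[0,T]$ $$\omega_t=S_t\omega_0-\int_0^tS_{t-s}(u_s\cdot\nabla\omega_s)\,ds-\int_0^tS_{t-s}(\xi\cdot\nabla\omega_s)\,dW^H_s .$$ Here the first integral is a Bochner integral, and the second is the Young integral, i.e. the limit in $H^{2\alpha}$, as $k\to\infty$, of the dyadic sums $$\sum_{n\ge0:\ [n2^{-k},(n+1)2^{-k}]\subset[0,t]}S_{t-n2^{-k}}\big(\xi\cdot\nabla\omega_{n2^{-k}}\big)\big(W^H_{(n+1)2^{-k}}-W^H_{n2^{-k}}\big);$$ the existence of both integrals is part of the definition. Then for $T$ sufficiently small (depending on the path of the noise) there is a unique mild solution in $V^T$. Precisely: there are a random variable $\tau:\Omega\to\mathbb R$ and a process $\omega=(\omega_t)$ (each $\omega_t$ being a strongly measurable $L^2(\mathbb T^2)$-valued random variable) such that, almost surely, $\tau>0$ and for every $T\in(0,\tau]$ the restriction of $\omega$ to $[0,T]$ belongs to $V^T$, is a mild solution on $[0,T]$, and is the only mild solution on $[0,T]$ in $V^T$. Moreover, if $\omega_0$ has zero mean then almost surely $\operatorname{curl}(K*\omega_t)=\omega_t$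 for all $t\in[0,\tau]$. -/

import Mathlib

open MeasureTheory ProbabilityTheory Filter Topology Set
open scoped ENNReal NNReal

noncomputable section

namespace Vorticity

/-! ### Fourier analysis and Sobolev spaces on the two-dimensional torus -/

/-- The torus `𝕋² = (ℝ/ℤ)²`. -/
abbrev Torus : Type := UnitAddTorus (Fin 2)

/-- The normalised Haar (Lebesgue) measure on the torus. -/
abbrev torusMeasure : Measure Torus :=
  Measure.pi fun _ : Fin 2 => (AddCircle.haarAddCircle : Measure UnitAddCircle)

/-- Square-integrable functions on the torus.  Scalar fields are elements of this space;
the physical (real-valued) ones are singled out by `IsReal`. -/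
abbrev L2 : Type := Lp ℂ 2 torusMeasure

/-- The `k`-th Fourier mode `x ↦ exp (2 π i k · x)` as an element of `L²(𝕋²)`. -/
def mode (k : Fin 2 → ℤ) : L2 := UnitAddTorus.mFourierLp 2 k

/-- The `k`-th Fourier coefficient `∫ f(x) exp (-2 π i k · x) dx`. -/
def coeff (f : L2) (k : Fin 2 → ℤ) : ℂ := UnitAddTorus.mFourierCoeff f k

/-- The field is real-valued. -/
def IsReal (f : L2) : Prop := ∀ᵐ x ∂torusMeasure, (f x).im = 0

/-- The eigenvalue `4 π² |k|²` of `-Δ` on the mode `k`. -/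
def eigenvalue (k : Fin 2 → ℤ) : ℝ := 4 * Real.pi ^ 2 * ∑ j, (k j : ℝ) ^ 2

/-- The norm of `H^s(𝕋²)`, `(∑ₖ (1 + 4π²|k|²)^s |f̂(k)|²)^{1/2}`, with value `∞` when `f ∉ H^s`. -/
def sobolevNorm (s : ℝ) (f : L2) : ℝ≥0∞ :=
  (∑' k : Fin 2 → ℤ, ENNReal.ofReal ((1 + eigenvalue k) ^ s * ‖coeff f k‖ ^ 2)) ^ (1 / 2 : ℝ)

/-- Membership in `H^s(𝕋²)`, for `s ≥ 0`. -/
def MemSobolev (s : ℝ) (f : L2) : Prop := sobolevNorm s f < ∞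

/-- Membership in `C^∞(𝕋²) = ⋂_{s ≥ 0} H^s(𝕋²)`. -/
def MemSmooth (f : L2) : Prop := ∀ s : ℝ, 0 ≤ s → MemSobolev s f

/-- The Fourier multiplier with symbol `m`, that is `f ↦ ∑ₖ m(k) f̂(k) exp (2 π i k · x)`.
It is meant for those `f` for which the series converges in `L²`. -/
def multiplier (m : (Fin 2 → ℤ) → ℂ) (f : L2) : L2 := ∑' k, (m k * coeff f k) • mode k

/-- The (weak) partial derivative `∂ⱼ f`, for `f ∈ H¹`. -/
def partialDeriv (j : Fin 2) (f : L2) : L2 :=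
  multiplier (fun k => 2 * Real.pi * Complex.I * (k j : ℂ)) f

/-- The heat semigroup `S_t = exp (t Δ)`, for `t ≥ 0`. -/
def heat (t : ℝ) (f : L2) : L2 := multiplier (fun k => (Real.exp (-(t * eigenvalue k)) : ℂ)) f

/-! ### The operators of the vorticity equation -/

/-- The divergence `∂₁ v₁ + ∂₂ v₂`. -/
def divergence (v : Fin 2 → L2) : L2 := partialDeriv 0 (v 0) + partialDeriv 1 (v 1)

/-- The scalar curl `∂₁ v₂ - ∂₂ v₁`. -/
def curl (v : Fin 2 → L2) : L2 := partialDeriv 0 (v 1) - partialDeriv 1 (v 0)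

/-- The symbol of `Δ⁻¹` on functions of zero mean (the zero mode is sent to `0`). -/
def invLaplaceSymbol (k : Fin 2 → ℤ) : ℂ := if k = 0 then 0 else -((eigenvalue k : ℂ)⁻¹)

/-- The Biot-Savart velocity `u = K ∗ ω = ∇^⊥ Δ⁻¹ ω = (-∂₂ ψ, ∂₁ ψ)`, where the stream function `ψ`
is the zero-mean solution of `Δ ψ = ω - ∫ ω`. -/
def biotSavart (f : L2) : Fin 2 → L2 :=
  ![multiplier (fun k => -(2 * Real.pi * Complex.I * (k 1 : ℂ)) * invLaplaceSymbol k) f,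
    multiplier (fun k => (2 * Real.pi * Complex.I * (k 0 : ℂ)) * invLaplaceSymbol k) f]

open scoped Classical in
/-- The transport term `v · ∇ f`, the pointwise product `v₁ ∂₁ f + v₂ ∂₂ f`.  It is a
square-integrable function when `v` is bounded and `f ∈ H¹`. -/
def transport (v : Fin 2 → L2) (f : L2) : L2 :=
  if h : MemLp (fun x => ∑ j, (v j) x * (partialDeriv j f) x) 2 torusMeasure then h.toLp _ else 0

/-! ### Spaces of paths -/

/-- `f ∈ C([0,T]; H^s)`. -/
def ContPath (s T : ℝ) (f : ℝ → L2) : Prop :=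
  (∀ t ∈ Icc 0 T, MemSobolev s (f t)) ∧
    ∀ t ∈ Icc 0 T, Tendsto (fun r => sobolevNorm s (f r - f t)) (𝓝[Icc 0 T] t) (𝓝 0)

/-- `f ∈ C^γ([0,T]; H^s)`. -/
def HolderPath (γ s T : ℝ) (f : ℝ → L2) : Prop :=
  (∀ t ∈ Icc 0 T, MemSobolev s (f t)) ∧
    ∃ C : ℝ≥0, ∀ r ∈ Icc 0 T, ∀ t ∈ Icc 0 T,
      sobolevNorm s (f t - f r) ≤ C * ENNReal.ofReal (|t - r| ^ γ)

/-- The space `V^T = C([0,T]; H^{2α}) ∩ C^γ([0,T]; H^{2α-2γ})` of paths of real scalar fields. -/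
def MemV (α γ T : ℝ) (f : ℝ → L2) : Prop :=
  (∀ t ∈ Icc 0 T, IsReal (f t)) ∧ ContPath (2 * α) T f ∧ HolderPath γ (2 * α - 2 * γ) T f

/-! ### The noise and the Young integral -/

/-- `W` is a fractional Brownian motion with Hurst parameter `H`: a centred Gaussian process with
covariance `(t^{2H} + s^{2H} - |t-s|^{2H}) / 2` and almost surely continuous paths. -/
structure IsFBM {Ω : Type*} [MeasurableSpace Ω] (H : ℝ) (W : ℝ≥0 → Ω → ℝ) (P : Measure Ω) :
    Prop where
  measurable : ∀ t, Measurable (W t)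
  gaussian : IsGaussianProcess W P
  centred : ∀ t, ∫ w, W t w ∂P = 0
  covariance_eq : ∀ s t : ℝ≥0,
    cov[W s, W t; P] =
      ((t : ℝ) ^ (2 * H) + (s : ℝ) ^ (2 * H) - |(t : ℝ) - (s : ℝ)| ^ (2 * H)) / 2
  continuous_paths : ∀ᵐ w ∂P, Continuous fun t => W t w

/-- The dyadic sum `∑ S_{t - n/2ᵏ} Y_{n/2ᵏ} (W_{(n+1)/2ᵏ} - W_{n/2ᵏ})` over all `n` such that
`[n/2ᵏ, (n+1)/2ᵏ] ⊆ [0,t]`, along the path `W`. -/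
def youngSum (W : ℝ≥0 → ℝ) (Y : ℝ → L2) (t : ℝ) (k : ℕ) : L2 :=
  ∑ n ∈ Finset.range ⌊t * 2 ^ k⌋₊,
    (W (((n : ℝ≥0) + 1) / 2 ^ k) - W ((n : ℝ≥0) / 2 ^ k)) •
      heat (t - (n : ℝ) / 2 ^ k) (Y ((n : ℝ) / 2 ^ k))

/-- `I` is the Young integral `∫₀ᵗ S_{t-r} Y_r dW_r` in `H^s`: it belongs to `H^s` and it is the
limit of the dyadic sums in the norm of `H^s`. -/
def IsYoungIntegral (s : ℝ) (W : ℝ≥0 → ℝ) (Y : ℝ → L2) (t : ℝ) (I : L2) : Prop :=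
  MemSobolev s I ∧ Tendsto (fun k => sobolevNorm s (youngSum W Y t k - I)) atTop (𝓝 0)

/-! ### Mild solutions -/

/-- `ω` is a mild solution on `[0,T]` in the class `V^T`, along the path `W` of the noise, of
`dω + u · ∇ω dt + ξ · ∇ω dW = Δω dt`, `u = K ∗ ω`, started at `ω₀`: for all `t ∈ [0,T]`,
`ω_t = S_t ω₀ - ∫₀ᵗ S_{t-s} (u_s · ∇ω_s) ds - ∫₀ᵗ S_{t-s} (ξ · ∇ω_s) dW_s`. -/
def IsMildSolution (α γ : ℝ) (ξ : Fin 2 → L2) (ω₀ : L2) (W : ℝ≥0 → ℝ) (T : ℝ) (ω : ℝ → L2) :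
    Prop :=
  MemV α γ T ω ∧
    ∀ t ∈ Icc 0 T,
      IntervalIntegrable (fun s => heat (t - s) (transport (biotSavart (ω s)) (ω s))) volume 0 t ∧
      ∃ I : L2, IsYoungIntegral (2 * α) W (fun s => transport ξ (ω s)) t I ∧
        ω t = heat t ω₀ - (∫ s in (0 : ℝ)..t, heat (t - s) (transport (biotSavart (ω s)) (ω s))) - I

end Vorticity

end

/-!
The solution is constructed pathwise by a fixed point argument, the only probabilistic inputs being
a Hölder bound on the dyadic increments of the noise and measurability.

All spaces are described by Fourier coefficients.  `SobBound s f C` is a real-valued form of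
`‖f‖_{H^s} ≤ C` in which `s` may be negative; it is stable under sums, Fourier multipliers and
`L²`-limits.  A field with absolutely summable Fourier series multiplies `H^r`, for `r` of either
sign, by Peetre's inequality (`SobBound.wienerMul`).  As the Biot-Savart operator gains one
derivative, the nonlinearity `(K ∗ f) · ∇g` and the noise coefficient `ξ · ∇f` map paths in
`C(H^{2α}) ∩ C^γ(H^{2α-2γ})` to paths in `C(H^{2α-1}) ∩ C^γ(H^{2α-1-2γ})`
(`exists_pathBound_advection`, `exists_pathBound_transport`).  The estimate behind contraction and
uniqueness needs only such boundedness and Hölder bounds, which `PathBound` records.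

The Young convolution integral wins the lost derivative back.  Passing from dyadic level `k` to
level `k + 1` replaces, on the interval `[u,v]` with midpoint `m`, the term `S_{t-u} Y_u (W_v - W_u)`
by one that differs from it by `S_{t-m} (Y_m - S_{m-u} Y_u) (W_v - W_m)`.  The bracket is of size
`2^{-kγ}` in `H^{ρ-2γ}`, where `Y` takes values in `H^ρ`, the increment of a `β`-Hölder driver is of
size `2^{-kβ}`, and the semigroup brings the term to `H^{ρ+2θ}` at the price `(t-m)^{-(γ+θ)}`.  As
`β + γ > 1` and `θ < β`, the sum over the intervals of one level decays geometrically in the level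
(`exists_sobBound_youngSumIncr_succ_sub`), and the integral over an interval of length `h` is of size
`h^{β-θ}` in `H^{ρ+2θ}` (`exists_sobBound_youngInt`).  The choices `θ = 0` and `θ = 1/2` give Hölder
continuity and values in `H^{ρ+1}`, and `θ` slightly above `1/2` gives continuity in `H^{ρ+1}`.

The drift is treated in the same way: as the integrand is continuous in `L²`, the Bochner integral is
the limit of its dyadic Riemann sums, hence a Young integral with respect to the driver `t ↦ t`
(`integral_eq_youngInt`).  Mild solutions are thus fixed points of a single map `mildMap`, which maps
a ball into itself and contracts it on a short interval (`exists_mildMap_estimates`).  The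
contraction estimate is stated for paths that agree up to a time `a` and asks only that `T - a` be
small, so it also propagates uniqueness, without restriction on the size of the solutions, over
`[0,T]` in finitely many steps (`mildMap_fixedPoint_unique`).

For fractional Brownian motion, Gaussian moments and the Borel-Cantelli lemma give a dyadic Hölder
bound of any exponent `β < H`, here with `γ < β < H`.  The life span is an explicit function of the
best constant in that bound, and the solution is a limit of Picard iterates which are measurable
because their Fourier coefficients are.  Finally, transport by a divergence-free field has zero mean,
so the mean of `ω` is conserved, and on fields of zero mean the curl inverts the Biot-Savart operator.
-/

noncomputable section

namespace Vorticity

section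

/-! ### Fourier coefficients and multipliers -/

/-- The Fourier basis of `L²(𝕋²)`. -/
def fourierBasis : HilbertBasis (Fin 2 → ℤ) ℂ L2 := UnitAddTorus.mFourierBasis

theorem coe_fourierBasis (k : Fin 2 → ℤ) : fourierBasis k = mode k :=
  congrFun UnitAddTorus.coe_mFourierBasis k

theorem fourierBasis_repr (f : L2) (k : Fin 2 → ℤ) : fourierBasis.repr f k = coeff f k :=
  UnitAddTorus.mFourierBasis_repr f k

/-- The `k`-th Fourier coefficient as a continuous linear functional. -/
def coeffL (k : Fin 2 → ℤ) : L2 →L[ℂ] ℂ := innerSL ℂ (mode k)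

theorem coeffL_apply (k : Fin 2 → ℤ) (f : L2) : coeffL k f = coeff f k := by
  rw [← fourierBasis_repr, HilbertBasis.repr_apply_apply, coe_fourierBasis]; rfl

theorem coeff_add (f g : L2) (k : Fin 2 → ℤ) : coeff (f + g) k = coeff f k + coeff g k := by
  simp only [← coeffL_apply, map_add]

theorem coeff_sub (f g : L2) (k : Fin 2 → ℤ) : coeff (f - g) k = coeff f k - coeff g k := by
  simp only [← coeffL_apply, map_sub]

theorem coeff_zero (k : Fin 2 → ℤ) : coeff (0 : L2) k = 0 := by
  simp only [← coeffL_apply, map_zero]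

theorem coeff_smul (c : ℂ) (f : L2) (k : Fin 2 → ℤ) : coeff (c • f) k = c * coeff f k := by
  simp only [← coeffL_apply, map_smul, smul_eq_mul]

theorem coeff_real_smul (c : ℝ) (f : L2) (k : Fin 2 → ℤ) : coeff (c • f) k = c * coeff f k := by
  have : c • f = (c : ℂ) • f := (algebraMap_smul ℂ c f).symm
  rw [this, coeff_smul]

theorem coeff_sum {ι : Type*} (s : Finset ι) (f : ι → L2) (k : Fin 2 → ℤ) :
    coeff (∑ i ∈ s, f i) k = ∑ i ∈ s, coeff (f i) k := by
  simp only [← coeffL_apply, map_sum]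

theorem tendsto_coeff {ι : Type*} {l : Filter ι} {f : ι → L2} {g : L2} (h : Tendsto f l (𝓝 g))
    (k : Fin 2 → ℤ) : Tendsto (fun i => coeff (f i) k) l (𝓝 (coeff g k)) := by
  simp only [← coeffL_apply]
  exact ((coeffL k).continuous.tendsto g).comp h

theorem ext_coeff {f g : L2} (h : ∀ k, coeff f k = coeff g k) : f = g := by
  apply fourierBasis.repr.injective
  ext k
  rw [fourierBasis_repr, fourierBasis_repr, h]

theorem summable_sq_coeff (f : L2) : Summable fun k => ‖coeff f k‖ ^ 2 :=
  (UnitAddTorus.hasSum_sq_mFourierCoeff f).summable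

theorem tsum_sq_coeff (f : L2) : ∑' k, ‖coeff f k‖ ^ 2 = ‖f‖ ^ 2 := by
  have h := fourierBasis.repr.norm_map f
  have h2 := lp.norm_rpow_eq_tsum (p := 2) (by norm_num) (fourierBasis.repr f)
  simp only [ENNReal.toReal_ofNat, Real.rpow_ofNat, fourierBasis_repr, h] at h2
  exact h2.symm

/-- A square-summable sequence is the sequence of coefficients of its Fourier series. -/
theorem coeff_tsum_smul_mode {a : (Fin 2 → ℤ) → ℂ} (ha : Summable fun k => ‖a k‖ ^ 2)
    (k : Fin 2 → ℤ) : coeff (∑' l, a l • mode l) k = a k := by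
  have hmem : Memℓp a 2 := by
    rw [memℓp_gen_iff (by norm_num)]
    simpa using ha
  have h := fourierBasis.hasSum_repr_symm ⟨a, hmem⟩
  simp only [coe_fourierBasis] at h
  rw [h.tsum_eq, ← fourierBasis_repr, LinearIsometryEquiv.apply_symm_apply]

theorem hasSum_coeff_smul_mode (f : L2) : HasSum (fun k => coeff f k • mode k) f := by
  have := fourierBasis.hasSum_repr f
  simpa only [coe_fourierBasis, fourierBasis_repr] using this

theorem coeff_multiplier {m : (Fin 2 → ℤ) → ℂ} {f : L2}
    (h : Summable fun k => ‖m k * coeff f k‖ ^ 2) (k : Fin 2 → ℤ) :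
    coeff (multiplier m f) k = m k * coeff f k :=
  coeff_tsum_smul_mode h k

theorem summable_bounded_multiplier {m : (Fin 2 → ℤ) → ℂ} {M : ℝ} (hm : ∀ k, ‖m k‖ ≤ M) (f : L2) :
    Summable fun k => ‖m k * coeff f k‖ ^ 2 := by
  refine Summable.of_nonneg_of_le (fun k => by positivity) (fun k => ?_)
    ((summable_sq_coeff f).mul_left (M ^ 2))
  rw [norm_mul, mul_pow]
  gcongr
  exact hm k

/-! ### Quantitative Sobolev bounds -/

/-- The Fourier weight `1 + 4π²|k|²`. -/
def jap (k : Fin 2 → ℤ) : ℝ := 1 + eigenvalue k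

theorem eigenvalue_nonneg (k : Fin 2 → ℤ) : 0 ≤ eigenvalue k := by
  unfold eigenvalue; positivity

theorem one_le_jap (k : Fin 2 → ℤ) : 1 ≤ jap k := by
  have := eigenvalue_nonneg k
  unfold jap; linarith

theorem jap_pos (k : Fin 2 → ℤ) : 0 < jap k := zero_lt_one.trans_le (one_le_jap k)

/-- `SobBound s f C` says that the norm of `f` in `H^s` is at most the real number `C ≥ 0`.  The
exponent `s` may be negative.  The bound is phrased through finite partial sums, which makes it
visibly stable under limits. -/
def SobBound (s : ℝ) (f : L2) (C : ℝ) : Prop :=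
  0 ≤ C ∧ ∀ F : Finset (Fin 2 → ℤ), ∑ k ∈ F, jap k ^ s * ‖coeff f k‖ ^ 2 ≤ C ^ 2

theorem sobolevNorm_le_iff {s C : ℝ} (hC : 0 ≤ C) (f : L2) :
    sobolevNorm s f ≤ ENNReal.ofReal C ↔ SobBound s f C := by
  have hnn : ∀ k, 0 ≤ jap k ^ s * ‖coeff f k‖ ^ 2 := fun k => by
    have := jap_pos k
    positivity
  have h2 : ENNReal.ofReal C = (ENNReal.ofReal (C ^ 2)) ^ (1 / 2 : ℝ) := by
    rw [ENNReal.ofReal_rpow_of_nonneg (by positivity) (by norm_num), ← Real.sqrt_eq_rpow,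
      Real.sqrt_sq hC]
  unfold sobolevNorm
  simp only [show ∀ k, 1 + eigenvalue k = jap k from fun _ => rfl]
  rw [h2, ENNReal.rpow_le_rpow_iff (by norm_num), ENNReal.tsum_eq_iSup_sum, iSup_le_iff]
  refine ⟨fun h => ⟨hC, fun F => ?_⟩, fun h F => ?_⟩
  · have := h F
    rw [← ENNReal.ofReal_sum_of_nonneg (fun k _ => hnn k),
      ENNReal.ofReal_le_ofReal_iff (by positivity)] at this
    exact this
  · rw [← ENNReal.ofReal_sum_of_nonneg (fun k _ => hnn k)]
    exact ENNReal.ofReal_le_ofReal (h.2 F)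

theorem memSobolev_iff {s : ℝ} {f : L2} : MemSobolev s f ↔ ∃ C, SobBound s f C := by
  constructor
  · intro h
    refine ⟨(sobolevNorm s f).toReal, (sobolevNorm_le_iff ENNReal.toReal_nonneg f).1 ?_⟩
    rw [ENNReal.ofReal_toReal (ne_of_lt h)]
  · rintro ⟨C, hC⟩
    exact ((sobolevNorm_le_iff hC.1 f).2 hC).trans_lt ENNReal.ofReal_lt_top

namespace SobBound

variable {s s' C D : ℝ} {f g : L2}

theorem memSobolev (h : SobBound s f C) : MemSobolev s f := memSobolev_iff.2 ⟨C, h⟩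

theorem sobolevNorm_le (h : SobBound s f C) : sobolevNorm s f ≤ ENNReal.ofReal C :=
  (sobolevNorm_le_iff h.1 f).2 h

theorem mono (h : SobBound s f C) (hCD : C ≤ D) : SobBound s f D :=
  ⟨h.1.trans hCD, fun F => (h.2 F).trans (pow_le_pow_left₀ h.1 hCD 2)⟩

/-- Pointwise domination of Fourier coefficients, with a change of the exponent. -/
theorem of_coeff_le (h : SobBound s f C) {M : ℝ} (hM : 0 ≤ M)
    (hle : ∀ k, ‖coeff g k‖ ≤ M * jap k ^ ((s - s') / 2) * ‖coeff f k‖) :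
    SobBound s' g (M * C) := by
  refine ⟨mul_nonneg hM h.1, fun F => ?_⟩
  calc ∑ k ∈ F, jap k ^ s' * ‖coeff g k‖ ^ 2
      ≤ ∑ k ∈ F, M ^ 2 * (jap k ^ s * ‖coeff f k‖ ^ 2) := by
        refine Finset.sum_le_sum fun k _ => ?_
        have hj := jap_pos k
        calc jap k ^ s' * ‖coeff g k‖ ^ 2
            ≤ jap k ^ s' * (M * jap k ^ ((s - s') / 2) * ‖coeff f k‖) ^ 2 := by
              gcongr
              exact hle k
          _ = M ^ 2 * ((jap k ^ s' * (jap k ^ ((s - s') / 2)) ^ 2) * ‖coeff f k‖ ^ 2) := by ring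
          _ = M ^ 2 * (jap k ^ s * ‖coeff f k‖ ^ 2) := by
              rw [← Real.rpow_mul_natCast hj.le, ← Real.rpow_add hj]
              congr 4
              push_cast; ring
    _ = M ^ 2 * ∑ k ∈ F, jap k ^ s * ‖coeff f k‖ ^ 2 := by rw [Finset.mul_sum]
    _ ≤ M ^ 2 * C ^ 2 := by
        gcongr
        exact h.2 F
    _ = (M * C) ^ 2 := by ring

theorem mono_exponent (h : SobBound s f C) (hs : s' ≤ s) : SobBound s' f C := by
  have := h.of_coeff_le (g := f) (s' := s') zero_le_one (fun k => ?_)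
  · simpa using this
  · have := Real.one_le_rpow (one_le_jap k) (show 0 ≤ (s - s') / 2 by linarith)
    rw [one_mul]
    exact le_mul_of_one_le_left (norm_nonneg _) this

theorem zero (s : ℝ) : SobBound s 0 0 := ⟨le_rfl, fun F => by simp [coeff_zero]⟩

theorem add (hf : SobBound s f C) (hg : SobBound s g D) : SobBound s (f + g) (C + D) := by
  refine ⟨add_nonneg hf.1 hg.1, fun F => ?_⟩
  set a : (Fin 2 → ℤ) → ℝ := fun k => jap k ^ (s / 2) * ‖coeff f k‖
  set b : (Fin 2 → ℤ) → ℝ := fun k => jap k ^ (s / 2) * ‖coeff g k‖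
  have hw : ∀ k, jap k ^ s = (jap k ^ (s / 2)) ^ 2 := fun k => by
    rw [← Real.rpow_mul_natCast (jap_pos k).le]; congr 1; push_cast; ring
  have hA : ∑ k ∈ F, a k ^ 2 ≤ C ^ 2 := by
    simpa only [a, mul_pow, ← hw] using hf.2 F
  have hB : ∑ k ∈ F, b k ^ 2 ≤ D ^ 2 := by
    simpa only [b, mul_pow, ← hw] using hg.2 F
  have hAB : ∑ k ∈ F, a k * b k ≤ C * D := by
    refine abs_le_of_sq_le_sq' ?_ (mul_nonneg hf.1 hg.1) |>.2
    calc (∑ k ∈ F, a k * b k) ^ 2 ≤ (∑ k ∈ F, a k ^ 2) * ∑ k ∈ F, b k ^ 2 :=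
          Finset.sum_mul_sq_le_sq_mul_sq F a b
      _ ≤ C ^ 2 * D ^ 2 := by
          gcongr
      _ = (C * D) ^ 2 := by ring
  calc ∑ k ∈ F, jap k ^ s * ‖coeff (f + g) k‖ ^ 2 ≤ ∑ k ∈ F, (a k + b k) ^ 2 := by
        refine Finset.sum_le_sum fun k _ => ?_
        have hj := jap_pos k
        rw [hw, ← mul_pow, coeff_add]
        gcongr
        simp only [a, b, ← mul_add]
        gcongr
        exact norm_add_le _ _
    _ = ∑ k ∈ F, a k ^ 2 + 2 * ∑ k ∈ F, a k * b k + ∑ k ∈ F, b k ^ 2 := by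
        rw [Finset.mul_sum, ← Finset.sum_add_distrib, ← Finset.sum_add_distrib]
        exact Finset.sum_congr rfl fun k _ => by ring
    _ ≤ (C + D) ^ 2 := by nlinarith

theorem smul (h : SobBound s f C) (c : ℂ) : SobBound s (c • f) (‖c‖ * C) := by
  refine h.of_coeff_le (norm_nonneg c) fun k => ?_
  rw [sub_self, zero_div, Real.rpow_zero, mul_one, coeff_smul, norm_mul]

theorem real_smul (h : SobBound s f C) (c : ℝ) : SobBound s (c • f) (|c| * C) := by
  have : c • f = (c : ℂ) • f := (algebraMap_smul ℂ c f).symm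
  rw [this]
  simpa using h.smul (c : ℂ)

theorem neg (h : SobBound s f C) : SobBound s (-f) C := by
  simpa using h.smul (-1)

theorem sub (hf : SobBound s f C) (hg : SobBound s g D) : SobBound s (f - g) (C + D) := by
  rw [sub_eq_add_neg]; exact hf.add hg.neg

theorem sub_comm (h : SobBound s (f - g) C) : SobBound s (g - f) C := by
  simpa using h.neg

theorem sum {ι : Type*} (F : Finset ι) {f : ι → L2} {C : ι → ℝ}
    (h : ∀ i ∈ F, SobBound s (f i) (C i)) : SobBound s (∑ i ∈ F, f i) (∑ i ∈ F, C i) := by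
  classical
  induction F using Finset.induction_on with
  | empty => simpa using zero s
  | insert i F hi ih =>
    rw [Finset.sum_insert hi, Finset.sum_insert hi]
    exact (h i (Finset.mem_insert_self i F)).add
      (ih fun j hj => h j (Finset.mem_insert_of_mem hj))

/-- Sobolev bounds pass to `L²`-limits. -/
theorem of_tendsto {ι : Type*} {l : Filter ι} [l.NeBot] {f : ι → L2} {g : L2} {C : ι → ℝ} {D : ℝ}
    (hf : Tendsto f l (𝓝 g)) (hC : Tendsto C l (𝓝 D)) (h : ∀ᶠ i in l, SobBound s (f i) (C i)) :
    SobBound s g D := by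
  refine ⟨ge_of_tendsto hC (h.mono fun i hi => hi.1), fun F => ?_⟩
  refine le_of_tendsto_of_tendsto (tendsto_finsetSum F fun k _ =>
    (((tendsto_coeff hf k).norm.pow 2).const_mul _)) (hC.pow 2) (h.mono fun i hi => hi.2 F)

theorem norm_le (h : SobBound s f C) (hs : 0 ≤ s) : ‖f‖ ≤ C := by
  refine abs_le_of_sq_le_sq' ?_ h.1 |>.2
  rw [← tsum_sq_coeff]
  refine (summable_sq_coeff f).tsum_le_of_sum_le fun F => ?_
  simpa using (h.mono_exponent hs).2 F

theorem eq_zero (h : SobBound s f 0) : f = 0 := by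
  refine ext_coeff fun k => ?_
  have h1 := h.2 {k}
  have hj : 0 < jap k ^ s := Real.rpow_pos_of_pos (jap_pos k) s
  simp only [Finset.sum_singleton, ne_eq, OfNat.ofNat_ne_zero, not_false_eq_true, zero_pow] at h1
  have : ‖coeff f k‖ ^ 2 ≤ 0 := by
    by_contra! hc
    exact absurd h1 (not_le.2 (mul_pos hj hc))
  rw [coeff_zero, ← norm_eq_zero]
  exact pow_eq_zero_iff (two_ne_zero) |>.1 (le_antisymm this (by positivity))

end SobBound

theorem sobBound_norm (f : L2) : SobBound 0 f ‖f‖ := by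
  refine ⟨norm_nonneg f, fun F => ?_⟩
  rw [← tsum_sq_coeff]
  simpa using (summable_sq_coeff f).sum_le_tsum F fun k _ => by positivity

theorem MemSobolev.mono {s s' : ℝ} {f : L2} (h : MemSobolev s f) (hs : s' ≤ s) :
    MemSobolev s' f := by
  obtain ⟨C, hC⟩ := memSobolev_iff.1 h
  exact (hC.mono_exponent hs).memSobolev

theorem MemSobolev.add {s : ℝ} {f g : L2} (hf : MemSobolev s f) (hg : MemSobolev s g) :
    MemSobolev s (f + g) := by
  obtain ⟨C, hC⟩ := memSobolev_iff.1 hf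
  obtain ⟨D, hD⟩ := memSobolev_iff.1 hg
  exact (hC.add hD).memSobolev

theorem MemSobolev.sub {s : ℝ} {f g : L2} (hf : MemSobolev s f) (hg : MemSobolev s g) :
    MemSobolev s (f - g) := by
  obtain ⟨C, hC⟩ := memSobolev_iff.1 hf
  obtain ⟨D, hD⟩ := memSobolev_iff.1 hg
  exact (hC.sub hD).memSobolev

theorem memSobolev_zero_exponent (f : L2) : MemSobolev 0 f := (sobBound_norm f).memSobolev

/-! ### The heat semigroup -/

theorem norm_heat_symbol_le {t : ℝ} (ht : 0 ≤ t) (k : Fin 2 → ℤ) :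
    ‖(Real.exp (-(t * eigenvalue k)) : ℂ)‖ ≤ 1 := by
  rw [Complex.norm_real, Real.norm_eq_abs, Real.abs_exp]
  exact Real.exp_le_one_iff.2 (neg_nonpos.2 (mul_nonneg ht (eigenvalue_nonneg k)))

theorem coeff_heat {t : ℝ} (ht : 0 ≤ t) (f : L2) (k : Fin 2 → ℤ) :
    coeff (heat t f) k = (Real.exp (-(t * eigenvalue k)) : ℂ) * coeff f k :=
  coeff_multiplier (summable_bounded_multiplier (norm_heat_symbol_le ht) f) k

theorem heat_add {t : ℝ} (ht : 0 ≤ t) (f g : L2) : heat t (f + g) = heat t f + heat t g :=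
  ext_coeff fun k => by simp only [coeff_heat ht, coeff_add, mul_add]

theorem heat_sub {t : ℝ} (ht : 0 ≤ t) (f g : L2) : heat t (f - g) = heat t f - heat t g :=
  ext_coeff fun k => by simp only [coeff_heat ht, coeff_sub, mul_sub]

theorem heat_real_smul {t : ℝ} (ht : 0 ≤ t) (c : ℝ) (f : L2) : heat t (c • f) = c • heat t f :=
  ext_coeff fun k => by simp only [coeff_heat ht, coeff_real_smul]; ring

theorem heat_sum {t : ℝ} (ht : 0 ≤ t) {ι : Type*} (s : Finset ι) (f : ι → L2) :
    heat t (∑ i ∈ s, f i) = ∑ i ∈ s, heat t (f i) :=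
  ext_coeff fun k => by simp only [coeff_heat ht, coeff_sum, Finset.mul_sum]

theorem heat_zero_right {t : ℝ} (ht : 0 ≤ t) : heat t (0 : L2) = 0 :=
  ext_coeff fun k => by simp only [coeff_heat ht, coeff_zero, mul_zero]

theorem heat_zero_left (f : L2) : heat 0 f = f :=
  ext_coeff fun k => by simp [coeff_heat le_rfl]

theorem heat_heat {r t : ℝ} (hr : 0 ≤ r) (ht : 0 ≤ t) (f : L2) :
    heat r (heat t f) = heat (r + t) f :=
  ext_coeff fun k => by
    rw [coeff_heat hr, coeff_heat ht, coeff_heat (add_nonneg hr ht), ← mul_assoc]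
    norm_cast
    rw [← Real.exp_add]
    congr 3
    ring

theorem SobBound.heat {s C : ℝ} {f : L2} (h : SobBound s f C) {t : ℝ} (ht : 0 ≤ t) :
    SobBound s (heat t f) C := by
  have := h.of_coeff_le (g := Vorticity.heat t f) (s' := s) zero_le_one (fun k => ?_)
  · simpa using this
  · rw [sub_self, zero_div, Real.rpow_zero, one_mul, one_mul, coeff_heat ht, norm_mul]
    exact mul_le_of_le_one_left (norm_nonneg _) (norm_heat_symbol_le ht k)

/-- The heat semigroup as a continuous linear map. -/
def heatL (t : ℝ) (ht : 0 ≤ t) : L2 →L[ℂ] L2 :=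
  LinearMap.mkContinuous
    { toFun := heat t
      map_add' := heat_add ht
      map_smul' := fun c f => ext_coeff fun k => by
        simp only [coeff_heat ht, coeff_smul, RingHom.id_apply]; ring } 1 fun f => by
      rw [one_mul]
      exact ((sobBound_norm f).heat ht).norm_le le_rfl

theorem heatL_apply {t : ℝ} (ht : 0 ≤ t) (f : L2) : heatL t ht f = heat t f := rfl

theorem one_add_rpow_le_exp {x θ : ℝ} (hx : 0 ≤ x) (hθ : 0 ≤ θ) :
    (1 + x) ^ θ ≤ (1 + θ) ^ θ * Real.exp x := by
  have h0 : (0 : ℝ) < 1 + θ := by linarith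
  have h1 : 1 + x ≤ (1 + θ) * Real.exp (x / (1 + θ)) := by
    have h2 := Real.add_one_le_exp (x / (1 + θ))
    calc 1 + x ≤ (1 + θ) * (x / (1 + θ) + 1) := by
          rw [mul_add, mul_div_cancel₀ _ h0.ne']; linarith
      _ ≤ _ := by gcongr
  calc (1 + x) ^ θ ≤ ((1 + θ) * Real.exp (x / (1 + θ))) ^ θ := by gcongr
    _ = (1 + θ) ^ θ * Real.exp (x / (1 + θ) * θ) := by
        rw [Real.mul_rpow h0.le (Real.exp_pos _).le, Real.exp_mul]
    _ ≤ (1 + θ) ^ θ * Real.exp x := by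
        gcongr
        rw [div_mul_eq_mul_div, div_le_iff₀ h0]
        nlinarith

/-- Parabolic smoothing: `S_t` gains `2θ` derivatives at the price `t^{-θ}`. -/
theorem SobBound.heat_smoothing {s C : ℝ} {f : L2} (h : SobBound s f C) {t θ : ℝ} (ht : 0 < t)
    (ht1 : t ≤ 1) (hθ : 0 ≤ θ) :
    SobBound (s + 2 * θ) (Vorticity.heat t f) ((1 + θ) ^ θ * t ^ (-θ) * C) := by
  refine h.of_coeff_le (by positivity) fun k => ?_
  have hj := jap_pos k
  have hl := eigenvalue_nonneg k
  rw [coeff_heat ht.le, norm_mul, Complex.norm_real, Real.norm_eq_abs, Real.abs_exp]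
  gcongr
  rw [show (s - (s + 2 * θ)) / 2 = -θ by ring, mul_assoc, ← Real.mul_rpow ht.le hj.le,
    Real.exp_neg, Real.rpow_neg (by positivity), ← div_eq_mul_inv, inv_eq_one_div,
    div_le_div_iff₀ (Real.exp_pos _) (by positivity), one_mul]
  refine le_trans ?_ (one_add_rpow_le_exp (by positivity) hθ)
  gcongr
  unfold jap
  nlinarith

/-- Time regularity of the heat semigroup: `S_t - 1` is of size `t^θ` at the price of `2θ`
derivatives. -/
theorem SobBound.heat_sub_self {s C θ : ℝ} {f : L2} (h : SobBound (s + 2 * θ) f C) {t : ℝ}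
    (ht : 0 ≤ t) (hθ : 0 ≤ θ) (hθ1 : θ ≤ 1) :
    SobBound s (Vorticity.heat t f - f) (t ^ θ * C) := by
  refine h.of_coeff_le (by positivity) fun k => ?_
  have hj := jap_pos k
  have hl := eigenvalue_nonneg k
  have hx : 0 ≤ t * eigenvalue k := by positivity
  rw [coeff_sub, coeff_heat ht, ← sub_one_mul, norm_mul]
  gcongr
  rw [show (s + 2 * θ - s) / 2 = θ by ring, ← Real.mul_rpow ht hj.le]
  have h1 : ‖(Complex.exp (-(t * eigenvalue k) : ℝ) - 1 : ℂ)‖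
      = 1 - Real.exp (-(t * eigenvalue k)) := by
    rw [← Complex.ofReal_exp, ← Complex.ofReal_one, ← Complex.ofReal_sub, Complex.norm_real,
      Real.norm_eq_abs, abs_sub_comm, abs_of_nonneg]
    have := Real.exp_le_one_iff.2 (neg_nonpos.2 hx)
    linarith
  have h2 : 1 - Real.exp (-(t * eigenvalue k)) ≤ 1 := by
    have := Real.exp_pos (-(t * eigenvalue k)); linarith
  have h3 : 1 - Real.exp (-(t * eigenvalue k)) ≤ t * eigenvalue k := by
    have := Real.add_one_le_exp (-(t * eigenvalue k)); linarith
  have h4 : t * eigenvalue k ≤ t * jap k := by unfold jap; nlinarith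
  push_cast at h1 ⊢
  rw [h1]
  rcases le_total (t * jap k) 1 with hle | hge
  · calc _ ≤ t * jap k := h3.trans h4
      _ = (t * jap k) ^ (1 : ℝ) := (Real.rpow_one _).symm
      _ ≤ _ := Real.rpow_le_rpow_of_exponent_ge' (by positivity) hle hθ hθ1
  · exact h2.trans (Real.one_le_rpow hge hθ)

end

/-! ### Products in Sobolev spaces -/

theorem memLp_continuous_mul (φ : C(Torus, ℂ)) (g : L2) :
    MemLp (fun x => φ x * g x) 2 torusMeasure := by
  refine MemLp.of_le_mul (c := ‖φ‖) (Lp.memLp g)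
    (φ.continuous.aestronglyMeasurable.mul (Lp.aestronglyMeasurable g)) (ae_of_all _ fun x => ?_)
  rw [norm_mul]
  gcongr
  exact φ.norm_coe_le_norm x

/-- Multiplication of a fixed `g ∈ L²` by continuous functions, as a continuous linear map. -/
def mulCont (g : L2) : C(Torus, ℂ) →L[ℂ] L2 :=
  LinearMap.mkContinuous
    { toFun := fun φ => (memLp_continuous_mul φ g).toLp _
      map_add' := fun φ ψ => by
        rw [← MemLp.toLp_add]
        exact MemLp.toLp_congr _ _ (ae_of_all _ fun x => by simp [add_mul])
      map_smul' := fun c φ => by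
        rw [RingHom.id_apply, ← MemLp.toLp_const_smul]
        exact MemLp.toLp_congr _ _ (ae_of_all _ fun x => by simp [mul_assoc]) } ‖g‖ fun φ => by
      rw [mul_comm]
      refine Lp.norm_le_mul_norm_of_ae_le_mul ?_
      filter_upwards [(memLp_continuous_mul φ g).coeFn_toLp] with x hx
      simp only [LinearMap.coe_mk, AddHom.coe_mk, hx, norm_mul]
      gcongr
      exact φ.norm_coe_le_norm x

theorem coeFn_mulCont (g : L2) (φ : C(Torus, ℂ)) :
    mulCont g φ =ᵐ[torusMeasure] fun x => φ x * g x :=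
  (memLp_continuous_mul φ g).coeFn_toLp

theorem coeff_mulCont_mFourier (g : L2) (m k : Fin 2 → ℤ) :
    coeff (mulCont g (UnitAddTorus.mFourier m)) k = coeff g (k - m) := by
  refine integral_congr_ae ?_
  filter_upwards [coeFn_mulCont g (UnitAddTorus.mFourier m)] with x hx
  rw [hx, smul_eq_mul, smul_eq_mul, ← mul_assoc, ← UnitAddTorus.mFourier_add, neg_sub,
    neg_add_eq_sub]

/-- The continuous representative of a field with absolutely summable Fourier series. -/
def wienerFun (v : L2) : C(Torus, ℂ) := ∑' m, coeff v m • UnitAddTorus.mFourier m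

theorem hasSum_wienerFun {v : L2} (hv : Summable fun m => ‖coeff v m‖) :
    HasSum (fun m => coeff v m • UnitAddTorus.mFourier m) (wienerFun v) := by
  refine Summable.hasSum (Summable.of_norm ?_)
  simpa only [norm_smul, UnitAddTorus.mFourier_norm, mul_one] using hv

theorem coeFn_wienerFun {v : L2} (hv : Summable fun m => ‖coeff v m‖) :
    v =ᵐ[torusMeasure] wienerFun v := by
  have h : HasSum (fun m => coeff v m • mode m)
      (ContinuousMap.toLp (E := ℂ) 2 torusMeasure ℂ (wienerFun v)) := by
    have := (ContinuousMap.toLp (E := ℂ) 2 torusMeasure ℂ).hasSum (hasSum_wienerFun hv)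
    simp only [map_smul] at this
    exact this
  have h2 := h.unique (hasSum_coeff_smul_mode v)
  have h3 := ContinuousMap.coeFn_toLp (p := 2) (𝕜 := ℂ) torusMeasure (wienerFun v)
  rw [h2] at h3
  exact h3

/-- The product `v g` of a field with absolutely summable Fourier series and an `L²` field. -/
def wienerMul (v g : L2) : L2 := mulCont g (wienerFun v)

theorem hasSum_wienerMul {v : L2} (hv : Summable fun m => ‖coeff v m‖) (g : L2) :
    HasSum (fun m => coeff v m • mulCont g (UnitAddTorus.mFourier m)) (wienerMul v g) := by
  have := (mulCont g).hasSum (hasSum_wienerFun hv)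
  simp only [map_smul] at this
  exact this

theorem hasSum_coeff_wienerMul {v : L2} (hv : Summable fun m => ‖coeff v m‖) (g : L2)
    (k : Fin 2 → ℤ) :
    HasSum (fun m => coeff v m * coeff g (k - m)) (coeff (wienerMul v g) k) := by
  have := (coeffL k).hasSum (hasSum_wienerMul hv g)
  simpa only [map_smul, coeffL_apply, coeff_mulCont_mFourier, smul_eq_mul] using this

theorem coeFn_wienerMul {v : L2} (hv : Summable fun m => ‖coeff v m‖) (g : L2) :
    wienerMul v g =ᵐ[torusMeasure] fun x => v x * g x := by
  filter_upwards [coeFn_mulCont g (wienerFun v), coeFn_wienerFun hv] with x h1 h2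
  rw [wienerMul, h1, h2]

theorem wienerMul_add_right {v : L2} (hv : Summable fun m => ‖coeff v m‖) (f g : L2) :
    wienerMul v (f + g) = wienerMul v f + wienerMul v g := by
  refine ext_coeff fun k => ?_
  rw [coeff_add]
  refine (hasSum_coeff_wienerMul hv (f + g) k).unique ?_
  simpa only [coeff_add, mul_add] using
    (hasSum_coeff_wienerMul hv f k).add (hasSum_coeff_wienerMul hv g k)

theorem wienerMul_add_left {v w : L2} (hv : Summable fun m => ‖coeff v m‖)
    (hw : Summable fun m => ‖coeff w m‖) (f : L2) :
    wienerMul (v + w) f = wienerMul v f + wienerMul w f := by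
  refine ext_coeff fun k => ?_
  have hvw : Summable fun m => ‖coeff (v + w) m‖ := by
    refine Summable.of_nonneg_of_le (fun _ => norm_nonneg _) (fun m => ?_) (hv.add hw)
    rw [coeff_add]
    exact norm_add_le _ _
  rw [coeff_add]
  refine (hasSum_coeff_wienerMul hvw f k).unique ?_
  simpa only [coeff_add, add_mul] using
    (hasSum_coeff_wienerMul hv f k).add (hasSum_coeff_wienerMul hw f k)

/-- The weighted Wiener norm `∑ₘ (1 + 4π²|m|²)^{p/2} |v̂(m)|` is at most `A`. -/
def WienerBound (p : ℝ) (v : L2) (A : ℝ) : Prop :=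
  ∀ F : Finset (Fin 2 → ℤ), ∑ m ∈ F, jap m ^ (p / 2) * ‖coeff v m‖ ≤ A

theorem WienerBound.summable {p A : ℝ} {v : L2} (h : WienerBound p v A) (hp : 0 ≤ p) :
    Summable fun m => ‖coeff v m‖ := by
  refine summable_of_sum_le (c := A) (fun _ => norm_nonneg _) fun F => ?_
  refine (Finset.sum_le_sum fun m _ => ?_).trans (h F)
  exact le_mul_of_one_le_left (norm_nonneg _)
    (Real.one_le_rpow (one_le_jap m) (by positivity))

/-- Peetre's inequality for the Fourier weight. -/
theorem jap_le_mul (k m : Fin 2 → ℤ) : jap k ≤ 2 * jap m * jap (k - m) := by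
  have hpi : 0 ≤ Real.pi ^ 2 := by positivity
  simp only [jap, eigenvalue, Fin.sum_univ_two, Pi.sub_apply, Int.cast_sub]
  nlinarith [mul_nonneg hpi (sq_nonneg ((k 0 : ℝ) - 2 * m 0)),
    mul_nonneg hpi (sq_nonneg ((k 1 : ℝ) - 2 * m 1)),
    mul_nonneg (mul_nonneg hpi hpi) (mul_nonneg
      (add_nonneg (sq_nonneg (m 0 : ℝ)) (sq_nonneg (m 1 : ℝ)))
      (add_nonneg (sq_nonneg ((k 0 : ℝ) - m 0)) (sq_nonneg ((k 1 : ℝ) - m 1))))]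

theorem jap_neg (k : Fin 2 → ℤ) : jap (-k) = jap k := by
  simp [jap, eigenvalue]

theorem jap_rpow_le_mul (r : ℝ) (k m : Fin 2 → ℤ) :
    jap k ^ r ≤ (2 * jap m) ^ |r| * jap (k - m) ^ r := by
  have hk := jap_pos k
  have hm := jap_pos m
  have hkm := jap_pos (k - m)
  rcases le_total 0 r with hr | hr
  · rw [abs_of_nonneg hr, ← Real.mul_rpow (by positivity) hkm.le]
    exact Real.rpow_le_rpow hk.le (jap_le_mul k m) hr
  · have h := jap_le_mul (k - m) (-m)
    rw [jap_neg, sub_neg_eq_add, sub_add_cancel] at h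
    rw [abs_of_nonpos hr]
    have h2 : jap (k - m) ^ (-r) ≤ (2 * jap m) ^ (-r) * jap k ^ (-r) := by
      rw [← Real.mul_rpow (by positivity) hk.le]
      exact Real.rpow_le_rpow hkm.le h (by linarith)
    calc jap k ^ r = jap (k - m) ^ (-r) * (jap k ^ r * jap (k - m) ^ r) := by
          rw [mul_left_comm, ← Real.rpow_add hkm, neg_add_cancel, Real.rpow_zero, mul_one]
      _ ≤ ((2 * jap m) ^ (-r) * jap k ^ (-r)) * (jap k ^ r * jap (k - m) ^ r) := by gcongr
      _ = (2 * jap m) ^ (-r) * jap (k - m) ^ r * (jap k ^ (-r) * jap k ^ r) := by ring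
      _ = _ := by rw [← Real.rpow_add hk, neg_add_cancel, Real.rpow_zero, mul_one]

theorem SobBound.mulCont_mFourier {r B : ℝ} {g : L2} (h : SobBound r g B) (m : Fin 2 → ℤ) :
    SobBound r (mulCont g (UnitAddTorus.mFourier m)) (2 ^ (|r| / 2) * jap m ^ (|r| / 2) * B) := by
  have hm := jap_pos m
  refine ⟨mul_nonneg (by positivity) h.1, fun F => ?_⟩
  have hF := h.2 (F.map (Equiv.subRight m).toEmbedding)
  rw [Finset.sum_map] at hF
  simp only [Equiv.coe_toEmbedding, Equiv.subRight_apply] at hF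
  calc ∑ k ∈ F, jap k ^ r * ‖coeff (mulCont g (UnitAddTorus.mFourier m)) k‖ ^ 2
      ≤ ∑ k ∈ F, (2 * jap m) ^ |r| * (jap (k - m) ^ r * ‖coeff g (k - m)‖ ^ 2) := by
        refine Finset.sum_le_sum fun k _ => ?_
        rw [coeff_mulCont_mFourier, ← mul_assoc]
        gcongr
        exact jap_rpow_le_mul r k m
    _ ≤ (2 * jap m) ^ |r| * B ^ 2 := by
        rw [← Finset.mul_sum]
        gcongr
    _ = (2 ^ (|r| / 2) * jap m ^ (|r| / 2) * B) ^ 2 := by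
        rw [mul_pow, ← Real.mul_rpow (by norm_num) hm.le, ← Real.rpow_mul_natCast (by positivity)]
        congr 2
        push_cast; ring

/-- Multiplication by a field in the weighted Wiener algebra is bounded on `H^r`, also for
negative `r`. -/
theorem SobBound.wienerMul {r A B : ℝ} {v g : L2} (hv : WienerBound |r| v A)
    (hg : SobBound r g B) : SobBound r (wienerMul v g) (2 ^ (|r| / 2) * A * B) := by
  refine SobBound.of_tendsto (hasSum_wienerMul (hv.summable (abs_nonneg r)) g) tendsto_const_nhds
    (Eventually.of_forall fun F => ?_)
  refine (SobBound.sum F fun m _ => (hg.mulCont_mFourier m).smul (coeff v m)).mono ?_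
  calc ∑ m ∈ F, ‖coeff v m‖ * (2 ^ (|r| / 2) * jap m ^ (|r| / 2) * B)
      = 2 ^ (|r| / 2) * (∑ m ∈ F, jap m ^ (|r| / 2) * ‖coeff v m‖) * B := by
        rw [Finset.mul_sum, Finset.sum_mul]
        exact Finset.sum_congr rfl fun m _ => by ring
    _ ≤ _ := by
        have := hg.1
        gcongr
        exact hv F

theorem one_le_eigenvalue {k : Fin 2 → ℤ} (hk : k ≠ 0) : 1 ≤ eigenvalue k := by
  have h1 : (1 : ℝ) ≤ ∑ j, (k j : ℝ) ^ 2 := by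
    obtain ⟨j, hj⟩ := Function.ne_iff.1 hk
    have h2 : (1 : ℝ) ≤ (k j : ℝ) ^ 2 := by
      have : (1 : ℤ) ≤ k j ^ 2 := Int.add_one_le_iff.2 (sq_pos_of_ne_zero hj)
      exact_mod_cast this
    exact h2.trans (Finset.single_le_sum (f := fun j => (k j : ℝ) ^ 2)
      (fun i _ => sq_nonneg _) (Finset.mem_univ j))
  unfold eigenvalue
  nlinarith [Real.pi_gt_three]

theorem summable_jap_rpow {δ : ℝ} (hδ : 0 < δ) :
    Summable fun m : Fin 2 → ℤ => jap m ^ (-(1 + δ)) := by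
  refine Summable.of_norm_bounded_eventually
    (EisensteinSeries.summable_one_div_norm_rpow (k := 2 * (1 + δ)) (by linarith)) ?_
  have : ∀ᶠ m : Fin 2 → ℤ in cofinite, m ≠ 0 := (finite_singleton _).compl_mem_cofinite
  filter_upwards [this] with m hm
  have hj := jap_pos m
  have hn : 0 < ‖m‖ := norm_pos_iff.2 hm
  rw [Real.norm_of_nonneg (by positivity), Real.rpow_neg hj.le, Real.rpow_neg hn.le]
  gcongr
  rw [Real.rpow_mul hn.le, Real.rpow_two]
  gcongr
  obtain ⟨j, hj⟩ : ∃ j, ‖m‖ = ‖m j‖ := by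
    obtain ⟨j, -, hj⟩ := Finset.exists_mem_eq_sup' Finset.univ_nonempty (fun j => ‖m j‖₊)
    refine ⟨j, ?_⟩
    rw [Pi.norm_def, ← Finset.sup'_eq_sup Finset.univ_nonempty, hj]; rfl
  have h1 : (m j : ℝ) ^ 2 ≤ ∑ j, (m j : ℝ) ^ 2 :=
    Finset.single_le_sum (f := fun j => (m j : ℝ) ^ 2) (fun i _ => sq_nonneg _) (Finset.mem_univ j)
  rw [hj, Int.norm_eq_abs, sq_abs]
  have hpi : 1 ≤ 4 * Real.pi ^ 2 := by nlinarith [Real.pi_gt_three]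
  have h0 := (sq_nonneg (m j : ℝ)).trans h1
  unfold jap eigenvalue
  nlinarith

/-- The constant of the embedding of `H^{p+1+δ}` into the Wiener algebra of weight `p`. -/
def wienerConst (δ : ℝ) : ℝ := √(∑' m : Fin 2 → ℤ, jap m ^ (-(1 + δ)))

theorem SobBound.wienerBound {p δ A : ℝ} {v : L2} (h : SobBound (p + 1 + δ) v A) (hδ : 0 < δ) :
    WienerBound p v (wienerConst δ * A) := by
  intro F
  refine abs_le_of_sq_le_sq' ?_ (mul_nonneg (Real.sqrt_nonneg _) h.1) |>.2
  have hs := summable_jap_rpow hδ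
  have hnn : ∀ m : Fin 2 → ℤ, 0 ≤ jap m ^ (-(1 + δ)) := fun m => by
    have := jap_pos m
    positivity
  calc (∑ m ∈ F, jap m ^ (p / 2) * ‖coeff v m‖) ^ 2
      = (∑ m ∈ F, jap m ^ (-(1 + δ) / 2) * (jap m ^ ((p + 1 + δ) / 2) * ‖coeff v m‖)) ^ 2 := by
        congr 1
        refine Finset.sum_congr rfl fun m _ => ?_
        rw [← mul_assoc, ← Real.rpow_add (jap_pos m)]
        congr 2
        ring
    _ ≤ (∑ m ∈ F, (jap m ^ (-(1 + δ) / 2)) ^ 2) *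
          ∑ m ∈ F, (jap m ^ ((p + 1 + δ) / 2) * ‖coeff v m‖) ^ 2 :=
        Finset.sum_mul_sq_le_sq_mul_sq F _ _
    _ = (∑ m ∈ F, jap m ^ (-(1 + δ))) * ∑ m ∈ F, jap m ^ (p + 1 + δ) * ‖coeff v m‖ ^ 2 := by
        congr 1 <;> refine Finset.sum_congr rfl fun m _ => ?_
        · rw [← Real.rpow_mul_natCast (jap_pos m).le]
          congr 1
          push_cast; ring
        · rw [mul_pow, ← Real.rpow_mul_natCast (jap_pos m).le]
          congr 2
          push_cast; ring
    _ ≤ (∑' m : Fin 2 → ℤ, jap m ^ (-(1 + δ))) * A ^ 2 := by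
        gcongr
        · exact Finset.sum_nonneg fun m _ => mul_nonneg (by have := jap_pos m; positivity)
            (by positivity)
        · exact tsum_nonneg hnn
        · exact hs.sum_le_tsum F fun m _ => hnn m
        · exact h.2 F
    _ = (wienerConst δ * A) ^ 2 := by
        rw [mul_pow, wienerConst, Real.sq_sqrt (tsum_nonneg hnn)]

/-! ### Derivatives, transport and the Biot-Savart law -/

theorem norm_partialDeriv_symbol_le (j : Fin 2) (k : Fin 2 → ℤ) :
    ‖(2 * Real.pi * Complex.I * (k j : ℂ) : ℂ)‖ ≤ eigenvalue k ^ (1 / 2 : ℝ) := by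
  rw [← Real.sqrt_eq_rpow]
  refine Real.le_sqrt_of_sq_le ?_
  have h1 : (k j : ℝ) ^ 2 ≤ ∑ j, (k j : ℝ) ^ 2 :=
    Finset.single_le_sum (f := fun j => (k j : ℝ) ^ 2) (fun i _ => sq_nonneg _) (Finset.mem_univ j)
  have h2 : ‖(2 * Real.pi * Complex.I * (k j : ℂ) : ℂ)‖ = 2 * Real.pi * |(k j : ℝ)| := by
    simp [abs_of_nonneg Real.pi_pos.le]
  rw [h2, mul_pow, sq_abs]
  unfold eigenvalue
  nlinarith [Real.pi_pos]

theorem norm_partialDeriv_symbol_le_jap (j : Fin 2) (k : Fin 2 → ℤ) :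
    ‖(2 * Real.pi * Complex.I * (k j : ℂ) : ℂ)‖ ≤ jap k ^ (1 / 2 : ℝ) :=
  (norm_partialDeriv_symbol_le j k).trans (Real.rpow_le_rpow (eigenvalue_nonneg k)
    (by unfold jap; linarith) (by norm_num))

theorem coeff_partialDeriv {f : L2} (hf : MemSobolev 1 f) (j : Fin 2) (k : Fin 2 → ℤ) :
    coeff (partialDeriv j f) k = 2 * Real.pi * Complex.I * (k j : ℂ) * coeff f k := by
  refine coeff_multiplier ?_ k
  obtain ⟨C, hC⟩ := memSobolev_iff.1 hf
  refine summable_of_sum_le (c := C ^ 2) (fun _ => by positivity) fun F =>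
    (Finset.sum_le_sum fun k _ => ?_).trans (hC.2 F)
  rw [norm_mul, mul_pow]
  gcongr
  calc _ ≤ (jap k ^ (1 / 2 : ℝ)) ^ 2 := by
        gcongr
        exact norm_partialDeriv_symbol_le_jap j k
    _ = jap k ^ (1 : ℝ) := by
        rw [← Real.rpow_mul_natCast (jap_pos k).le]
        norm_num

theorem SobBound.partialDeriv {r C : ℝ} {f : L2} (hf : MemSobolev 1 f) (h : SobBound (r + 1) f C)
    (j : Fin 2) : SobBound r (partialDeriv j f) C := by
  have := h.of_coeff_le (g := Vorticity.partialDeriv j f) (s' := r) zero_le_one fun k => ?_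
  · simpa using this
  · rw [coeff_partialDeriv hf, norm_mul, add_sub_cancel_left, one_mul]
    gcongr
    exact norm_partialDeriv_symbol_le_jap j k

theorem partialDeriv_add {f g : L2} (hf : MemSobolev 1 f) (hg : MemSobolev 1 g) (j : Fin 2) :
    partialDeriv j (f + g) = partialDeriv j f + partialDeriv j g :=
  ext_coeff fun k => by
    rw [coeff_add, coeff_partialDeriv hf, coeff_partialDeriv hg, coeff_partialDeriv (hf.add hg),
      coeff_add, mul_add]

theorem transport_eq_sum {v : Fin 2 → L2} (hv : ∀ j, Summable fun m => ‖coeff (v j) m‖) (f : L2) :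
    transport v f = ∑ j, wienerMul (v j) (partialDeriv j f) := by
  have h : (∑ j, wienerMul (v j) (partialDeriv j f) : L2) =ᵐ[torusMeasure]
      fun x => ∑ j, (v j) x * (partialDeriv j f) x := by
    rw [Fin.sum_univ_two]
    filter_upwards [Lp.coeFn_add (wienerMul (v 0) (partialDeriv 0 f))
      (wienerMul (v 1) (partialDeriv 1 f)), coeFn_wienerMul (hv 0) (partialDeriv 0 f),
      coeFn_wienerMul (hv 1) (partialDeriv 1 f)] with x h1 h2 h3
    rw [h1, Pi.add_apply, h2, h3, Fin.sum_univ_two]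
  have hmem := (memLp_congr_ae h).1 (Lp.memLp _)
  rw [transport, dif_pos hmem]
  refine Lp.ext ?_
  filter_upwards [hmem.coeFn_toLp, h] with x h1 h2
  rw [h1, h2]

/-- The basic estimate `‖v · ∇f‖_{H^r} ≤ C ‖v‖ ‖f‖_{H^{r+1}}` with a Wiener norm of `v`. -/
theorem SobBound.transport {r A B : ℝ} {v : Fin 2 → L2} {f : L2}
    (hv : ∀ j, WienerBound |r| (v j) A) (hf : MemSobolev 1 f) (h : SobBound (r + 1) f B) :
    SobBound r (transport v f) (2 * 2 ^ (|r| / 2) * A * B) := by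
  rw [transport_eq_sum fun j => (hv j).summable (abs_nonneg r)]
  refine (SobBound.sum Finset.univ fun j _ =>
    SobBound.wienerMul (hv j) (h.partialDeriv hf j)).mono (le_of_eq ?_)
  rw [Fin.sum_univ_two]; ring

theorem hasSum_coeff_transport {v : Fin 2 → L2} (hv : ∀ j, Summable fun m => ‖coeff (v j) m‖)
    {f : L2} (hf : MemSobolev 1 f) (k : Fin 2 → ℤ) :
    HasSum (fun m => ∑ j, coeff (v j) m *
      (2 * Real.pi * Complex.I * ((k - m) j : ℂ) * coeff f (k - m))) (coeff (transport v f) k) := by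
  rw [transport_eq_sum hv, coeff_sum]
  simp only [← coeff_partialDeriv hf]
  exact hasSum_sum fun j _ => hasSum_coeff_wienerMul (hv j) _ k

theorem transport_add_right {v : Fin 2 → L2} (hv : ∀ j, Summable fun m => ‖coeff (v j) m‖)
    {f g : L2} (hf : MemSobolev 1 f) (hg : MemSobolev 1 g) :
    transport v (f + g) = transport v f + transport v g := by
  simp only [transport_eq_sum hv, ← Finset.sum_add_distrib]
  refine Finset.sum_congr rfl fun j _ => ?_
  rw [partialDeriv_add hf hg, wienerMul_add_right (hv j)]

theorem summable_coeff_add {v w : L2} (hv : Summable fun m => ‖coeff v m‖)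
    (hw : Summable fun m => ‖coeff w m‖) : Summable fun m => ‖coeff (v + w) m‖ := by
  refine Summable.of_nonneg_of_le (fun _ => norm_nonneg _) (fun m => ?_) (hv.add hw)
  rw [coeff_add]
  exact norm_add_le _ _

theorem transport_add_left {v w : Fin 2 → L2} (hv : ∀ j, Summable fun m => ‖coeff (v j) m‖)
    (hw : ∀ j, Summable fun m => ‖coeff (w j) m‖) (f : L2) :
    transport (v + w) f = transport v f + transport w f := by
  rw [transport_eq_sum hv, transport_eq_sum hw, transport_eq_sum (v := v + w)
    fun j => summable_coeff_add (hv j) (hw j), ← Finset.sum_add_distrib]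
  exact Finset.sum_congr rfl fun j _ => wienerMul_add_left (hv j) (hw j) _

/-- The symbol of the components of the Biot-Savart operator. -/
def biotSavartSymbol : Fin 2 → (Fin 2 → ℤ) → ℂ :=
  ![fun k => -(2 * Real.pi * Complex.I * (k 1 : ℂ)) * invLaplaceSymbol k,
    fun k => (2 * Real.pi * Complex.I * (k 0 : ℂ)) * invLaplaceSymbol k]

theorem biotSavart_apply (f : L2) (j : Fin 2) :
    biotSavart f j = multiplier (biotSavartSymbol j) f := by
  fin_cases j <;> rfl

/-- The Biot-Savart operator gains one derivative. -/
theorem norm_biotSavartSymbol_le (j : Fin 2) (k : Fin 2 → ℤ) :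
    ‖biotSavartSymbol j k‖ ≤ 2 * jap k ^ (-1 / 2 : ℝ) := by
  have hj := jap_pos k
  have key : ∀ i : Fin 2, ‖(2 * Real.pi * Complex.I * (k i : ℂ)) * invLaplaceSymbol k‖
      ≤ 2 * jap k ^ (-1 / 2 : ℝ) := by
    intro i
    rcases eq_or_ne k 0 with rfl | hk
    · simp only [invLaplaceSymbol, if_true, mul_zero, norm_zero]; positivity
    · have hl := one_le_eigenvalue hk
      have hl0 : 0 < eigenvalue k := by linarith
      rw [norm_mul, invLaplaceSymbol, if_neg hk, norm_neg, norm_inv, Complex.norm_real,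
        Real.norm_of_nonneg hl0.le]
      calc _ ≤ eigenvalue k ^ (1 / 2 : ℝ) * (eigenvalue k)⁻¹ := by
            gcongr
            exact norm_partialDeriv_symbol_le i k
        _ = eigenvalue k ^ (-1 / 2 : ℝ) := by
            rw [← Real.rpow_neg_one, ← Real.rpow_add hl0]; norm_num
        _ ≤ (jap k / 2) ^ (-1 / 2 : ℝ) := by
            refine Real.rpow_le_rpow_of_nonpos (by positivity) ?_ (by norm_num)
            unfold jap; linarith
        _ = 2 ^ (1 / 2 : ℝ) * jap k ^ (-1 / 2 : ℝ) := by
            rw [Real.div_rpow hj.le (by norm_num), div_eq_mul_inv, ← Real.rpow_neg (by norm_num),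
              mul_comm]
            norm_num
        _ ≤ 2 * jap k ^ (-1 / 2 : ℝ) := by
            gcongr
            calc (2 : ℝ) ^ (1 / 2 : ℝ) ≤ 2 ^ (1 : ℝ) :=
                  Real.rpow_le_rpow_of_exponent_le (by norm_num) (by norm_num)
              _ = 2 := Real.rpow_one 2
  fin_cases j
  · have : biotSavartSymbol 0 k = -(2 * Real.pi * Complex.I * (k 1 : ℂ) * invLaplaceSymbol k) := by
      simp [biotSavartSymbol]
    change ‖biotSavartSymbol 0 k‖ ≤ _
    rw [this, norm_neg]
    exact key 1
  · exact key 0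

theorem coeff_biotSavart (f : L2) (j : Fin 2) (k : Fin 2 → ℤ) :
    coeff (biotSavart f j) k = biotSavartSymbol j k * coeff f k := by
  rw [biotSavart_apply]
  refine coeff_multiplier (summable_bounded_multiplier (M := 2) (fun k => ?_) f) k
  refine (norm_biotSavartSymbol_le j k).trans ?_
  have := Real.rpow_le_one_of_one_le_of_nonpos (one_le_jap k) (show (-1 / 2 : ℝ) ≤ 0 by norm_num)
  linarith

theorem biotSavart_add (f g : L2) : biotSavart (f + g) = biotSavart f + biotSavart g := by
  funext j
  refine ext_coeff fun k => ?_
  rw [Pi.add_apply, coeff_add]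
  simp only [coeff_biotSavart, coeff_add, mul_add]

theorem SobBound.biotSavart {s C : ℝ} {f : L2} (h : SobBound s f C) (j : Fin 2) :
    SobBound (s + 1) (biotSavart f j) (2 * C) := by
  refine h.of_coeff_le (by norm_num) fun k => ?_
  rw [coeff_biotSavart, norm_mul]
  gcongr
  rw [show (s - (s + 1)) / 2 = -1 / 2 by ring]
  exact norm_biotSavartSymbol_le j k

theorem summable_coeff_biotSavart {δ : ℝ} (hδ : 0 < δ) {f : L2} (hf : MemSobolev δ f) (j : Fin 2) :
    Summable fun m => ‖coeff (biotSavart f j) m‖ := by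
  obtain ⟨C, hC⟩ := memSobolev_iff.1 hf
  have h : SobBound (0 + 1 + δ) (Vorticity.biotSavart f j) (2 * C) := by
    have := hC.biotSavart j
    rwa [zero_add, add_comm]
  exact (h.wienerBound hδ).summable le_rfl

/-- The nonlinearity `B(f, g) = (K ∗ f) · ∇g`. -/
def advection (f g : L2) : L2 := transport (biotSavart f) g

theorem advection_add_left {f f' g : L2} {δ : ℝ} (hδ : 0 < δ) (hf : MemSobolev δ f)
    (hf' : MemSobolev δ f') :
    advection (f + f') g = advection f g + advection f' g := by
  rw [advection, biotSavart_add, transport_add_left (summable_coeff_biotSavart hδ hf)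
    (summable_coeff_biotSavart hδ hf')]
  rfl

theorem advection_add_right {f g g' : L2} {δ : ℝ} (hδ : 0 < δ) (hf : MemSobolev δ f)
    (hg : MemSobolev 1 g) (hg' : MemSobolev 1 g') :
    advection f (g + g') = advection f g + advection f g' :=
  transport_add_right (summable_coeff_biotSavart hδ hf) hg hg'

theorem SobBound.advection {r δ A B : ℝ} {f g : L2} (hδ : 0 < δ) (hf : SobBound (|r| + δ) f A)
    (hg1 : MemSobolev 1 g) (hg : SobBound (r + 1) g B) :
    SobBound r (advection f g) (4 * 2 ^ (|r| / 2) * wienerConst δ * A * B) := by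
  have hv : ∀ j, WienerBound |r| (Vorticity.biotSavart f j) (wienerConst δ * (2 * A)) := fun j => by
    refine SobBound.wienerBound ?_ hδ
    rw [show |r| + 1 + δ = |r| + δ + 1 by ring]
    exact hf.biotSavart j
  refine (SobBound.transport hv hg1 hg).mono (le_of_eq ?_)
  ring

/-! ### Real fields -/

theorem coeff_star (f : L2) (k : Fin 2 → ℤ) :
    coeff (star f) k = starRingEnd ℂ (coeff f (-k)) := by
  unfold coeff UnitAddTorus.mFourierCoeff
  rw [← integral_conj]
  refine integral_congr_ae ?_
  filter_upwards [Lp.coeFn_star f] with x hx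
  rw [hx, neg_neg, UnitAddTorus.mFourier_neg, Pi.star_apply, smul_eq_mul, smul_eq_mul, map_mul]
  rfl

theorem isReal_iff {f : L2} : IsReal f ↔ ∀ k, coeff f (-k) = starRingEnd ℂ (coeff f k) := by
  have h1 : IsReal f ↔ star f = f := by
    constructor
    · intro h
      refine Lp.ext ?_
      filter_upwards [Lp.coeFn_star f, h] with x hx h0
      rw [hx]
      exact Complex.conj_eq_iff_im.2 h0
    · intro h
      have h2 := Lp.coeFn_star f
      rw [h] at h2
      filter_upwards [h2] with x hx
      exact Complex.conj_eq_iff_im.1 hx.symm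
  rw [h1]
  constructor
  · intro h k
    conv_lhs => rw [← h]
    rw [coeff_star, neg_neg]
  · intro h
    exact ext_coeff fun k => by rw [coeff_star, h, Complex.conj_conj]

theorem IsReal.sub {f g : L2} (hf : IsReal f) (hg : IsReal g) : IsReal (f - g) := by
  rw [isReal_iff] at *
  intro k
  rw [coeff_sub, coeff_sub, hf, hg, map_sub]

theorem IsReal.real_smul {f : L2} (hf : IsReal f) (c : ℝ) : IsReal (c • f) := by
  rw [isReal_iff] at *
  intro k
  rw [coeff_real_smul, coeff_real_smul, hf, map_mul, Complex.conj_ofReal]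

theorem isReal_zero : IsReal 0 := by
  rw [isReal_iff]
  intro k
  simp [coeff_zero]

theorem IsReal.sum {ι : Type*} (s : Finset ι) {f : ι → L2} (h : ∀ i ∈ s, IsReal (f i)) :
    IsReal (∑ i ∈ s, f i) := by
  rw [isReal_iff]
  intro k
  rw [coeff_sum, coeff_sum, map_sum]
  exact Finset.sum_congr rfl fun i hi => isReal_iff.1 (h i hi) k

theorem IsReal.of_tendsto {ι : Type*} {l : Filter ι} [l.NeBot] {f : ι → L2} {g : L2}
    (hf : Tendsto f l (𝓝 g)) (h : ∀ i, IsReal (f i)) : IsReal g := by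
  rw [isReal_iff]
  intro k
  refine tendsto_nhds_unique (tendsto_coeff hf (-k)) ?_
  simp only [fun i => isReal_iff.1 (h i) k]
  exact ((Complex.continuous_conj.tendsto _).comp (tendsto_coeff hf k))

theorem eigenvalue_neg (k : Fin 2 → ℤ) : eigenvalue (-k) = eigenvalue k := by
  simp [eigenvalue]

theorem IsReal.heat {f : L2} (hf : IsReal f) {t : ℝ} (ht : 0 ≤ t) : IsReal (heat t f) := by
  rw [isReal_iff] at *
  intro k
  rw [coeff_heat ht, coeff_heat ht, hf, map_mul, Complex.conj_ofReal, eigenvalue_neg]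

theorem IsReal.partialDeriv {f : L2} (hf : IsReal f) (h : MemSobolev 1 f) (j : Fin 2) :
    IsReal (partialDeriv j f) := by
  rw [isReal_iff] at *
  intro k
  rw [coeff_partialDeriv h, coeff_partialDeriv h, hf]
  have h2 : starRingEnd ℂ 2 = 2 := map_ofNat _ 2
  simp [h2]

theorem IsReal.biotSavart {f : L2} (hf : IsReal f) (j : Fin 2) : IsReal (biotSavart f j) := by
  rw [isReal_iff] at *
  intro k
  have hs : biotSavartSymbol j (-k) = starRingEnd ℂ (biotSavartSymbol j k) := by
    have hi : invLaplaceSymbol (-k) = starRingEnd ℂ (invLaplaceSymbol k) := by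
      simp only [invLaplaceSymbol, neg_eq_zero, eigenvalue_neg]
      split_ifs <;> simp
    have h2 : starRingEnd ℂ 2 = 2 := map_ofNat _ 2
    fin_cases j <;> simp [biotSavartSymbol, hi, h2]
  rw [coeff_biotSavart, coeff_biotSavart, hf, hs, map_mul]

theorem IsReal.transport {v : Fin 2 → L2} {f : L2} (hv : ∀ j, IsReal (v j)) (hf : IsReal f)
    (h : MemSobolev 1 f) : IsReal (transport v f) := by
  unfold Vorticity.transport
  split_ifs with hm
  · filter_upwards [hm.coeFn_toLp, hv 0, hv 1, hf.partialDeriv h 0, hf.partialDeriv h 1]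
      with x h1 h2 h3 h4 h5
    rw [h1, Fin.sum_univ_two, Complex.add_im, Complex.mul_im, Complex.mul_im, h2, h3, h4, h5]
    simp
  · exact isReal_zero

section

/-! ### Young convolution integrals -/

/-- The increment of the driver over the `n`-th dyadic interval of level `k`. -/
def dyadicIncr (W : ℝ≥0 → ℝ) (k n : ℕ) : ℝ :=
  W (((n : ℝ≥0) + 1) / 2 ^ k) - W ((n : ℝ≥0) / 2 ^ k)

/-- The dyadic increments of `W` inside `[0,1]` obey a `β`-Hölder bound with constant `K`.  Only
these increments enter the Young integral. -/
def DyadicHolder (β K : ℝ) (W : ℝ≥0 → ℝ) : Prop :=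
  ∀ k n : ℕ, n < 2 ^ k → |dyadicIncr W k n| ≤ K * ((2 : ℝ) ^ k) ^ (-β)

theorem DyadicHolder.nonneg {β K : ℝ} {W : ℝ≥0 → ℝ} (h : DyadicHolder β K W) : 0 ≤ K := by
  have := (abs_nonneg _).trans (h 0 0 (by norm_num))
  simpa using this

/-- A path bounded by `C` in `H^σ` on `[0,T]` and `γ`-Hölder with constant `C` in `H^{σ-2γ}`. -/
structure PathBound (σ γ T : ℝ) (Y : ℝ → L2) (C : ℝ) : Prop where
  nonneg : 0 ≤ C
  bound : ∀ t, 0 ≤ t → t ≤ T → SobBound σ (Y t) C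
  holder : ∀ s t, 0 ≤ s → s ≤ t → t ≤ T → SobBound (σ - 2 * γ) (Y t - Y s) (C * (t - s) ^ γ)

theorem youngSum_eq (W : ℝ≥0 → ℝ) (Y : ℝ → L2) (t : ℝ) (k : ℕ) :
    youngSum W Y t k = ∑ n ∈ Finset.range ⌊t * 2 ^ k⌋₊,
      dyadicIncr W k n • heat (t - (n : ℝ) / 2 ^ k) (Y ((n : ℝ) / 2 ^ k)) := rfl

theorem dyadicIncr_refine (W : ℝ≥0 → ℝ) (k n : ℕ) :
    dyadicIncr W k n = dyadicIncr W (k + 1) (2 * n) + dyadicIncr W (k + 1) (2 * n + 1) := by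
  have h1 : (((2 * n : ℕ) : ℝ≥0)) / 2 ^ (k + 1) = (n : ℝ≥0) / 2 ^ k := by
    push_cast; field_simp; ring
  have h2 : (((2 * n + 1 : ℕ) : ℝ≥0) + 1) / 2 ^ (k + 1) = ((n : ℝ≥0) + 1) / 2 ^ k := by
    push_cast; field_simp; ring
  have h3 : (((2 * n + 1 : ℕ) : ℝ≥0)) / 2 ^ (k + 1) = (((2 * n : ℕ) : ℝ≥0) + 1) / 2 ^ (k + 1) := by
    push_cast; ring
  unfold dyadicIncr
  rw [h1, h2, h3]
  ring

/-- The defect of additivity of the germ `S_{t-u} Y_u (W_v - W_u)` on the `n`-th dyadic interval of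
level `k`, before the propagator `S_{t-m}` from its midpoint `m` is applied. -/
def youngDefect (W : ℝ≥0 → ℝ) (Y : ℝ → L2) (k n : ℕ) : L2 :=
  dyadicIncr W (k + 1) (2 * n + 1) •
    (Y ((2 * n + 1 : ℝ) / 2 ^ (k + 1)) - heat (1 / 2 ^ (k + 1)) (Y ((n : ℝ) / 2 ^ k)))

/-- The contribution of the last dyadic interval of level `k + 1` in `[0,t]`, when it is not
contained in an interval of level `k` in `[0,t]`. -/
def youngTail (W : ℝ≥0 → ℝ) (Y : ℝ → L2) (k : ℕ) (t : ℝ) : L2 :=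
  if ⌊t * 2 ^ (k + 1)⌋₊ = 2 * ⌊t * 2 ^ k⌋₊ + 1 then
    dyadicIncr W (k + 1) (2 * ⌊t * 2 ^ k⌋₊) •
      heat (t - (⌊t * 2 ^ k⌋₊ : ℝ) / 2 ^ k) (Y ((⌊t * 2 ^ k⌋₊ : ℝ) / 2 ^ k))
  else 0

theorem floor_dyadic_succ {t : ℝ} (ht : 0 ≤ t) (k : ℕ) :
    ⌊t * 2 ^ (k + 1)⌋₊ = 2 * ⌊t * 2 ^ k⌋₊ ∨ ⌊t * 2 ^ (k + 1)⌋₊ = 2 * ⌊t * 2 ^ k⌋₊ + 1 := by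
  have h0 : 0 ≤ t * 2 ^ k := by positivity
  have h1 := Nat.floor_le h0
  have h2 := Nat.lt_floor_add_one (t * 2 ^ k)
  have h3 : 2 * ⌊t * 2 ^ k⌋₊ ≤ ⌊t * 2 ^ (k + 1)⌋₊ := by
    refine Nat.le_floor ?_
    push_cast
    rw [pow_succ]
    linarith
  have h4 : ⌊t * 2 ^ (k + 1)⌋₊ < 2 * ⌊t * 2 ^ k⌋₊ + 2 := by
    rw [Nat.floor_lt (by positivity)]
    push_cast
    rw [pow_succ]
    linarith
  omega

theorem sum_range_two_mul {M : Type*} [AddCommMonoid M] (f : ℕ → M) (N : ℕ) :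
    ∑ i ∈ Finset.range (2 * N), f i = ∑ n ∈ Finset.range N, (f (2 * n) + f (2 * n + 1)) := by
  induction N with
  | zero => simp
  | succ N ih =>
    rw [show 2 * (N + 1) = 2 * N + 1 + 1 by ring, Finset.sum_range_succ, Finset.sum_range_succ, ih,
      Finset.sum_range_succ, add_assoc]

theorem dyadic_le_of_lt_floor {t : ℝ} {k n : ℕ} (ht : 0 ≤ t) (hn : n < ⌊t * 2 ^ k⌋₊) :
    ((n : ℝ) + 1) / 2 ^ k ≤ t := by
  rw [div_le_iff₀ (by positivity)]
  have h1 : ((n + 1 : ℕ) : ℝ) ≤ ⌊t * 2 ^ k⌋₊ := by exact_mod_cast hn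
  push_cast at h1
  exact h1.trans (Nat.floor_le (by positivity))

theorem dyadic_midpoint_le {t : ℝ} {k n : ℕ} (ht : 0 ≤ t) (hn : n < ⌊t * 2 ^ k⌋₊) :
    (2 * (n : ℝ) + 1) / 2 ^ (k + 1) ≤ t := by
  refine le_trans ?_ (dyadic_le_of_lt_floor ht hn)
  rw [pow_succ, div_le_div_iff₀ (by positivity) (by positivity)]
  nlinarith [pow_pos (two_pos (α := ℝ)) k]

/-- Passing from dyadic level `k` to level `k + 1`. -/
theorem youngSum_succ_sub (W : ℝ≥0 → ℝ) (Y : ℝ → L2) {t : ℝ} (ht : 0 ≤ t) (k : ℕ) :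
    youngSum W Y t (k + 1) - youngSum W Y t k =
      ∑ n ∈ Finset.range ⌊t * 2 ^ k⌋₊,
        heat (t - (2 * n + 1 : ℝ) / 2 ^ (k + 1)) (youngDefect W Y k n) + youngTail W Y k t := by
  set N := ⌊t * 2 ^ k⌋₊ with hN
  have hcast : ∀ n : ℕ, ((2 * n : ℕ) : ℝ) / 2 ^ (k + 1) = (n : ℝ) / 2 ^ k := fun n => by
    push_cast; field_simp; ring
  have hpair : ∑ i ∈ Finset.range (2 * N), dyadicIncr W (k + 1) i •
        heat (t - (i : ℝ) / 2 ^ (k + 1)) (Y ((i : ℝ) / 2 ^ (k + 1))) =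
      youngSum W Y t k + ∑ n ∈ Finset.range N,
        heat (t - (2 * n + 1 : ℝ) / 2 ^ (k + 1)) (youngDefect W Y k n) := by
    rw [sum_range_two_mul, youngSum_eq, ← hN, ← Finset.sum_add_distrib]
    refine Finset.sum_congr rfl fun n hn => ?_
    have hm : 0 ≤ t - (2 * n + 1 : ℝ) / 2 ^ (k + 1) :=
      sub_nonneg.2 (dyadic_midpoint_le ht (Finset.mem_range.1 hn))
    have hsplit : t - (2 * n + 1 : ℝ) / 2 ^ (k + 1) + 1 / 2 ^ (k + 1) = t - (n : ℝ) / 2 ^ k := by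
      field_simp; ring
    rw [youngDefect, heat_real_smul hm, heat_sub hm, heat_heat hm (by positivity), hsplit, hcast,
      dyadicIncr_refine W k n]
    push_cast
    module
  rw [youngSum_eq W Y t (k + 1)]
  rcases floor_dyadic_succ ht k with h | h
  · rw [h, hpair, youngTail, if_neg (by omega), add_zero, add_sub_cancel_left]
  · rw [h, Finset.sum_range_succ, hpair, youngTail, if_pos h, hcast]
    abel

/-- The Young sum over `[s,t]`, with all terms propagated to time `t`. -/
def youngSumIncr (W : ℝ≥0 → ℝ) (Y : ℝ → L2) (s t : ℝ) (k : ℕ) : L2 :=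
  youngSum W Y t k - heat (t - s) (youngSum W Y s k)

theorem floor_dyadic_mono {s t : ℝ} (hst : s ≤ t) (k : ℕ) : ⌊s * 2 ^ k⌋₊ ≤ ⌊t * 2 ^ k⌋₊ :=
  Nat.floor_le_floor (by gcongr)

theorem youngSumIncr_eq (W : ℝ≥0 → ℝ) (Y : ℝ → L2) {s t : ℝ} (hs : 0 ≤ s) (hst : s ≤ t) (k : ℕ) :
    youngSumIncr W Y s t k = ∑ n ∈ Finset.Ico ⌊s * 2 ^ k⌋₊ ⌊t * 2 ^ k⌋₊,
      dyadicIncr W k n • heat (t - (n : ℝ) / 2 ^ k) (Y ((n : ℝ) / 2 ^ k)) := by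
  have hts : 0 ≤ t - s := sub_nonneg.2 hst
  rw [youngSumIncr, youngSum_eq, youngSum_eq, heat_sum hts,
    Finset.sum_Ico_eq_sub _ (floor_dyadic_mono hst k)]
  congr 1
  refine Finset.sum_congr rfl fun n hn => ?_
  have h1 : (n : ℝ) / 2 ^ k ≤ s := by
    refine le_trans ?_ (dyadic_le_of_lt_floor hs (Finset.mem_range.1 hn))
    gcongr; linarith
  rw [heat_real_smul hts, heat_heat hts (sub_nonneg.2 h1)]
  congr 2
  ring

theorem youngSumIncr_succ_sub (W : ℝ≥0 → ℝ) (Y : ℝ → L2) {s t : ℝ} (hs : 0 ≤ s) (hst : s ≤ t)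
    (k : ℕ) :
    youngSumIncr W Y s t (k + 1) - youngSumIncr W Y s t k =
      ∑ n ∈ Finset.Ico ⌊s * 2 ^ k⌋₊ ⌊t * 2 ^ k⌋₊,
        heat (t - (2 * n + 1 : ℝ) / 2 ^ (k + 1)) (youngDefect W Y k n) +
      (youngTail W Y k t - heat (t - s) (youngTail W Y k s)) := by
  have hts : 0 ≤ t - s := sub_nonneg.2 hst
  have h1 : youngSumIncr W Y s t (k + 1) - youngSumIncr W Y s t k =
      (youngSum W Y t (k + 1) - youngSum W Y t k) -
        heat (t - s) (youngSum W Y s (k + 1) - youngSum W Y s k) := by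
    rw [heat_sub hts, youngSumIncr, youngSumIncr]; abel
  rw [h1, youngSum_succ_sub W Y (hs.trans hst), youngSum_succ_sub W Y hs, heat_add hts,
    heat_sum hts, Finset.sum_Ico_eq_sub _ (floor_dyadic_mono hst k)]
  have h2 : ∑ n ∈ Finset.range ⌊s * 2 ^ k⌋₊,
        heat (t - s) (heat (s - (2 * n + 1 : ℝ) / 2 ^ (k + 1)) (youngDefect W Y k n)) =
      ∑ n ∈ Finset.range ⌊s * 2 ^ k⌋₊,
        heat (t - (2 * n + 1 : ℝ) / 2 ^ (k + 1)) (youngDefect W Y k n) := by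
    refine Finset.sum_congr rfl fun n hn => ?_
    rw [heat_heat hts (sub_nonneg.2 (dyadic_midpoint_le hs (Finset.mem_range.1 hn)))]
    congr 1
    ring
  rw [h2]
  abel

theorem sum_rpow_neg_le {b : ℝ} (hb : 0 ≤ b) (hb1 : b < 1) (L : ℕ) :
    ∑ i ∈ Finset.range L, ((i : ℝ) + 1) ^ (-b) ≤ (L : ℝ) ^ (1 - b) / (1 - b) := by
  have hc : 0 < 1 - b := by linarith
  induction L with
  | zero => simp [Real.zero_rpow hc.ne']
  | succ L ih =>
    rw [Finset.sum_range_succ]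
    have hL : (0 : ℝ) < (L : ℝ) + 1 := by positivity
    have h1 : (1 + -(1 / ((L : ℝ) + 1))) ^ (1 - b) ≤ 1 + (1 - b) * -(1 / ((L : ℝ) + 1)) := by
      refine rpow_one_add_le_one_add_mul_self ?_ hc.le (by linarith)
      rw [neg_le_neg_iff, div_le_one hL]
      linarith [(Nat.cast_nonneg L : (0 : ℝ) ≤ L)]
    have h2 : (L : ℝ) ^ (1 - b) = ((L : ℝ) + 1) ^ (1 - b) * (1 + -(1 / ((L : ℝ) + 1))) ^ (1 - b) := by
      have h0 : 0 ≤ 1 + -(1 / ((L : ℝ) + 1)) := by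
        rw [le_add_neg_iff_add_le, zero_add, div_le_one hL]
        linarith [(Nat.cast_nonneg L : (0 : ℝ) ≤ L)]
      rw [← Real.mul_rpow hL.le h0]
      congr 1
      field_simp; ring
    have h3 : ((L : ℝ) + 1) ^ (1 - b) = ((L : ℝ) + 1) * ((L : ℝ) + 1) ^ (-b) := by
      rw [sub_eq_add_neg, Real.rpow_add hL, Real.rpow_one]
    have h4 : (L : ℝ) ^ (1 - b) ≤ ((L : ℝ) + 1) ^ (1 - b) - (1 - b) * ((L : ℝ) + 1) ^ (-b) := by
      rw [h2]
      calc _ ≤ ((L : ℝ) + 1) ^ (1 - b) * (1 + (1 - b) * -(1 / ((L : ℝ) + 1))) := by gcongr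
        _ = _ := by rw [h3]; field_simp; ring
    push_cast
    rw [le_div_iff₀ hc] at ih ⊢
    rw [add_mul]
    linarith

theorem sum_Ico_rpow_neg_le {b : ℝ} (hb : 0 ≤ b) (hb1 : b < 1) {M N : ℕ} (hMN : M ≤ N) :
    ∑ n ∈ Finset.Ico M N, ((N : ℝ) - n) ^ (-b) ≤ ((N : ℝ) - M) ^ (1 - b) / (1 - b) := by
  have h := sum_rpow_neg_le hb hb1 (N - M)
  rw [Nat.cast_sub hMN] at h
  refine le_trans (le_of_eq ?_) h
  rw [Finset.sum_Ico_eq_sum_range, ← Finset.sum_range_reflect]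
  refine Finset.sum_congr rfl fun i hi => ?_
  have hi := Finset.mem_range.1 hi
  congr 1
  have h1 : i + 1 ≤ N - M := hi
  have : ((N - M - 1 - i : ℕ) : ℝ) = (N : ℝ) - M - 1 - i := by
    rw [Nat.cast_sub (by omega), Nat.cast_sub (by omega), Nat.cast_sub hMN]; simp
  rw [Nat.cast_add]
  linarith

variable {β γ ρ K C T : ℝ} {W : ℝ≥0 → ℝ} {Y : ℝ → L2}

theorem index_lt_of_lt_floor {t : ℝ} {k n : ℕ} (ht : t ≤ 1)
    (hn : n < ⌊t * 2 ^ k⌋₊) : n < 2 ^ k := by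
  refine hn.trans_le (Nat.floor_le_of_le ?_)
  push_cast
  exact mul_le_of_le_one_left (by positivity) ht

theorem sobBound_youngDefect (hγ : 0 ≤ γ) (hγ1 : γ ≤ 1) (hW : DyadicHolder β K W)
    (hY : PathBound ρ γ T Y C) (hT : T ≤ 1) {t : ℝ} (ht0 : 0 ≤ t) (ht : t ≤ T) {k n : ℕ}
    (hn : n < ⌊t * 2 ^ k⌋₊) :
    SobBound (ρ - 2 * γ) (youngDefect W Y k n)
      (2 * (K * C) * ((2 : ℝ) ^ (k + 1)) ^ (-(β + γ))) := by
  have h2 : (0 : ℝ) < 2 ^ (k + 1) := by positivity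
  have hu : (n : ℝ) / 2 ^ k ≤ (2 * n + 1 : ℝ) / 2 ^ (k + 1) := by
    rw [pow_succ, div_le_div_iff₀ (by positivity) (by positivity)]
    nlinarith [pow_pos (two_pos (α := ℝ)) k]
  have hm := dyadic_midpoint_le ht0 hn
  have hdist : (2 * n + 1 : ℝ) / 2 ^ (k + 1) - (n : ℝ) / 2 ^ k = 1 / 2 ^ (k + 1) := by
    field_simp; ring
  have h1 := hY.holder _ _ (by positivity) hu (hm.trans ht)
  rw [hdist] at h1
  have h3 : SobBound (ρ - 2 * γ + 2 * γ) (Y ((n : ℝ) / 2 ^ k)) C := by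
    rw [sub_add_cancel]
    exact hY.bound _ (by positivity) (hu.trans (hm.trans ht))
  have h4 := h3.heat_sub_self (t := 1 / 2 ^ (k + 1)) (by positivity) hγ hγ1
  have h5 : Y ((2 * n + 1 : ℝ) / 2 ^ (k + 1)) - heat (1 / 2 ^ (k + 1)) (Y ((n : ℝ) / 2 ^ k)) =
      (Y ((2 * n + 1 : ℝ) / 2 ^ (k + 1)) - Y ((n : ℝ) / 2 ^ k)) -
        (heat (1 / 2 ^ (k + 1)) (Y ((n : ℝ) / 2 ^ k)) - Y ((n : ℝ) / 2 ^ k)) := by abel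
  have hidx : 2 * n + 1 < 2 ^ (k + 1) := by
    have := index_lt_of_lt_floor (ht.trans hT) hn
    rw [pow_succ]; omega
  have h6 : SobBound (ρ - 2 * γ)
      (Y ((2 * n + 1 : ℝ) / 2 ^ (k + 1)) - heat (1 / 2 ^ (k + 1)) (Y ((n : ℝ) / 2 ^ k)))
      (2 * C * ((2 : ℝ) ^ (k + 1)) ^ (-γ)) := by
    rw [h5]
    refine (h1.sub h4).mono (le_of_eq ?_)
    rw [one_div, Real.inv_rpow h2.le, Real.rpow_neg h2.le]
    ring
  refine (h6.real_smul _).mono ?_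
  have hC := hY.nonneg
  calc |dyadicIncr W (k + 1) (2 * n + 1)| * (2 * C * ((2 : ℝ) ^ (k + 1)) ^ (-γ))
      ≤ (K * ((2 : ℝ) ^ (k + 1)) ^ (-β)) * (2 * C * ((2 : ℝ) ^ (k + 1)) ^ (-γ)) := by
        gcongr
        exact hW _ _ hidx
    _ = _ := by
        rw [neg_add, Real.rpow_add h2]; ring

/-- The size of one refinement term in `H^{ρ+2θ}`, in terms of its distance `N - n` from the end. -/
theorem sobBound_heat_youngDefect {θ b : ℝ} (hγ : 0 ≤ γ) (hγ1 : γ ≤ 1) (hθ : 0 ≤ θ)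
    (hbθ : b ≤ γ + θ) (hW : DyadicHolder β K W)
    (hY : PathBound ρ γ T Y C) (hT : T ≤ 1) {t : ℝ} (ht0 : 0 ≤ t) (ht : t ≤ T) {k n : ℕ}
    (hn : n < ⌊t * 2 ^ k⌋₊) :
    SobBound (ρ + 2 * θ) (heat (t - (2 * n + 1 : ℝ) / 2 ^ (k + 1)) (youngDefect W Y k n))
      (2 * (1 + (γ + θ)) ^ (γ + θ) * (K * C) * ((2 : ℝ) ^ (k + 1)) ^ (-(β - θ)) *
        ((⌊t * 2 ^ k⌋₊ : ℝ) - n) ^ (-b)) := by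
  set N := ⌊t * 2 ^ k⌋₊ with hN
  have h2 : (0 : ℝ) < 2 ^ (k + 1) := by positivity
  have hC := hY.nonneg
  have hK := hW.nonneg
  have hNn : (1 : ℝ) ≤ (N : ℝ) - n := by
    have : ((n + 1 : ℕ) : ℝ) ≤ N := by exact_mod_cast hn
    push_cast at this; linarith
  have hNt : (N : ℝ) ≤ t * 2 ^ k := Nat.floor_le (by positivity)
  have hdist : ((N : ℝ) - n) / 2 ^ (k + 1) ≤ t - (2 * n + 1 : ℝ) / 2 ^ (k + 1) := by
    rw [le_sub_iff_add_le, ← add_div, div_le_iff₀ h2, pow_succ]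
    linarith
  have hpos : 0 < ((N : ℝ) - n) / 2 ^ (k + 1) := by positivity
  have h1 := (sobBound_youngDefect hγ hγ1 hW hY hT ht0 ht hn).heat_smoothing
    (hpos.trans_le hdist) (by
      have : 0 ≤ (2 * n + 1 : ℝ) / 2 ^ (k + 1) := by positivity
      linarith) (show 0 ≤ γ + θ by positivity)
  rw [show ρ - 2 * γ + 2 * (γ + θ) = ρ + 2 * θ by ring] at h1
  refine h1.mono ?_
  calc (1 + (γ + θ)) ^ (γ + θ) * (t - (2 * n + 1 : ℝ) / 2 ^ (k + 1)) ^ (-(γ + θ)) *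
        (2 * (K * C) * ((2 : ℝ) ^ (k + 1)) ^ (-(β + γ)))
      ≤ (1 + (γ + θ)) ^ (γ + θ) * (((N : ℝ) - n) ^ (-b) * ((2 : ℝ) ^ (k + 1)) ^ (γ + θ)) *
        (2 * (K * C) * ((2 : ℝ) ^ (k + 1)) ^ (-(β + γ))) := by
        gcongr
        calc (t - (2 * n + 1 : ℝ) / 2 ^ (k + 1)) ^ (-(γ + θ))
            ≤ (((N : ℝ) - n) / 2 ^ (k + 1)) ^ (-(γ + θ)) :=
              Real.rpow_le_rpow_of_nonpos hpos hdist (by linarith)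
          _ = ((N : ℝ) - n) ^ (-(γ + θ)) * ((2 : ℝ) ^ (k + 1)) ^ (γ + θ) := by
              rw [Real.div_rpow (by linarith) h2.le, div_eq_mul_inv, ← Real.rpow_neg h2.le, neg_neg]
          _ ≤ _ := by
              gcongr
    _ = 2 * (1 + (γ + θ)) ^ (γ + θ) * (K * C) *
          (((2 : ℝ) ^ (k + 1)) ^ (γ + θ) * ((2 : ℝ) ^ (k + 1)) ^ (-(β + γ))) *
          ((N : ℝ) - n) ^ (-b) := by ring
    _ = _ := by
        rw [← Real.rpow_add h2]
        congr 3
        ring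

theorem sobBound_dyadic_term {θ : ℝ} (hθ : 0 ≤ θ) (hW : DyadicHolder β K W)
    (hY : PathBound ρ γ T Y C) {t u : ℝ} (hu0 : 0 ≤ u) (ht : t ≤ T) (ht1 : t ≤ 1) {k n : ℕ}
    (hn : n < 2 ^ k) (hu : u + 1 / 2 ^ k ≤ t) :
    SobBound (ρ + 2 * θ) (dyadicIncr W k n • heat (t - u) (Y u))
      ((1 + θ) ^ θ * (K * C) * ((2 : ℝ) ^ k) ^ (-(β - θ))) := by
  have h2 : (0 : ℝ) < 2 ^ k := by positivity
  have hC := hY.nonneg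
  have hinv : 0 < 1 / (2 : ℝ) ^ k := by positivity
  have h1 := (hY.bound u hu0 (by linarith)).heat_smoothing (t := t - u)
    (by linarith) (by linarith) hθ
  refine (h1.real_smul _).mono ?_
  calc |dyadicIncr W k n| * ((1 + θ) ^ θ * (t - u) ^ (-θ) * C)
      ≤ (K * ((2 : ℝ) ^ k) ^ (-β)) * ((1 + θ) ^ θ * ((2 : ℝ) ^ k) ^ θ * C) := by
        have hK := hW.nonneg
        have hinc := hW k n hn
        have hs : (t - u) ^ (-θ) ≤ ((2 : ℝ) ^ k) ^ θ :=
          calc (t - u) ^ (-θ) ≤ (1 / (2 : ℝ) ^ k) ^ (-θ) :=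
                Real.rpow_le_rpow_of_nonpos hinv (by linarith) (by linarith)
            _ = ((2 : ℝ) ^ k) ^ θ := by
                rw [one_div, Real.inv_rpow h2.le, Real.rpow_neg h2.le, inv_inv]
        have htu : 0 ≤ t - u := by linarith
        gcongr
    _ = (1 + θ) ^ θ * (K * C) * (((2 : ℝ) ^ k) ^ (-β) * ((2 : ℝ) ^ k) ^ θ) := by ring
    _ = _ := by
        rw [← Real.rpow_add h2]
        congr 2
        ring

theorem sobBound_youngTail {θ : ℝ} (hθ : 0 ≤ θ) (hW : DyadicHolder β K W)
    (hY : PathBound ρ γ T Y C) (hT : T ≤ 1) {s t : ℝ} (hs : 0 ≤ s) (hst : s ≤ t) (ht : t ≤ T)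
    (k : ℕ) :
    SobBound (ρ + 2 * θ) (heat (t - s) (youngTail W Y k s))
      ((1 + θ) ^ θ * (K * C) * ((2 : ℝ) ^ (k + 1)) ^ (-(β - θ))) := by
  have hts : 0 ≤ t - s := sub_nonneg.2 hst
  have hC := hY.nonneg
  have hK := hW.nonneg
  unfold youngTail
  split_ifs with h
  · set N := ⌊s * 2 ^ k⌋₊ with hN
    have hlt : 2 * N < ⌊s * 2 ^ (k + 1)⌋₊ := by omega
    have h1 := dyadic_le_of_lt_floor hs hlt
    have h2 : (N : ℝ) / 2 ^ k + 1 / 2 ^ (k + 1) ≤ s := by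
      refine le_trans (le_of_eq ?_) h1
      push_cast; field_simp; ring
    have h3 : 0 < 1 / (2 : ℝ) ^ (k + 1) := by positivity
    rw [heat_real_smul hts, heat_heat hts (by linarith), sub_add_sub_cancel]
    exact sobBound_dyadic_term hθ hW hY (by positivity) ht (ht.trans hT)
      (index_lt_of_lt_floor (hst.trans (ht.trans hT)) hlt) (h2.trans hst)
  · rw [heat_zero_right hts]
    exact ((SobBound.zero _).mono (by positivity))

/-- The change of the Young sum over `[s,t]` in `H^{ρ+2θ}` when the dyadic level increases by one
decays geometrically in the level. -/
theorem exists_sobBound_youngSumIncr_succ_sub {θ : ℝ} (hγ : 0 < γ) (hγ1 : γ ≤ 1) (hβ1 : β ≤ 1)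
    (hβγ : 1 < β + γ) (hθ : 0 ≤ θ) (hθβ : θ < β) :
    ∃ A δ : ℝ, 0 ≤ A ∧ 0 < δ ∧ ∀ (ρ K C T : ℝ) (W : ℝ≥0 → ℝ) (Y : ℝ → L2),
      DyadicHolder β K W → PathBound ρ γ T Y C → T ≤ 1 →
      ∀ (s t : ℝ) (k : ℕ), 0 ≤ s → s < t → t ≤ T → 1 ≤ (t - s) * 2 ^ k →
        SobBound (ρ + 2 * θ) (youngSumIncr W Y s t (k + 1) - youngSumIncr W Y s t k)
          (A * (K * C) * (t - s) ^ (β - θ - δ) * ((2 : ℝ) ^ k) ^ (-δ)) := by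
  -- The exponent `b` makes `∑ j^{-b}` grow slowly enough for the sum over levels to converge.
  set b : ℝ := min (γ + θ) (1 - (β - θ) / 2) with hb
  have hbθ : b ≤ γ + θ := min_le_left _ _
  have hb1 : b < 1 := (min_le_right _ _).trans_lt (by linarith)
  have hb0 : 0 ≤ b := le_min (by linarith) (by linarith)
  have hbδ : 1 - (β - θ) < b := lt_min (by linarith) (by linarith)
  have hc : 0 < 1 - b := by linarith
  refine ⟨2 * (1 + (γ + θ)) ^ (γ + θ) * (2 / (1 - b)) + 2 * (1 + θ) ^ θ, β - θ - (1 - b),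
    by positivity, by linarith, ?_⟩
  intro ρ K C T W Y hW hY hT s t k hs hst ht hk
  have ht0 : 0 ≤ t := hs.trans hst.le
  have hC := hY.nonneg
  have hK := hW.nonneg
  set M := ⌊s * 2 ^ k⌋₊ with hM
  set N := ⌊t * 2 ^ k⌋₊ with hN
  have hMN : M ≤ N := floor_dyadic_mono hst.le k
  have h2k : (0 : ℝ) < 2 ^ k := by positivity
  have hts : 0 < t - s := sub_pos.2 hst
  have hcount : (N : ℝ) - M ≤ 2 * ((t - s) * 2 ^ k) := by
    have h1 : (N : ℝ) ≤ t * 2 ^ k := Nat.floor_le (by positivity)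
    have h2 : s * 2 ^ k < (M : ℝ) + 1 := Nat.lt_floor_add_one _
    linarith
  have hcount0 : (0 : ℝ) ≤ (N : ℝ) - M := sub_nonneg.2 (by exact_mod_cast hMN)
  have hX : 1 ≤ ((t - s) * 2 ^ k) ^ (1 - b) := Real.one_le_rpow hk hc.le
  have hmesh : ((2 : ℝ) ^ (k + 1)) ^ (-(β - θ)) ≤ ((2 : ℝ) ^ k) ^ (-(β - θ)) :=
    Real.rpow_le_rpow_of_nonpos h2k (pow_le_pow_right₀ (by norm_num) (Nat.le_succ k)) (by linarith)
  rw [youngSumIncr_succ_sub W Y hs hst.le k]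
  have hsum := SobBound.sum (Finset.Ico M N) fun n hn =>
    sobBound_heat_youngDefect hγ.le hγ1 hθ hbθ hW hY hT ht0 ht (Finset.mem_Ico.1 hn).2
  have htail1 := sobBound_youngTail hθ hW hY hT ht0 le_rfl ht k
  rw [sub_self, heat_zero_left] at htail1
  have htail2 := sobBound_youngTail hθ hW hY hT hs hst.le ht k
  refine (hsum.add (htail1.sub htail2)).mono ?_
  rw [← Finset.mul_sum]
  have hS : ∑ n ∈ Finset.Ico M N, ((N : ℝ) - n) ^ (-b) ≤
      2 / (1 - b) * ((t - s) * 2 ^ k) ^ (1 - b) := by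
    refine (sum_Ico_rpow_neg_le hb0 hb1 hMN).trans ?_
    rw [div_mul_eq_mul_div]
    gcongr
    calc ((N : ℝ) - M) ^ (1 - b) ≤ (2 * ((t - s) * 2 ^ k)) ^ (1 - b) := by gcongr
      _ = 2 ^ (1 - b) * ((t - s) * 2 ^ k) ^ (1 - b) := by
          rw [Real.mul_rpow (by norm_num) (by positivity)]
      _ ≤ 2 * ((t - s) * 2 ^ k) ^ (1 - b) := by
          gcongr
          calc (2 : ℝ) ^ (1 - b) ≤ 2 ^ (1 : ℝ) :=
                Real.rpow_le_rpow_of_exponent_le (by norm_num) (by linarith)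
            _ = 2 := Real.rpow_one 2
  have hfinal : ((t - s) * 2 ^ k) ^ (1 - b) * ((2 : ℝ) ^ k) ^ (-(β - θ)) =
      (t - s) ^ (β - θ - (β - θ - (1 - b))) * ((2 : ℝ) ^ k) ^ (-(β - θ - (1 - b))) := by
    rw [Real.mul_rpow hts.le h2k.le, mul_assoc, ← Real.rpow_add h2k]
    congr 2 <;> ring
  calc 2 * (1 + (γ + θ)) ^ (γ + θ) * (K * C) * ((2 : ℝ) ^ (k + 1)) ^ (-(β - θ)) *
          ∑ n ∈ Finset.Ico M N, ((N : ℝ) - n) ^ (-b) +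
        ((1 + θ) ^ θ * (K * C) * ((2 : ℝ) ^ (k + 1)) ^ (-(β - θ)) +
          (1 + θ) ^ θ * (K * C) * ((2 : ℝ) ^ (k + 1)) ^ (-(β - θ)))
      ≤ 2 * (1 + (γ + θ)) ^ (γ + θ) * (K * C) * ((2 : ℝ) ^ k) ^ (-(β - θ)) *
          (2 / (1 - b) * ((t - s) * 2 ^ k) ^ (1 - b)) +
        ((1 + θ) ^ θ * (K * C) * ((2 : ℝ) ^ k) ^ (-(β - θ)) * ((t - s) * 2 ^ k) ^ (1 - b) +
          (1 + θ) ^ θ * (K * C) * ((2 : ℝ) ^ k) ^ (-(β - θ)) * ((t - s) * 2 ^ k) ^ (1 - b)) := by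
        have h5 : (1 + θ) ^ θ * (K * C) * ((2 : ℝ) ^ (k + 1)) ^ (-(β - θ)) ≤
            (1 + θ) ^ θ * (K * C) * ((2 : ℝ) ^ k) ^ (-(β - θ)) * ((t - s) * 2 ^ k) ^ (1 - b) :=
          calc _ ≤ (1 + θ) ^ θ * (K * C) * ((2 : ℝ) ^ k) ^ (-(β - θ)) := by gcongr
            _ ≤ _ := le_mul_of_one_le_right (by positivity) hX
        have h6 : 0 ≤ ∑ n ∈ Finset.Ico M N, ((N : ℝ) - n) ^ (-b) :=
          Finset.sum_nonneg fun n hn => Real.rpow_nonneg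
            (sub_nonneg.2 (by exact_mod_cast (Finset.mem_Ico.1 hn).2.le)) _
        gcongr
    _ = (2 * (1 + (γ + θ)) ^ (γ + θ) * (2 / (1 - b)) + 2 * (1 + θ) ^ θ) * (K * C) *
          (((t - s) * 2 ^ k) ^ (1 - b) * ((2 : ℝ) ^ k) ^ (-(β - θ))) := by ring
    _ = _ := by rw [hfinal]; ring

end

section

theorem sobBound_of_geometric {σ a b r : ℝ} {x : ℕ → L2} (ha : 0 ≤ a) (hr : 0 ≤ r) (hr1 : r < 1)
    (h0 : SobBound σ (x 0) b) (h : ∀ i, SobBound σ (x (i + 1) - x i) (a * r ^ i)) (i : ℕ) :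
    SobBound σ (x i) (b + a / (1 - r)) := by
  have h1 : SobBound σ (x i) (b + ∑ j ∈ Finset.range i, a * r ^ j) := by
    have h2 := h0.add (SobBound.sum (Finset.range i) fun j _ => h j)
    rwa [Finset.sum_range_sub, add_sub_cancel] at h2
  refine h1.mono ?_
  rw [← Finset.mul_sum, div_eq_mul_inv]
  gcongr
  rw [← tsum_geometric_of_lt_one hr hr1]
  exact (summable_geometric_of_lt_one hr hr1).sum_le_tsum _ fun j _ => by positivity

theorem tendsto_of_sobBound_geometric {σ a r : ℝ} {x : ℕ → L2} (hσ : 0 ≤ σ)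
    (hr1 : r < 1) (h : ∀ i, SobBound σ (x (i + 1) - x i) (a * r ^ i)) :
    ∃ y, Tendsto x atTop (𝓝 y) := by
  refine cauchySeq_tendsto_of_complete (cauchySeq_of_le_geometric r a hr1 fun i => ?_)
  rw [dist_comm, dist_eq_norm]
  exact (h i).norm_le hσ

theorem sobBound_sub_lim_of_geometric {σ a r : ℝ} {x : ℕ → L2} {y : L2} (ha : 0 ≤ a)
    (hr : 0 ≤ r) (hr1 : r < 1) (h : ∀ i, SobBound σ (x (i + 1) - x i) (a * r ^ i))
    (hy : Tendsto x atTop (𝓝 y)) (i : ℕ) : SobBound σ (x i - y) (a * r ^ i / (1 - r)) := by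
  have h1 : ∀ j, SobBound σ (x (j + i) - x i) (0 + a * r ^ i / (1 - r)) := by
    refine sobBound_of_geometric (x := fun j => x (j + i) - x i) (by positivity) hr hr1 ?_
      fun j => ?_
    · simpa using SobBound.zero σ
    · have h2 := h (j + i)
      rw [sub_sub_sub_cancel_right, show j + 1 + i = j + i + 1 by ring]
      refine h2.mono (le_of_eq ?_)
      rw [pow_add]; ring
  simp only [zero_add] at h1
  refine (SobBound.of_tendsto (((tendsto_add_atTop_iff_nat i).2 hy).sub_const (x i))
    tendsto_const_nhds (Eventually.of_forall h1)).sub_comm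

theorem tendsto_sobolevNorm_of_geometric {σ a r : ℝ} {x : ℕ → L2} {y : L2} (ha : 0 ≤ a)
    (hr : 0 ≤ r) (hr1 : r < 1) (h : ∀ i, SobBound σ (x (i + 1) - x i) (a * r ^ i))
    (hy : Tendsto x atTop (𝓝 y)) :
    Tendsto (fun i => sobolevNorm σ (x i - y)) atTop (𝓝 0) := by
  have h1 : Tendsto (fun i => ENNReal.ofReal (a * r ^ i / (1 - r))) atTop (𝓝 0) := by
    rw [← ENNReal.ofReal_zero]
    refine ENNReal.tendsto_ofReal ?_
    have := ((tendsto_pow_atTop_nhds_zero_of_lt_one hr hr1).const_mul a).div_const (1 - r)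
    simpa using this
  exact tendsto_of_tendsto_of_tendsto_of_le_of_le tendsto_const_nhds h1 (fun _ => zero_le)
    fun i => (sobBound_sub_lim_of_geometric ha hr hr1 h hy i).sobolevNorm_le

/-- The Young integral `∫₀ᵗ S_{t-r} Y_r dW_r` as the `L²`-limit of the dyadic sums. -/
def youngInt (W : ℝ≥0 → ℝ) (Y : ℝ → L2) (t : ℝ) : L2 := limUnder atTop (youngSum W Y t)

theorem youngSum_zero (W : ℝ≥0 → ℝ) (Y : ℝ → L2) (k : ℕ) : youngSum W Y 0 k = 0 := by
  simp [youngSum_eq]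

theorem youngSumIncr_zero (W : ℝ≥0 → ℝ) (Y : ℝ → L2) {t : ℝ} (ht : 0 ≤ t) (k : ℕ) :
    youngSumIncr W Y 0 t k = youngSum W Y t k := by
  rw [youngSumIncr, youngSum_zero, sub_zero, heat_zero_right ht, sub_zero]

theorem exists_dyadic_level {h : ℝ} (h0 : 0 < h) (h1 : h ≤ 1) :
    ∃ k : ℕ, 1 ≤ h * 2 ^ k ∧ h * 2 ^ k ≤ 2 := by
  obtain ⟨n, hn1, hn2⟩ := exists_nat_pow_near (one_le_inv_iff₀.2 ⟨h0, h1⟩)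
    (show (1 : ℝ) < 2 by norm_num)
  refine ⟨n + 1, ?_, ?_⟩
  · have := mul_lt_mul_of_pos_left hn2 h0
    rw [mul_inv_cancel₀ h0.ne'] at this
    exact this.le
  · have := mul_le_mul_of_nonneg_left hn1 h0.le
    rw [mul_inv_cancel₀ h0.ne'] at this
    rw [pow_succ]; linarith

variable {β γ : ℝ}

theorem sobBound_youngSumIncr_of_few {θ ρ K C T : ℝ} {W : ℝ≥0 → ℝ} {Y : ℝ → L2} (hθ : 0 ≤ θ)
    (hW : DyadicHolder β K W) (hY : PathBound ρ γ T Y C) (hT : T ≤ 1) {s t : ℝ} {k : ℕ}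
    (hs : 0 ≤ s) (hst : s ≤ t) (ht : t ≤ T) (hk : (t - s) * 2 ^ k ≤ 2) :
    SobBound (ρ + 2 * θ) (youngSumIncr W Y s t k)
      (3 * (1 + θ) ^ θ * (K * C) * ((2 : ℝ) ^ k) ^ (-(β - θ))) := by
  have ht0 := hs.trans hst
  have hK := hW.nonneg
  have hC := hY.nonneg
  rw [youngSumIncr_eq W Y hs hst]
  refine (SobBound.sum (C := fun _ => (1 + θ) ^ θ * (K * C) * ((2 : ℝ) ^ k) ^ (-(β - θ))) _
    fun n hn => ?_).mono ?_
  · have hlt := (Finset.mem_Ico.1 hn).2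
    refine sobBound_dyadic_term hθ hW hY (by positivity) ht (ht.trans hT)
      (index_lt_of_lt_floor (ht.trans hT) hlt) ?_
    rw [← add_div]
    exact dyadic_le_of_lt_floor ht0 hlt
  · rw [Finset.sum_const, Nat.card_Ico, nsmul_eq_mul,
      Nat.cast_sub (floor_dyadic_mono hst k)]
    have h1 : (⌊t * 2 ^ k⌋₊ : ℝ) ≤ t * 2 ^ k := Nat.floor_le (by positivity)
    have h2 : s * 2 ^ k < (⌊s * 2 ^ k⌋₊ : ℝ) + 1 := Nat.lt_floor_add_one _
    have h3 : (⌊t * 2 ^ k⌋₊ : ℝ) - ⌊s * 2 ^ k⌋₊ ≤ 3 := by linarith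
    calc _ ≤ 3 * ((1 + θ) ^ θ * (K * C) * ((2 : ℝ) ^ k) ^ (-(β - θ))) := by gcongr
      _ = _ := by ring

/-- From some level on, the increments of the Young sums are bounded in `H^{ρ+2θ}` and form a
sequence with geometrically decaying differences. -/
theorem exists_sobBound_youngSumIncr {θ : ℝ} (hγ : 0 < γ) (hγ1 : γ ≤ 1) (hβ1 : β ≤ 1)
    (hβγ : 1 < β + γ) (hθ : 0 ≤ θ) (hθβ : θ < β) :
    ∃ M r : ℝ, 0 ≤ M ∧ 0 ≤ r ∧ r < 1 ∧ ∀ (ρ K C T : ℝ) (W : ℝ≥0 → ℝ) (Y : ℝ → L2),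
      DyadicHolder β K W → PathBound ρ γ T Y C → T ≤ 1 →
      ∀ s t : ℝ, 0 ≤ s → s < t → t ≤ T → ∃ k : ℕ, ∀ i,
        SobBound (ρ + 2 * θ) (youngSumIncr W Y s t (i + k)) (M * (K * C) * (t - s) ^ (β - θ)) ∧
        SobBound (ρ + 2 * θ) (youngSumIncr W Y s t (i + 1 + k) - youngSumIncr W Y s t (i + k))
          (M * (K * C) * (t - s) ^ (β - θ) * r ^ i) := by
  obtain ⟨A, δ, hA, hδ, H⟩ :=
    exists_sobBound_youngSumIncr_succ_sub hγ hγ1 hβ1 hβγ hθ hθβ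
  set r : ℝ := 2 ^ (-δ) with hr
  have hr0 : 0 ≤ r := by positivity
  have hr1 : r < 1 := Real.rpow_lt_one_of_one_lt_of_neg (by norm_num) (by linarith)
  have hr2 : 0 < 1 - r := by linarith
  have hM : A ≤ 3 * (1 + θ) ^ θ + A / (1 - r) := by
    have h1 : A ≤ A / (1 - r) := by
      rw [le_div_iff₀ hr2]
      nlinarith
    have h2 : 0 ≤ 3 * (1 + θ) ^ θ := by positivity
    linarith
  refine ⟨3 * (1 + θ) ^ θ + A / (1 - r), r, by positivity, hr0, hr1, ?_⟩
  intro ρ K C T W Y hW hY hT s t hs hst ht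
  have hts : 0 < t - s := sub_pos.2 hst
  have hK := hW.nonneg
  have hC := hY.nonneg
  obtain ⟨k, hk1, hk2⟩ := exists_dyadic_level hts (by linarith)
  have h2k : (0 : ℝ) < 2 ^ k := by positivity
  have hlevel : ∀ p : ℝ, 0 ≤ p → ((2 : ℝ) ^ k) ^ (-p) ≤ (t - s) ^ p := fun p hp => by
    rw [Real.rpow_neg h2k.le, inv_le_iff_one_le_mul₀ (by positivity),
      ← Real.mul_rpow hts.le h2k.le]
    exact Real.one_le_rpow hk1 hp
  set a : ℝ := A * (K * C) * (t - s) ^ (β - θ) with ha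
  have hstep : ∀ i, SobBound (ρ + 2 * θ)
      (youngSumIncr W Y s t (i + 1 + k) - youngSumIncr W Y s t (i + k)) (a * r ^ i) := fun i => by
    have h1 := H ρ K C T W Y hW hY hT s t (i + k) hs hst ht (hk1.trans (by
      gcongr
      · norm_num
      · omega))
    rw [show i + 1 + k = i + k + 1 by ring]
    refine h1.mono ?_
    calc A * (K * C) * (t - s) ^ (β - θ - δ) * ((2 : ℝ) ^ (i + k)) ^ (-δ)
        = A * (K * C) * (t - s) ^ (β - θ - δ) * (r ^ i * ((2 : ℝ) ^ k) ^ (-δ)) := by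
          rw [pow_add, Real.mul_rpow (by positivity) h2k.le, hr, ← Real.rpow_natCast (2 ^ (-δ)) i,
            ← Real.rpow_mul (by norm_num), ← Real.rpow_natCast 2 i, ← Real.rpow_mul (by norm_num),
            mul_comm (i : ℝ)]
      _ ≤ A * (K * C) * (t - s) ^ (β - θ - δ) * (r ^ i * (t - s) ^ δ) := by
          gcongr
          exact hlevel δ hδ.le
      _ = A * (K * C) * ((t - s) ^ (β - θ - δ) * (t - s) ^ δ) * r ^ i := by ring
      _ = a * r ^ i := by rw [← Real.rpow_add hts, sub_add_cancel]
  have hbase := (sobBound_youngSumIncr_of_few hθ hW hY hT hs hst.le ht hk2).mono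
    (mul_le_mul_of_nonneg_left (hlevel (β - θ) (by linarith)) (by positivity))
  refine ⟨k, fun i => ⟨?_, (hstep i).mono ?_⟩⟩
  · refine (sobBound_of_geometric (x := fun i => youngSumIncr W Y s t (i + k)) (by positivity) hr0
      hr1 (by simpa using hbase) hstep i).mono (le_of_eq ?_)
    rw [ha]; ring
  · rw [ha]
    gcongr

theorem tendsto_youngSum {ρ K C T : ℝ} {W : ℝ≥0 → ℝ} {Y : ℝ → L2} (hγ : 0 < γ) (hγ1 : γ ≤ 1)
    (hβ0 : 0 < β) (hβ1 : β ≤ 1) (hβγ : 1 < β + γ) (hρ : 0 ≤ ρ) (hW : DyadicHolder β K W)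
    (hY : PathBound ρ γ T Y C) (hT : T ≤ 1) {t : ℝ} (ht0 : 0 ≤ t) (ht : t ≤ T) :
    Tendsto (youngSum W Y t) atTop (𝓝 (youngInt W Y t)) := by
  refine tendsto_nhds_limUnder ?_
  rcases ht0.eq_or_lt with rfl | ht0'
  · exact ⟨0, by simp only [funext (youngSum_zero W Y), tendsto_const_nhds]⟩
  · obtain ⟨M, r, -, -, hr1, H⟩ :=
      exists_sobBound_youngSumIncr hγ hγ1 hβ1 hβγ le_rfl hβ0
    obtain ⟨k, hk⟩ := H ρ K C T W Y hW hY hT 0 t le_rfl ht0' ht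
    simp only [youngSumIncr_zero W Y ht0] at hk
    obtain ⟨y, hy⟩ := tendsto_of_sobBound_geometric (by simpa using hρ) hr1 fun i => (hk i).2
    exact ⟨y, (tendsto_add_atTop_iff_nat k).1 hy⟩

/-- The Young convolution integral gains `2θ < 2β` derivatives, and over an interval of length `h`
it is of size `h^{β-θ}`. -/
theorem exists_sobBound_youngInt {θ : ℝ} (hγ : 0 < γ) (hγ1 : γ ≤ 1) (hβ1 : β ≤ 1)
    (hβγ : 1 < β + γ) (hθ : 0 ≤ θ) (hθβ : θ < β) :
    ∃ M : ℝ, 0 ≤ M ∧ ∀ (ρ K C T : ℝ) (W : ℝ≥0 → ℝ) (Y : ℝ → L2), 0 ≤ ρ →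
      DyadicHolder β K W → PathBound ρ γ T Y C → T ≤ 1 →
      ∀ s t : ℝ, 0 ≤ s → s ≤ t → t ≤ T →
        SobBound (ρ + 2 * θ) (youngInt W Y t - heat (t - s) (youngInt W Y s))
          (M * (K * C) * (t - s) ^ (β - θ)) := by
  obtain ⟨M, r, hM, -, -, H⟩ := exists_sobBound_youngSumIncr hγ hγ1 hβ1 hβγ hθ hθβ
  refine ⟨M, hM, ?_⟩
  intro ρ K C T W Y hρ hW hY hT s t hs hst ht
  have hK := hW.nonneg
  have hC := hY.nonneg
  have hts : 0 ≤ t - s := sub_nonneg.2 hst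
  rcases hst.eq_or_lt with rfl | hst'
  · rw [sub_self, heat_zero_left, sub_self]
    exact (SobBound.zero _).mono (by positivity)
  · obtain ⟨k, hk⟩ := H ρ K C T W Y hW hY hT s t hs hst' ht
    have hβ0 : 0 < β := hθ.trans_lt hθβ
    have h1 := tendsto_youngSum hγ hγ1 hβ0 hβ1 hβγ hρ hW hY hT (hs.trans hst) ht
    have h2 := tendsto_youngSum hγ hγ1 hβ0 hβ1 hβγ hρ hW hY hT hs (hst.trans ht)
    have h3 : Tendsto (youngSumIncr W Y s t) atTop
        (𝓝 (youngInt W Y t - heat (t - s) (youngInt W Y s))) :=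
      h1.sub (((heatL (t - s) hts).continuous.tendsto _).comp h2)
    exact SobBound.of_tendsto ((tendsto_add_atTop_iff_nat k).2 h3) tendsto_const_nhds
      (Eventually.of_forall fun i => (hk i).1)

theorem isYoungIntegral_youngInt {θ ρ K C T : ℝ} {W : ℝ≥0 → ℝ} {Y : ℝ → L2} (hγ : 0 < γ)
    (hγ1 : γ ≤ 1) (hβ1 : β ≤ 1) (hβγ : 1 < β + γ) (hθ : 0 ≤ θ) (hθβ : θ < β) (hρ : 0 ≤ ρ)
    (hW : DyadicHolder β K W) (hY : PathBound ρ γ T Y C) (hT : T ≤ 1) {t : ℝ} (ht0 : 0 ≤ t)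
    (ht : t ≤ T) : IsYoungIntegral (ρ + 2 * θ) W Y t (youngInt W Y t) := by
  have hK := hW.nonneg
  have hC := hY.nonneg
  have hβ0 : 0 < β := hθ.trans_lt hθβ
  have hlim := tendsto_youngSum hγ hγ1 hβ0 hβ1 hβγ hρ hW hY hT ht0 ht
  rcases ht0.eq_or_lt with rfl | ht0'
  · have h0 : youngInt W Y 0 = 0 := by
      refine tendsto_nhds_unique hlim ?_
      simp only [funext (youngSum_zero W Y), tendsto_const_nhds]
    rw [h0]
    refine ⟨(SobBound.zero _).memSobolev, ?_⟩
    have h1 : sobolevNorm (ρ + 2 * θ) 0 = 0 :=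
      le_antisymm (by simpa using (SobBound.zero (ρ + 2 * θ)).sobolevNorm_le) zero_le
    simp only [youngSum_zero, sub_zero, h1, tendsto_const_nhds]
  · obtain ⟨M, r, hM, hr0, hr1, H⟩ := exists_sobBound_youngSumIncr hγ hγ1 hβ1 hβγ hθ hθβ
    obtain ⟨k, hk⟩ := H ρ K C T W Y hW hY hT 0 t le_rfl ht0' ht
    simp only [youngSumIncr_zero W Y ht0] at hk
    have hlim' := (tendsto_add_atTop_iff_nat k).2 hlim
    refine ⟨(SobBound.of_tendsto hlim' tendsto_const_nhds
      (Eventually.of_forall fun i => (hk i).1)).memSobolev, ?_⟩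
    exact (tendsto_add_atTop_iff_nat k).1
      (tendsto_sobolevNorm_of_geometric (x := fun i => youngSum W Y t (i + k)) (by positivity)
        hr0 hr1 (fun i => (hk i).2) hlim')

theorem youngInt_eq_zero {W : ℝ≥0 → ℝ} {Y : ℝ → L2} {t : ℝ} (ht : 0 ≤ t)
    (hY : ∀ r, 0 ≤ r → r < t → Y r = 0) : youngInt W Y t = 0 := by
  have h : youngSum W Y t = fun _ => 0 := by
    funext k
    rw [youngSum_eq]
    refine Finset.sum_eq_zero fun n hn => ?_
    have h1 := dyadic_le_of_lt_floor ht (Finset.mem_range.1 hn)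
    have h2 : (n : ℝ) / 2 ^ k < t := by
      refine lt_of_lt_of_le ?_ h1
      gcongr; linarith
    rw [hY _ (by positivity) h2, heat_zero_right (by linarith), smul_zero]
  rw [youngInt, h]
  exact tendsto_const_nhds.limUnder_eq

theorem youngSum_sub (W : ℝ≥0 → ℝ) (Y Z : ℝ → L2) {t : ℝ} (ht : 0 ≤ t) (k : ℕ) :
    youngSum W (fun r => Y r - Z r) t k = youngSum W Y t k - youngSum W Z t k := by
  simp only [youngSum_eq, ← Finset.sum_sub_distrib, ← smul_sub]
  refine Finset.sum_congr rfl fun n hn => ?_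
  have h1 := dyadic_le_of_lt_floor ht (Finset.mem_range.1 hn)
  have h2 : (n : ℝ) / 2 ^ k ≤ t := by
    refine le_trans ?_ h1
    gcongr; linarith
  rw [heat_sub (by linarith)]

/-- The Young integral of a path vanishing before time `a`, as a path in the solution space: a small
factor `(T - a)^{β-γ}` appears. -/
theorem exists_pathBound_youngInt (hγ : 1 / 2 < γ) (hγβ : γ < β) (hβ1 : β ≤ 1) :
    ∃ M : ℝ, 0 ≤ M ∧ ∀ (ρ K C a T : ℝ) (W : ℝ≥0 → ℝ) (Y : ℝ → L2), 0 ≤ ρ →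
      DyadicHolder β K W → PathBound ρ γ T Y C → T ≤ 1 → 0 ≤ a → a ≤ T →
      (∀ r, 0 ≤ r → r < a → Y r = 0) →
        PathBound (ρ + 1) γ T (youngInt W Y) (M * (K * C) * (T - a) ^ (β - γ)) := by
  have hβγ : 1 < β + γ := by linarith
  have hγ0 : 0 < γ := by linarith
  have hγ1 : γ ≤ 1 := by linarith
  obtain ⟨M₀, hM₀, H₀⟩ :=
    exists_sobBound_youngInt (θ := 0) hγ0 hγ1 hβ1 hβγ le_rfl (by linarith)
  obtain ⟨M₁, hM₁, H₁⟩ :=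
    exists_sobBound_youngInt (θ := 1 / 2) hγ0 hγ1 hβ1 hβγ (by norm_num) (by linarith)
  refine ⟨M₀ + M₁, by positivity, ?_⟩
  intro ρ K C a T W Y hρ hW hY hT ha haT hYa
  have hK := hW.nonneg
  have hC := hY.nonneg
  have hTa : 0 ≤ T - a := sub_nonneg.2 haT
  have hzero : ∀ t, 0 ≤ t → t ≤ a → youngInt W Y t = 0 := fun t ht hta =>
    youngInt_eq_zero ht fun r hr hrt => hYa r hr (hrt.trans_le hta)
  have hsmall : ∀ h p : ℝ, 0 ≤ h → h ≤ T - a → β - γ ≤ p → h ^ p ≤ (T - a) ^ (β - γ) := by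
    intro h p hh hhT hp
    calc h ^ p ≤ (T - a) ^ p := Real.rpow_le_rpow hh hhT (by linarith)
      _ ≤ (T - a) ^ (β - γ) :=
        Real.rpow_le_rpow_of_exponent_ge' hTa (by linarith) (by linarith) hp
  have hbd : ∀ t, 0 ≤ t → t ≤ T → SobBound (ρ + 1) (youngInt W Y t)
      (M₁ * (K * C) * (T - a) ^ (β - γ)) := by
    intro t ht0 ht
    rcases le_total t a with hta | hat
    · rw [hzero t ht0 hta]
      exact (SobBound.zero _).mono (by positivity)
    · have h1 := H₁ ρ K C T W Y hρ hW hY hT a t ha hat ht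
      rw [hzero a ha le_rfl, heat_zero_right (sub_nonneg.2 hat), sub_zero,
        show ρ + 2 * (1 / 2) = ρ + 1 by ring] at h1
      refine h1.mono ?_
      gcongr
      exact hsmall _ _ (sub_nonneg.2 hat) (by linarith) (by linarith)
  -- the Hölder bound after time `a`
  have hinc : ∀ s t, a ≤ s → s ≤ t → t ≤ T → SobBound (ρ + 1 - 2 * γ)
      (youngInt W Y t - youngInt W Y s)
      ((M₀ + M₁) * (K * C) * (T - a) ^ (β - γ) * (t - s) ^ γ) := by
    intro s t has hst ht
    have hs : 0 ≤ s := ha.trans has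
    have hts : 0 ≤ t - s := sub_nonneg.2 hst
    have h1 := H₀ ρ K C T W Y hρ hW hY hT s t hs hst ht
    rw [mul_zero, add_zero, sub_zero] at h1
    have h2 := hbd s hs (hst.trans ht)
    rw [show ρ + 1 = ρ + 1 - 2 * γ + 2 * γ by ring] at h2
    have h3 := (h1.mono_exponent (show ρ + 1 - 2 * γ ≤ ρ by linarith)).add
      (h2.heat_sub_self hts hγ0.le hγ1)
    rw [sub_add_sub_cancel] at h3
    refine h3.mono ?_
    have h4 : (t - s) ^ β ≤ (T - a) ^ (β - γ) * (t - s) ^ γ := by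
      calc (t - s) ^ β = (t - s) ^ (β - γ) * (t - s) ^ γ := by
            rw [← Real.rpow_add_of_nonneg hts (by linarith) hγ0.le, sub_add_cancel]
        _ ≤ _ := by
            gcongr
    calc M₀ * (K * C) * (t - s) ^ β + (t - s) ^ γ * (M₁ * (K * C) * (T - a) ^ (β - γ))
        ≤ M₀ * (K * C) * ((T - a) ^ (β - γ) * (t - s) ^ γ) +
          (t - s) ^ γ * (M₁ * (K * C) * (T - a) ^ (β - γ)) := by gcongr
      _ = _ := by ring
  refine ⟨by positivity, fun t ht0 ht => (hbd t ht0 ht).mono ?_, fun s t hs hst ht => ?_⟩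
  · gcongr
    linarith
  · rcases le_total a s with has | hsa
    · exact hinc s t has hst ht
    · rcases le_total t a with hta | hat
      · rw [hzero t (hs.trans hst) hta, hzero s hs hsa, sub_zero]
        have : 0 ≤ t - s := sub_nonneg.2 hst
        exact (SobBound.zero _).mono (by positivity)
      · rw [hzero s hs hsa, ← hzero a ha le_rfl]
        refine (hinc a t le_rfl hat ht).mono ?_
        gcongr

end

section

/-! ### The mild solution map -/

namespace PathBound

variable {σ γ T C D : ℝ} {f g : ℝ → L2}

theorem mono (h : PathBound σ γ T f C) (hCD : C ≤ D) : PathBound σ γ T f D :=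
  ⟨h.nonneg.trans hCD, fun t ht0 ht => (h.bound t ht0 ht).mono hCD, fun s t hs hst ht =>
    (h.holder s t hs hst ht).mono
      (mul_le_mul_of_nonneg_right hCD (Real.rpow_nonneg (sub_nonneg.2 hst) _))⟩

theorem mono_time (h : PathBound σ γ T f C) {T' : ℝ} (hT : T' ≤ T) : PathBound σ γ T' f C :=
  ⟨h.nonneg, fun t ht0 ht => h.bound t ht0 (ht.trans hT),
    fun s t hs hst ht => h.holder s t hs hst (ht.trans hT)⟩

theorem congr (h : PathBound σ γ T f C) (hfg : ∀ t, 0 ≤ t → t ≤ T → g t = f t) :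
    PathBound σ γ T g C := by
  refine ⟨h.nonneg, fun t ht0 ht => ?_, fun s t hs hst ht => ?_⟩
  · rw [hfg t ht0 ht]; exact h.bound t ht0 ht
  · rw [hfg t (hs.trans hst) ht, hfg s hs (hst.trans ht)]; exact h.holder s t hs hst ht

theorem zero (σ γ T : ℝ) : PathBound σ γ T (fun _ => 0) 0 :=
  ⟨le_rfl, fun _ _ _ => SobBound.zero σ, fun _ _ _ _ _ => by
    simpa using SobBound.zero (σ - 2 * γ)⟩

theorem add (hf : PathBound σ γ T f C) (hg : PathBound σ γ T g D) :
    PathBound σ γ T (fun t => f t + g t) (C + D) := by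
  refine ⟨add_nonneg hf.nonneg hg.nonneg, fun t ht0 ht => (hf.bound t ht0 ht).add
    (hg.bound t ht0 ht), fun s t hs hst ht => ?_⟩
  rw [add_sub_add_comm, add_mul]
  exact (hf.holder s t hs hst ht).add (hg.holder s t hs hst ht)

theorem neg (hf : PathBound σ γ T f C) : PathBound σ γ T (fun t => -f t) C := by
  refine ⟨hf.nonneg, fun t ht0 ht => (hf.bound t ht0 ht).neg, fun s t hs hst ht => ?_⟩
  rw [neg_sub_neg]
  exact (hf.holder s t hs hst ht).sub_comm

theorem sub (hf : PathBound σ γ T f C) (hg : PathBound σ γ T g D) :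
    PathBound σ γ T (fun t => f t - g t) (C + D) := by
  simpa only [sub_eq_add_neg] using hf.add hg.neg

theorem of_tendsto {ι : Type*} {l : Filter ι} [l.NeBot] {F : ι → ℝ → L2} {c : ι → ℝ}
    (hF : ∀ t, 0 ≤ t → t ≤ T → Tendsto (fun i => F i t) l (𝓝 (f t))) (hc : Tendsto c l (𝓝 C))
    (h : ∀ᶠ i in l, PathBound σ γ T (F i) (c i)) : PathBound σ γ T f C := by
  refine ⟨ge_of_tendsto hc (h.mono fun i hi => hi.nonneg), fun t ht0 ht => ?_,
    fun s t hs hst ht => ?_⟩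
  · exact SobBound.of_tendsto (hF t ht0 ht) hc (h.mono fun i hi => hi.bound t ht0 ht)
  · exact SobBound.of_tendsto ((hF t (hs.trans hst) ht).sub (hF s hs (hst.trans ht)))
      (hc.mul_const _) (h.mono fun i hi => hi.holder s t hs hst ht)

end PathBound

theorem pathBound_heat {σ γ C : ℝ} (T : ℝ) {f : L2} (h : SobBound σ f C) (hγ : 0 ≤ γ)
    (hγ1 : γ ≤ 1) : PathBound σ γ T (fun t => heat t f) C := by
  refine ⟨h.1, fun t ht0 _ => h.heat ht0, fun s t hs hst _ => ?_⟩
  have hts : 0 ≤ t - s := sub_nonneg.2 hst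
  have h1 : heat t f - heat s f = heat (t - s) (heat s f) - heat s f := by
    rw [heat_heat hts hs, sub_add_cancel]
  have h2 := h.heat hs
  rw [show σ = σ - 2 * γ + 2 * γ by ring] at h2
  rw [h1, mul_comm C]
  exact h2.heat_sub_self hts hγ hγ1

theorem transport_sub_right {v : Fin 2 → L2} (hv : ∀ j, Summable fun m => ‖coeff (v j) m‖)
    {f g : L2} (hf : MemSobolev 1 f) (hg : MemSobolev 1 g) :
    transport v (f - g) = transport v f - transport v g := by
  rw [eq_sub_iff_add_eq, ← transport_add_right hv (hf.sub hg) hg, sub_add_cancel]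

theorem MemSmooth.exists_wienerBound {v : L2} (hv : MemSmooth v) {p : ℝ} (hp : 0 ≤ p) :
    ∃ A, WienerBound p v A := by
  obtain ⟨C, hC⟩ := memSobolev_iff.1 (hv (p + 1 + 1) (by positivity))
  exact ⟨_, hC.wienerBound one_pos⟩

theorem WienerBound.mono {p A B : ℝ} {v : L2} (h : WienerBound p v A) (hAB : A ≤ B) :
    WienerBound p v B := fun F => (h F).trans hAB

theorem MemSmooth.exists_wienerBound_fin {v : Fin 2 → L2} (hv : ∀ j, MemSmooth (v j)) {p : ℝ}
    (hp : 0 ≤ p) : ∃ A, 0 ≤ A ∧ ∀ j, WienerBound p (v j) A := by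
  choose A hA using fun j => (hv j).exists_wienerBound hp
  refine ⟨max 0 (max (A 0) (A 1)), le_max_left _ _, fun j => (hA j).mono ?_⟩
  fin_cases j
  · exact (le_max_left _ _).trans (le_max_right _ _)
  · exact (le_max_right _ _).trans (le_max_right _ _)

theorem MemSmooth.summable {v : L2} (hv : MemSmooth v) : Summable fun m => ‖coeff v m‖ := by
  obtain ⟨A, hA⟩ := hv.exists_wienerBound le_rfl
  exact hA.summable le_rfl

variable {α γ : ℝ} {ξ : Fin 2 → L2}

theorem PathBound.memSobolev_one (hα : 1 < α) {T C t : ℝ} {f : ℝ → L2}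
    (h : PathBound (2 * α) γ T f C) (ht0 : 0 ≤ t) (ht : t ≤ T) : MemSobolev 1 (f t) :=
  ((h.bound t ht0 ht).mono_exponent (by linarith)).memSobolev

/-- The noise coefficient `f ↦ ξ · ∇f` on paths: it costs one derivative. -/
theorem exists_pathBound_transport (hα : 1 < α) (hξ : ∀ j, MemSmooth (ξ j)) :
    ∃ A : ℝ, 0 ≤ A ∧ ∀ (T C : ℝ) (f : ℝ → L2), PathBound (2 * α) γ T f C →
      PathBound (2 * α - 1) γ T (fun t => transport ξ (f t)) (A * C) := by
  obtain ⟨A₁, hA₁, h₁⟩ := MemSmooth.exists_wienerBound_fin hξ (abs_nonneg (2 * α - 1))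
  obtain ⟨A₂, hA₂, h₂⟩ := MemSmooth.exists_wienerBound_fin hξ (abs_nonneg (2 * α - 1 - 2 * γ))
  set B₁ := 2 * 2 ^ (|2 * α - 1| / 2) * A₁
  set B₂ := 2 * 2 ^ (|2 * α - 1 - 2 * γ| / 2) * A₂
  have hB₁ : 0 ≤ B₁ := by positivity
  have hB₂ : 0 ≤ B₂ := by positivity
  refine ⟨B₁ + B₂, by positivity, fun T C f hf => ?_⟩
  have hC := hf.nonneg
  refine ⟨by positivity, fun t ht0 ht => ?_, fun s t hs hst ht => ?_⟩
  · have h1 := hf.bound t ht0 ht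
    rw [show 2 * α = 2 * α - 1 + 1 by ring] at h1
    refine (SobBound.transport h₁ (hf.memSobolev_one hα ht0 ht) h1).mono ?_
    change B₁ * C ≤ _
    gcongr
    linarith
  · have hft := hf.memSobolev_one hα (hs.trans hst) ht
    have hfs := hf.memSobolev_one hα hs (hst.trans ht)
    have h1 := hf.holder s t hs hst ht
    rw [show 2 * α - 2 * γ = 2 * α - 1 - 2 * γ + 1 by ring] at h1
    rw [← transport_sub_right (fun j => (hξ j).summable) hft hfs]
    refine (SobBound.transport h₂ (hft.sub hfs) h1).mono ?_
    change B₂ * (C * (t - s) ^ γ) ≤ _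
    have : 0 ≤ t - s := sub_nonneg.2 hst
    calc B₂ * (C * (t - s) ^ γ) = B₂ * C * (t - s) ^ γ := by ring
      _ ≤ (B₁ + B₂) * C * (t - s) ^ γ := by
          gcongr
          linarith

/-- The bilinear nonlinearity on paths.  The increment in the velocity is estimated in the positive
part of the exponent `2α - 1 - 2γ`, which may be negative. -/
theorem exists_pathBound_advection (hα : 1 < α) (hγ0 : 0 < γ) (hγ1 : γ < 1) :
    ∃ A : ℝ, 0 ≤ A ∧ ∀ (T C D : ℝ) (f g : ℝ → L2), PathBound (2 * α) γ T f C →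
      PathBound (2 * α) γ T g D →
      PathBound (2 * α - 1) γ T (fun t => advection (f t) (g t)) (A * (C * D)) := by
  set δ : ℝ := min 1 (2 * α - 2 * γ) with hδ
  have hδ0 : 0 < δ := lt_min one_pos (by linarith)
  set r : ℝ := 2 * α - 1 - 2 * γ with hr
  set r' : ℝ := max r 0 with hr'
  have hr'0 : |r'| = r' := abs_of_nonneg (le_max_right _ _)
  have hr'1 : r' + δ ≤ 2 * α - 2 * γ := by
    rcases le_total r 0 with h | h
    · rw [hr', max_eq_right h, zero_add]; exact min_le_right _ _
    · rw [hr', max_eq_left h, hr]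
      linarith [min_le_left 1 (2 * α - 2 * γ)]
  have hr'2 : r' + 1 ≤ 2 * α := by
    have : r' ≤ 2 * α - 1 := max_le (by linarith) (by linarith)
    linarith
  have habs : |r| ≤ 2 * α - 1 := abs_le.2 ⟨by linarith, by linarith⟩
  set B₁ := 4 * 2 ^ (|2 * α - 1| / 2) * wienerConst 1
  set B₂ := 4 * 2 ^ (|r| / 2) * wienerConst 1
  set B₃ := 4 * 2 ^ (|r'| / 2) * wienerConst δ
  have hw : ∀ ε, 0 ≤ wienerConst ε := fun ε => Real.sqrt_nonneg _
  have hB₁ : 0 ≤ B₁ := mul_nonneg (by positivity) (hw _)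
  have hB₂ : 0 ≤ B₂ := mul_nonneg (by positivity) (hw _)
  have hB₃ : 0 ≤ B₃ := mul_nonneg (by positivity) (hw _)
  refine ⟨B₁ + B₂ + B₃, by positivity, fun T C D f g hf hg => ?_⟩
  have hC := hf.nonneg
  have hD := hg.nonneg
  refine ⟨by positivity, fun t ht0 ht => ?_, fun s t hs hst ht => ?_⟩
  · have h1 := hf.bound t ht0 ht
    have h2 := hg.bound t ht0 ht
    rw [show 2 * α = |2 * α - 1| + 1 by rw [abs_of_nonneg (by linarith)]; ring] at h1
    rw [show 2 * α = 2 * α - 1 + 1 by ring] at h2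
    refine (SobBound.advection one_pos h1 (hg.memSobolev_one hα ht0 ht) h2).mono ?_
    change B₁ * C * D ≤ _
    rw [mul_assoc]
    gcongr
    linarith
  · have ht0 := hs.trans hst
    have hsT := hst.trans ht
    have hts : 0 ≤ t - s := sub_nonneg.2 hst
    have hft := hf.memSobolev_one hα ht0 ht
    have hfs := hf.memSobolev_one hα hs hsT
    have hgt := hg.memSobolev_one hα ht0 ht
    have hgs := hg.memSobolev_one hα hs hsT
    have hsplit : advection (f t) (g t) - advection (f s) (g s) =
        advection (f t - f s) (g t) + advection (f s) (g t - g s) := by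
      have h1 := advection_add_left (g := g t) one_pos (hft.sub hfs) hfs
      have h2 := advection_add_right one_pos hfs (hgt.sub hgs) hgs
      rw [sub_add_cancel] at h1 h2
      rw [h1, add_sub_assoc, h2, add_sub_cancel_right]
    rw [hsplit]
    have h3 : SobBound r (advection (f t - f s) (g t)) (B₃ * (C * (t - s) ^ γ) * D) := by
      refine SobBound.mono_exponent ?_ (le_max_left r 0)
      refine SobBound.advection hδ0 ?_ hgt ((hg.bound t ht0 ht).mono_exponent hr'2)
      rw [← hr', hr'0]
      exact (hf.holder s t hs hst ht).mono_exponent hr'1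
    have h4 : SobBound r (advection (f s) (g t - g s)) (B₂ * C * (D * (t - s) ^ γ)) := by
      refine SobBound.advection one_pos ((hf.bound s hs hsT).mono_exponent (by linarith))
        (hgt.sub hgs) ?_
      rw [show r + 1 = 2 * α - 2 * γ by rw [hr]; ring]
      exact hg.holder s t hs hst ht
    refine (h3.add h4).mono ?_
    calc B₃ * (C * (t - s) ^ γ) * D + B₂ * C * (D * (t - s) ^ γ)
        = (B₂ + B₃) * (C * D) * (t - s) ^ γ := by ring
      _ ≤ (B₁ + B₂ + B₃) * (C * D) * (t - s) ^ γ := by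
          gcongr
          linarith

/-- Time itself as a driver, so that the drift is a Young integral as well. -/
def timeDriver : ℝ≥0 → ℝ := fun t => t

theorem dyadicIncr_timeDriver (k n : ℕ) : dyadicIncr timeDriver k n = 1 / 2 ^ k := by
  simp only [dyadicIncr, timeDriver]
  push_cast
  ring

theorem dyadicHolder_timeDriver {β : ℝ} (hβ : β ≤ 1) : DyadicHolder β 1 timeDriver := by
  intro k n _
  have h2 : (1 : ℝ) ≤ 2 ^ k := one_le_pow₀ (by norm_num)
  have h3 : (0 : ℝ) < 2 ^ k := by positivity
  rw [dyadicIncr_timeDriver, abs_of_nonneg (by positivity), one_mul, one_div,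
    ← Real.rpow_neg_one]
  exact Real.rpow_le_rpow_of_exponent_le h2 (by linarith)

/-- The right-hand side of the mild formulation, with the drift written as a Young integral. -/
def mildMap (ξ : Fin 2 → L2) (ω₀ : L2) (W : ℝ≥0 → ℝ) (f : ℝ → L2) (t : ℝ) : L2 :=
  heat t ω₀ - youngInt timeDriver (fun s => advection (f s) (f s)) t -
    youngInt W (fun s => transport ξ (f s)) t

theorem youngInt_sub {β ρ K C D T : ℝ} {W : ℝ≥0 → ℝ} {Y Z : ℝ → L2} (hγ : 1 / 2 < γ)
    (hγβ : γ < β) (hβ1 : β ≤ 1) (hρ : 0 ≤ ρ) (hW : DyadicHolder β K W)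
    (hY : PathBound ρ γ T Y C) (hZ : PathBound ρ γ T Z D) (hT : T ≤ 1) {t : ℝ} (ht0 : 0 ≤ t)
    (ht : t ≤ T) :
    youngInt W (fun r => Y r - Z r) t = youngInt W Y t - youngInt W Z t := by
  have lim : ∀ {X : ℝ → L2} {c : ℝ}, PathBound ρ γ T X c →
      Tendsto (youngSum W X t) atTop (𝓝 (youngInt W X t)) := fun hX =>
    tendsto_youngSum (by linarith) (by linarith) (by linarith) hβ1 (by linarith) hρ hW hX hT ht0 ht
  refine tendsto_nhds_unique (lim (hY.sub hZ)) ?_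
  simp only [funext (youngSum_sub W Y Z ht0)]
  exact (lim hY).sub (lim hZ)

/-- The two estimates behind the fixed point argument: the solution map is bounded on balls, and it
is a contraction on short intervals.  In the contraction estimate the paths agree before time `a`
and only the length `T - a` of the remaining interval has to be small. -/
theorem exists_mildMap_estimates {β : ℝ} (hα : 1 < α) (hγ : 1 / 2 < γ) (hγβ : γ < β) (hβ1 : β ≤ 1)
    (hξ : ∀ j, MemSmooth (ξ j)) :
    ∃ M : ℝ, 0 ≤ M ∧ ∀ (K R T : ℝ) (ω₀ : L2) (W : ℝ≥0 → ℝ), DyadicHolder β K W → T ≤ 1 →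
      (∀ (C₀ : ℝ) (f : ℝ → L2), 0 ≤ T → SobBound (2 * α) ω₀ C₀ → PathBound (2 * α) γ T f R →
        PathBound (2 * α) γ T (mildMap ξ ω₀ W f)
          (C₀ + M * (1 + K) * (1 + R) * T ^ (β - γ) * R)) ∧
      (∀ (a C : ℝ) (f g : ℝ → L2), 0 ≤ a → a ≤ T → PathBound (2 * α) γ T f R →
        PathBound (2 * α) γ T g R → PathBound (2 * α) γ T (fun t => f t - g t) C →
        (∀ r, 0 ≤ r → r < a → f r = g r) →
        PathBound (2 * α) γ T (fun t => mildMap ξ ω₀ W f t - mildMap ξ ω₀ W g t)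
          (M * (1 + K) * (1 + R) * (T - a) ^ (β - γ) * C)) := by
  have hγ1 : γ < 1 := by linarith
  have hγ0 : 0 < γ := by linarith
  obtain ⟨A₁, hA₁, h₁⟩ := exists_pathBound_advection hα hγ0 hγ1
  obtain ⟨A₂, hA₂, h₂⟩ := exists_pathBound_transport (γ := γ) hα hξ
  obtain ⟨M, hM, hY⟩ := exists_pathBound_youngInt hγ hγβ hβ1
  have hρ : 0 ≤ 2 * α - 1 := by linarith
  have htd := dyadicHolder_timeDriver hβ1
  refine ⟨M * (2 * A₁ + A₂), by positivity, fun K R T ω₀ W hW hT => ⟨?_, ?_⟩⟩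
  · intro C₀ f hT0 hω₀ hf
    have hK := hW.nonneg
    have hR := hf.nonneg
    have h3 := hY _ _ _ 0 T _ _ hρ htd (h₁ T R R f f hf hf) hT le_rfl hT0
      fun r hr hr' => absurd hr' (not_lt.2 hr)
    have h4 := hY _ _ _ 0 T _ _ hρ hW (h₂ T R f hf) hT le_rfl hT0
      fun r hr hr' => absurd hr' (not_lt.2 hr)
    rw [sub_add_cancel, sub_zero] at h3 h4
    refine (((pathBound_heat T hω₀ hγ0.le hγ1.le).sub h3).sub h4).mono ?_
    have h5 : M * (1 * (A₁ * (R * R))) * T ^ (β - γ) + M * (K * (A₂ * R)) * T ^ (β - γ) =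
        M * (A₁ * R + A₂ * K) * T ^ (β - γ) * R := by ring
    rw [add_assoc, h5]
    have h6 : A₁ * R + A₂ * K ≤ (2 * A₁ + A₂) * (1 + K) * (1 + R) := by
      nlinarith [mul_nonneg hA₁ hK, mul_nonneg hA₁ hR, mul_nonneg hA₂ hK, mul_nonneg hA₂ hR,
        mul_nonneg (mul_nonneg hA₁ hK) hR, mul_nonneg (mul_nonneg hA₂ hK) hR]
    calc C₀ + M * (A₁ * R + A₂ * K) * T ^ (β - γ) * R
        ≤ C₀ + M * ((2 * A₁ + A₂) * (1 + K) * (1 + R)) * T ^ (β - γ) * R := by gcongr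
      _ = _ := by ring
  · intro a C f g ha haT hf hg hfg heq
    have hK := hW.nonneg
    have hR := hf.nonneg
    have hC := hfg.nonneg
    have hTa : 0 ≤ T - a := sub_nonneg.2 haT
    -- difference of the nonlinear terms
    have h3 : PathBound (2 * α - 1) γ T
        (fun t => advection (f t) (f t) - advection (g t) (g t)) (2 * A₁ * (R * C)) := by
      refine (((h₁ T C R _ f hfg hf).add (h₁ T R C g _ hg hfg)).mono
        (le_of_eq (by ring))).congr fun t ht0 ht => ?_
      have hft := hf.memSobolev_one hα ht0 ht
      have hgt := hg.memSobolev_one hα ht0 ht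
      have e1 := advection_add_left (g := f t) one_pos (hft.sub hgt) hgt
      have e2 := advection_add_right one_pos hgt (hft.sub hgt) hgt
      rw [sub_add_cancel] at e1 e2
      rw [e1, add_sub_assoc, e2, add_sub_cancel_right]
    have h4 : PathBound (2 * α - 1) γ T
        (fun t => transport ξ (f t) - transport ξ (g t)) (A₂ * C) := by
      refine (h₂ T C _ hfg).congr fun t ht0 ht => ?_
      rw [transport_sub_right (fun j => (hξ j).summable) (hf.memSobolev_one hα ht0 ht)
        (hg.memSobolev_one hα ht0 ht)]
    have h5 := hY _ _ _ a T _ _ hρ htd h3 hT ha haT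
      fun r hr hra => by simp only [heq r hr hra, sub_self]
    have h6 := hY _ _ _ a T _ _ hρ hW h4 hT ha haT
      fun r hr hra => by simp only [heq r hr hra, sub_self]
    rw [sub_add_cancel] at h5 h6
    refine ((h5.add h6).neg.congr fun t ht0 ht => ?_).mono ?_
    · rw [youngInt_sub hγ hγβ hβ1 hρ htd (h₁ T R R f f hf hf) (h₁ T R R g g hg hg) hT ht0 ht,
        youngInt_sub hγ hγβ hβ1 hρ hW (h₂ T R f hf) (h₂ T R g hg) hT ht0 ht, mildMap, mildMap]
      abel
    · have h7 : M * (1 * (2 * A₁ * (R * C))) * (T - a) ^ (β - γ) +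
          M * (K * (A₂ * C)) * (T - a) ^ (β - γ) =
          M * (2 * A₁ * R + A₂ * K) * (T - a) ^ (β - γ) * C := by ring
      rw [h7]
      have h8 : 2 * A₁ * R + A₂ * K ≤ (2 * A₁ + A₂) * (1 + K) * (1 + R) := by
        nlinarith [mul_nonneg hA₁ hK, mul_nonneg hA₁ hR, mul_nonneg hA₂ hK, mul_nonneg hA₂ hR,
          mul_nonneg (mul_nonneg hA₁ hK) hR, mul_nonneg (mul_nonneg hA₂ hK) hR]
      calc M * (2 * A₁ * R + A₂ * K) * (T - a) ^ (β - γ) * C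
          ≤ M * ((2 * A₁ + A₂) * (1 + K) * (1 + R)) * (T - a) ^ (β - γ) * C := by gcongr
        _ = _ := by ring

end

section

/-! ### Picard iteration and uniqueness of fixed points -/

/-- A time horizon, depending on a size `q ≥ 0` of the data, for which `q T^ε ≤ 1/2`. -/
def lifespan (ε q : ℝ) : ℝ := min 1 ((2 * (1 + q))⁻¹ ^ ε⁻¹)

theorem lifespan_pos {ε q : ℝ} (hq : 0 ≤ q) : 0 < lifespan ε q := lt_min one_pos (by positivity)

theorem lifespan_le_one (ε q : ℝ) : lifespan ε q ≤ 1 := min_le_left _ _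

theorem mul_rpow_lifespan_le {ε q T : ℝ} (hε : 0 < ε) (hq : 0 ≤ q) (hT0 : 0 ≤ T)
    (hT : T ≤ lifespan ε q) : q * T ^ ε ≤ 1 / 2 := by
  have h1 : T ^ ε ≤ (2 * (1 + q))⁻¹ := by
    calc T ^ ε ≤ ((2 * (1 + q))⁻¹ ^ ε⁻¹) ^ ε := by
          gcongr
          exact hT.trans (min_le_right _ _)
      _ = (2 * (1 + q))⁻¹ := by
          rw [← Real.rpow_mul (by positivity), inv_mul_cancel₀ hε.ne', Real.rpow_one]
  calc q * T ^ ε ≤ q * (2 * (1 + q))⁻¹ := by gcongr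
    _ ≤ 1 / 2 := by
        rw [← div_eq_mul_inv, div_le_div_iff₀ (by positivity) (by norm_num)]
        linarith

variable {α β γ : ℝ} {ξ : Fin 2 → L2}

/-- Two fixed points of the solution map, whatever their size, agree: on a short interval after the
time up to which they are known to agree, their difference is bounded by half of itself. -/
theorem mildMap_fixedPoint_unique (hα : 1 < α) (hγ : 1 / 2 < γ) (hγβ : γ < β) (hβ1 : β ≤ 1)
    (hξ : ∀ j, MemSmooth (ξ j)) {K R T : ℝ} {ω₀ : L2} {W : ℝ≥0 → ℝ} (hW : DyadicHolder β K W)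
    (hT : T ≤ 1) {f g : ℝ → L2} (hf : PathBound (2 * α) γ T f R) (hg : PathBound (2 * α) γ T g R)
    (hf' : ∀ t, 0 ≤ t → t ≤ T → f t = mildMap ξ ω₀ W f t)
    (hg' : ∀ t, 0 ≤ t → t ≤ T → g t = mildMap ξ ω₀ W g t) {t : ℝ} (ht0 : 0 ≤ t) (ht : t ≤ T) :
    f t = g t := by
  obtain ⟨M, hM, H⟩ := exists_mildMap_estimates hα hγ hγβ hβ1 hξ
  have hK := hW.nonneg
  have hR := hf.nonneg
  have hε : 0 < β - γ := sub_pos.2 hγβ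
  have hq : 0 ≤ M * (1 + K) * (1 + R) := by positivity
  set h := lifespan (β - γ) (M * (1 + K) * (1 + R)) with hh
  have hh0 : 0 < h := lifespan_pos hq
  have hT0 : 0 ≤ T := ht0.trans ht
  have key : ∀ n : ℕ, ∀ r, 0 ≤ r → r ≤ T → r < n * h → f r = g r := by
    intro n
    induction n with
    | zero => intro r hr _ hr'; simp only [Nat.cast_zero, zero_mul] at hr'; linarith
    | succ n ih =>
      intro r hr hrT hr'
      set a := min T (n * h) with ha
      set b := min T ((n + 1 : ℕ) * h) with hb
      have hab : a ≤ b := min_le_min_left _ (by gcongr; simp)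
      have hbT : b ≤ T := min_le_left _ _
      have ha0 : 0 ≤ a := le_min hT0 (by positivity)
      have hba : b - a ≤ h := by
        rcases le_total T (n * h) with h1 | h1
        · rw [ha, min_eq_left h1]
          linarith
        · rw [ha, min_eq_right h1, sub_le_iff_le_add]
          refine (min_le_right _ _).trans (le_of_eq ?_)
          push_cast; ring
      have hfb := hf.mono_time hbT
      have hgb := hg.mono_time hbT
      have hhalf : ∀ C, PathBound (2 * α) γ b (fun t => f t - g t) C →
          PathBound (2 * α) γ b (fun t => f t - g t) (C * (1 / 2)) := by
        intro C hC
        have h1 := (H K R b ω₀ W hW (hbT.trans hT)).2 a C f g ha0 hab hfb hgb hC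
          fun r hr hra => ih r hr (hra.le.trans (min_le_left _ _))
            (hra.trans_le (min_le_right _ _))
        refine (h1.congr fun t ht0 ht => ?_).mono ?_
        · rw [← hf' t ht0 (ht.trans hbT), ← hg' t ht0 (ht.trans hbT)]
        · rw [mul_comm C]
          exact mul_le_mul_of_nonneg_right
            (mul_rpow_lifespan_le hε hq (sub_nonneg.2 hab) hba) hC.nonneg
      have hall : ∀ m : ℕ, PathBound (2 * α) γ b (fun t => f t - g t)
          ((R + R) * (1 / 2) ^ m) := by
        intro m
        induction m with
        | zero => simpa using hfb.sub hgb
        | succ m ihm => rw [pow_succ, ← mul_assoc]; exact hhalf _ ihm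
      have hlim : Tendsto (fun m : ℕ => (R + R) * (1 / 2 : ℝ) ^ m) atTop (𝓝 0) := by
        simpa using (tendsto_pow_atTop_nhds_zero_of_lt_one (by norm_num)
          (show (1 / 2 : ℝ) < 1 by norm_num)).const_mul (R + R)
      have hzero : PathBound (2 * α) γ b (fun t => f t - g t) 0 :=
        PathBound.of_tendsto (F := fun (_ : ℕ) t => f t - g t)
          (fun t _ _ => tendsto_const_nhds) hlim (Eventually.of_forall hall)
      exact sub_eq_zero.1 (hzero.bound r hr (le_min hrT hr'.le)).eq_zero
  obtain ⟨n, hn⟩ := exists_nat_gt (t / h)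
  exact key n t ht0 ht ((div_lt_iff₀ hh0).1 hn)

open scoped Classical in
/-- The field itself if it belongs to `H^s`, and `0` otherwise. -/
def regularPart (s : ℝ) (f : L2) : L2 := if MemSobolev s f then f else 0

theorem regularPart_of_mem {s : ℝ} {f : L2} (h : MemSobolev s f) : regularPart s f = f :=
  if_pos h

theorem memSobolev_regularPart (s : ℝ) (f : L2) : MemSobolev s (regularPart s f) := by
  unfold regularPart
  split_ifs with h
  · exact h
  · exact (SobBound.zero s).memSobolev

/-- The Picard iterates.  They are cut off outside `H^{2α}`, so that they are defined and depend
measurably on the driver for every driver and every time. -/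
def picard (α : ℝ) (ξ : Fin 2 → L2) (ω₀ : L2) (W : ℝ≥0 → ℝ) : ℕ → ℝ → L2
  | 0 => fun _ => 0
  | n + 1 => fun t => regularPart (2 * α) (mildMap ξ ω₀ W (picard α ξ ω₀ W n) t)

/-- The limit of the Picard iterates. -/
def mildSolution (α : ℝ) (ξ : Fin 2 → L2) (ω₀ : L2) (W : ℝ≥0 → ℝ) (t : ℝ) : L2 :=
  limUnder atTop fun n => picard α ξ ω₀ W n t

theorem mildSolution_fixedPoint {R T : ℝ} {ω₀ : L2} {W : ℝ≥0 → ℝ} (hα : 1 < α) (hR : 0 ≤ R)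
    (hball : ∀ f, PathBound (2 * α) γ T f R → PathBound (2 * α) γ T (mildMap ξ ω₀ W f) R)
    (hcontr : ∀ C f g, PathBound (2 * α) γ T f R → PathBound (2 * α) γ T g R →
      PathBound (2 * α) γ T (fun t => f t - g t) C →
      PathBound (2 * α) γ T (fun t => mildMap ξ ω₀ W f t - mildMap ξ ω₀ W g t) (C * (1 / 2))) :
    PathBound (2 * α) γ T (mildSolution α ξ ω₀ W) R ∧
      (∀ t, 0 ≤ t → t ≤ T →
        mildSolution α ξ ω₀ W t = mildMap ξ ω₀ W (mildSolution α ξ ω₀ W) t) ∧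
      (∀ t, 0 ≤ t → t ≤ T →
        Tendsto (fun n => picard α ξ ω₀ W n t) atTop (𝓝 (mildSolution α ξ ω₀ W t))) ∧
      ∀ n, PathBound (2 * α) γ T (picard α ξ ω₀ W n) R ∧ ∀ t, 0 ≤ t → t ≤ T →
        picard α ξ ω₀ W (n + 1) t = mildMap ξ ω₀ W (picard α ξ ω₀ W n) t := by
  set x := picard α ξ ω₀ W with hx
  set y := mildSolution α ξ ω₀ W with hy
  have hsucc : ∀ n, PathBound (2 * α) γ T (x n) R → ∀ t, 0 ≤ t → t ≤ T →
      x (n + 1) t = mildMap ξ ω₀ W (x n) t := fun n hn t ht0 ht =>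
    regularPart_of_mem ((hball _ hn).bound t ht0 ht).memSobolev
  have hbd : ∀ n, PathBound (2 * α) γ T (x n) R := by
    intro n
    induction n with
    | zero => exact (PathBound.zero (2 * α) γ T).mono hR
    | succ n ih => exact (hball _ ih).congr (hsucc n ih)
  have hdiff : ∀ n, PathBound (2 * α) γ T (fun t => x (n + 1) t - x n t) (R * (1 / 2) ^ n) := by
    intro n
    induction n with
    | zero =>
      refine ((hbd 1).congr fun t _ _ => ?_).mono (by simp)
      simp [hx, picard]
    | succ n ih =>
      rw [pow_succ, ← mul_assoc]
      exact (hcontr _ _ _ (hbd (n + 1)) (hbd n) ih).congr fun t ht0 ht => by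
        rw [hsucc (n + 1) (hbd (n + 1)) t ht0 ht, hsucc n (hbd n) t ht0 ht]
  have hσ : 0 ≤ 2 * α := by linarith
  have hlim : ∀ t, 0 ≤ t → t ≤ T → Tendsto (fun n => x n t) atTop (𝓝 (y t)) := fun t ht0 ht =>
    tendsto_nhds_limUnder (tendsto_of_sobBound_geometric hσ (by norm_num) fun n =>
      (hdiff n).bound t ht0 ht)
  have hyR : PathBound (2 * α) γ T y R :=
    PathBound.of_tendsto hlim tendsto_const_nhds (Eventually.of_forall hbd)
  have htail : ∀ n, PathBound (2 * α) γ T (fun t => x n t - y t) (2 * R * (1 / 2) ^ n) := by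
    intro n
    have h1 : ∀ m, PathBound (2 * α) γ T (fun t => x n t - x (n + m) t)
        (2 * R * (1 / 2) ^ n - 2 * R * (1 / 2) ^ (n + m)) := by
      intro m
      induction m with
      | zero => simpa using PathBound.zero (2 * α) γ T
      | succ m ih =>
        refine ((ih.sub (hdiff (n + m))).congr fun t _ _ => ?_).mono (le_of_eq ?_)
        · rw [sub_sub, add_sub_cancel]; rfl
        · rw [← add_assoc, pow_succ]; ring
    refine PathBound.of_tendsto (l := atTop) (fun t ht0 ht => tendsto_const_nhds.sub
      ((tendsto_add_atTop_iff_nat n).2 (hlim t ht0 ht))) tendsto_const_nhds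
      (Eventually.of_forall fun m => ?_)
    rw [add_comm m n]
    exact (h1 m).mono (by
      have : 0 ≤ 2 * R * (1 / 2 : ℝ) ^ (n + m) := by positivity
      linarith)
  refine ⟨hyR, fun t ht0 ht => ?_, hlim, fun n => ⟨hbd n, hsucc n (hbd n)⟩⟩
  have hdec : Tendsto (fun n : ℕ => 2 * R * (1 / 2 : ℝ) ^ n) atTop (𝓝 0) := by
    simpa using (tendsto_pow_atTop_nhds_zero_of_lt_one (by norm_num)
      (show (1 / 2 : ℝ) < 1 by norm_num)).const_mul (2 * R)
  have h2 : Tendsto (fun n => x (n + 1) t) atTop (𝓝 (mildMap ξ ω₀ W y t)) := by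
    rw [tendsto_iff_norm_sub_tendsto_zero]
    refine squeeze_zero (fun _ => norm_nonneg _) (fun n => ?_) hdec
    have h3 := (hcontr _ _ _ (hbd n) hyR (htail n)).bound t ht0 ht
    rw [hsucc n (hbd n) t ht0 ht]
    refine (h3.norm_le hσ).trans ?_
    have : 0 ≤ 2 * R * (1 / 2 : ℝ) ^ n := by positivity
    linarith
  exact tendsto_nhds_unique ((tendsto_add_atTop_iff_nat 1).2 (hlim t ht0 ht)) h2

end

/-! ### Continuity in time -/

theorem MemSobolev.sobBound {s : ℝ} {f : L2} (h : MemSobolev s f) :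
    SobBound s f (sobolevNorm s f).toReal := by
  refine (sobolevNorm_le_iff ENNReal.toReal_nonneg f).1 ?_
  rw [ENNReal.ofReal_toReal (ne_of_lt h)]

theorem sobolevNorm_sub_le (s : ℝ) (f g : L2) :
    sobolevNorm s (f - g) ≤ sobolevNorm s f + sobolevNorm s g := by
  by_cases hf : sobolevNorm s f = ∞
  · rw [hf, top_add]; exact le_top
  by_cases hg : sobolevNorm s g = ∞
  · rw [hg, add_top]; exact le_top
  have hf' : MemSobolev s f := lt_top_iff_ne_top.2 hf
  have hg' : MemSobolev s g := lt_top_iff_ne_top.2 hg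
  have h := (hf'.sobBound.sub hg'.sobBound).sobolevNorm_le
  rwa [ENNReal.ofReal_add ENNReal.toReal_nonneg ENNReal.toReal_nonneg, ENNReal.ofReal_toReal hf,
    ENNReal.ofReal_toReal hg] at h

theorem tendsto_of_tendsto_sobolevNorm {s : ℝ} (hs : 0 ≤ s) {ι : Type*} {l : Filter ι}
    {f : ι → L2} {g : L2} (h : Tendsto (fun i => sobolevNorm s (f i - g)) l (𝓝 0)) :
    Tendsto f l (𝓝 g) := by
  rw [tendsto_iff_norm_sub_tendsto_zero]
  have h1 := (ENNReal.tendsto_toReal ENNReal.zero_ne_top).comp h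
  rw [ENNReal.toReal_zero] at h1
  have h2 : ∀ᶠ i in l, sobolevNorm s (f i - g) < ∞ := h.eventually_lt_const ENNReal.zero_lt_top
  refine squeeze_zero' (Eventually.of_forall fun _ => norm_nonneg _) (h2.mono fun i hi => ?_) h1
  exact (MemSobolev.sobBound hi).norm_le hs

theorem tendsto_sobolevNorm_of_sobBound {s : ℝ} {ι : Type*} {l : Filter ι} {f : ι → L2}
    {c : ι → ℝ} (h : ∀ᶠ i in l, SobBound s (f i) (c i)) (hc : Tendsto c l (𝓝 0)) :
    Tendsto (fun i => sobolevNorm s (f i)) l (𝓝 0) := by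
  have h1 := ENNReal.tendsto_ofReal hc
  rw [ENNReal.ofReal_zero] at h1
  exact tendsto_of_tendsto_of_tendsto_of_le_of_le' tendsto_const_nhds h1
    (Eventually.of_forall fun _ => zero_le) (h.mono fun i hi => hi.sobolevNorm_le)

/-- The heat semigroup is strongly continuous on `H^s`. -/
theorem tendsto_sobolevNorm_heat_sub {s : ℝ} {f : L2} (hf : MemSobolev s f) {t : ℝ} (ht : 0 ≤ t) :
    Tendsto (fun r => sobolevNorm s (heat r f - heat t f)) (𝓝[Ici 0] t) (𝓝 0) := by
  obtain ⟨C, hC⟩ := memSobolev_iff.1 hf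
  have hnn : ∀ k, 0 ≤ jap k ^ s * ‖coeff f k‖ ^ 2 := fun k => by
    have := jap_pos k
    positivity
  have hsum : Summable fun k => jap k ^ s * ‖coeff f k‖ ^ 2 := summable_of_sum_le hnn hC.2
  set a : ℝ → (Fin 2 → ℤ) → ℝ := fun r k =>
    (Real.exp (-(r * eigenvalue k)) - Real.exp (-(t * eigenvalue k))) ^ 2 *
      (jap k ^ s * ‖coeff f k‖ ^ 2) with ha
  have hle : ∀ r, 0 ≤ r → ∀ k, ‖a r k‖ ≤ jap k ^ s * ‖coeff f k‖ ^ 2 := by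
    intro r hr k
    rw [Real.norm_of_nonneg (mul_nonneg (sq_nonneg _) (hnn k))]
    refine mul_le_of_le_one_left (hnn k) ?_
    have e1 : Real.exp (-(r * eigenvalue k)) ≤ 1 :=
      Real.exp_le_one_iff.2 (neg_nonpos.2 (mul_nonneg hr (eigenvalue_nonneg k)))
    have e2 : Real.exp (-(t * eigenvalue k)) ≤ 1 :=
      Real.exp_le_one_iff.2 (neg_nonpos.2 (mul_nonneg ht (eigenvalue_nonneg k)))
    have e3 := Real.exp_pos (-(r * eigenvalue k))
    have e4 := Real.exp_pos (-(t * eigenvalue k))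
    rw [sq_le_one_iff_abs_le_one, abs_le]
    constructor <;> linarith
  have hev : ∀ᶠ r in 𝓝[Ici 0] t, (0 : ℝ) ≤ r := eventually_mem_nhdsWithin
  have hlim : Tendsto (fun r => ∑' k, a r k) (𝓝[Ici 0] t) (𝓝 (∑' _ : Fin 2 → ℤ, (0 : ℝ))) := by
    refine tendsto_tsum_of_dominated_convergence hsum (fun k => ?_) (hev.mono hle)
    have hc : Continuous fun r => a r k := by fun_prop
    have := hc.tendsto t
    simp only [ha, sub_self, ne_eq, OfNat.ofNat_ne_zero, not_false_eq_true, zero_pow,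
      zero_mul] at this
    exact this.mono_left nhdsWithin_le_nhds
  rw [tsum_zero] at hlim
  have hlim2 := (Real.continuous_sqrt.tendsto 0).comp hlim
  rw [Real.sqrt_zero] at hlim2
  refine tendsto_sobolevNorm_of_sobBound (hev.mono fun r hr => ?_) hlim2
  have hnn' : ∀ k, 0 ≤ a r k := fun k => mul_nonneg (sq_nonneg _) (hnn k)
  refine ⟨Real.sqrt_nonneg _, fun F => ?_⟩
  simp only [Function.comp]
  rw [Real.sq_sqrt (tsum_nonneg hnn')]
  refine le_trans (le_of_eq (Finset.sum_congr rfl fun k _ => ?_))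
    ((Summable.of_norm_bounded hsum (hle r hr)).sum_le_tsum F fun k _ => hnn' k)
  rw [coeff_sub, coeff_heat hr, coeff_heat ht, ← sub_mul, norm_mul, mul_pow,
    ← Complex.ofReal_sub, Complex.norm_real, Real.norm_eq_abs, sq_abs]
  ring

theorem contPath_heat {s T : ℝ} {f : L2} (hf : MemSobolev s f) :
    ContPath s T fun t => heat t f := by
  obtain ⟨C, hC⟩ := memSobolev_iff.1 hf
  refine ⟨fun t ht => (hC.heat ht.1).memSobolev, fun t ht => ?_⟩
  exact (tendsto_sobolevNorm_heat_sub hf ht.1).mono_left (nhdsWithin_mono _ Icc_subset_Ici_self)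

theorem ContPath.sub {s T : ℝ} {f g : ℝ → L2} (hf : ContPath s T f) (hg : ContPath s T g) :
    ContPath s T fun t => f t - g t := by
  refine ⟨fun t ht => (hf.1 t ht).sub (hg.1 t ht), fun t ht => ?_⟩
  have h := (hf.2 t ht).add (hg.2 t ht)
  rw [add_zero] at h
  refine tendsto_of_tendsto_of_tendsto_of_le_of_le tendsto_const_nhds h (fun _ => zero_le)
    fun r => ?_
  change sobolevNorm s (f r - g r - (f t - g t)) ≤ _
  rw [sub_sub_sub_comm]
  exact sobolevNorm_sub_le _ _ _

theorem ContPath.congr {s T : ℝ} {f g : ℝ → L2} (hf : ContPath s T f)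
    (h : ∀ t ∈ Icc 0 T, g t = f t) : ContPath s T g := by
  refine ⟨fun t ht => by rw [h t ht]; exact hf.1 t ht, fun t ht => ?_⟩
  refine (hf.2 t ht).congr' ?_
  filter_upwards [self_mem_nhdsWithin] with r hr
  rw [h t ht, h r hr]

theorem contPath_of_holder {s T ε D : ℝ} (hε : 0 < ε) {f : ℝ → L2}
    (hf : ∀ t ∈ Icc 0 T, MemSobolev s (f t))
    (h : ∀ r t, 0 ≤ r → r ≤ t → t ≤ T → SobBound s (f t - f r) (D * (t - r) ^ ε)) :
    ContPath s T f := by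
  refine ⟨hf, fun t ht => ?_⟩
  have hc : Tendsto (fun r => D * |r - t| ^ ε) (𝓝[Icc 0 T] t) (𝓝 0) := by
    have : Continuous fun r : ℝ => D * |r - t| ^ ε :=
      continuous_const.mul ((by fun_prop : Continuous fun r : ℝ => |r - t|).rpow_const
        fun _ => Or.inr hε.le)
    have h0 := this.tendsto t
    rw [sub_self, abs_zero, Real.zero_rpow hε.ne', mul_zero] at h0
    exact h0.mono_left nhdsWithin_le_nhds
  refine tendsto_sobolevNorm_of_sobBound ?_ hc
  filter_upwards [self_mem_nhdsWithin] with r hr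
  rcases le_total r t with hrt | hrt
  · rw [abs_sub_comm, abs_of_nonneg (sub_nonneg.2 hrt)]
    exact (h r t hr.1 hrt ht.2).sub_comm
  · rw [abs_of_nonneg (sub_nonneg.2 hrt)]
    exact h t r ht.1 hrt hr.2

/-- The Young integral is a continuous path in `H^{ρ+1}`, because it is bounded in a slightly better
space. -/
theorem contPath_youngInt {β γ ρ K C T : ℝ} {W : ℝ≥0 → ℝ} {Y : ℝ → L2} (hγ : 1 / 2 < γ)
    (hγβ : γ < β) (hβ1 : β ≤ 1) (hρ : 0 ≤ ρ) (hW : DyadicHolder β K W)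
    (hY : PathBound ρ γ T Y C) (hT : T ≤ 1) : ContPath (ρ + 1) T (youngInt W Y) := by
  have hβγ : 1 < β + γ := by linarith
  have hγ0 : 0 < γ := by linarith
  have hγ1 : γ ≤ 1 := by linarith
  have hK := hW.nonneg
  have hC := hY.nonneg
  set ε : ℝ := (β - 1 / 2) / 2 with hε
  have hε0 : 0 < ε := by rw [hε]; linarith
  obtain ⟨M₁, hM₁, H₁⟩ :=
    exists_sobBound_youngInt (θ := 1 / 2) hγ0 hγ1 hβ1 hβγ (by norm_num) (by linarith)
  obtain ⟨M₂, hM₂, H₂⟩ :=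
    exists_sobBound_youngInt (θ := 1 / 2 + ε) hγ0 hγ1 hβ1 hβγ (by linarith) (by linarith)
  have hI0 : youngInt W Y 0 = 0 := youngInt_eq_zero le_rfl fun r hr hr' => absurd hr' (not_lt.2 hr)
  have hbd : ∀ t, 0 ≤ t → t ≤ T → SobBound (ρ + 1 + 2 * ε) (youngInt W Y t) (M₂ * (K * C)) := by
    intro t ht0 ht
    have h1 := H₂ ρ K C T W Y hρ hW hY hT 0 t le_rfl ht0 ht
    rw [hI0, sub_zero, heat_zero_right ht0, sub_zero,
      show ρ + 2 * (1 / 2 + ε) = ρ + 1 + 2 * ε by ring] at h1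
    refine h1.mono (mul_le_of_le_one_right (by positivity) ?_)
    exact Real.rpow_le_one ht0 (ht.trans hT) (by linarith)
  refine contPath_of_holder (D := M₁ * (K * C) + M₂ * (K * C)) hε0 (fun t ht =>
    ((hbd t ht.1 ht.2).mono_exponent (by linarith)).memSobolev) fun s t hs hst ht => ?_
  have hts : 0 ≤ t - s := sub_nonneg.2 hst
  have h1 := H₁ ρ K C T W Y hρ hW hY hT s t hs hst ht
  have h2 := (hbd s hs (hst.trans ht)).heat_sub_self hts hε0.le (by linarith)
  rw [show ρ + 2 * (1 / 2) = ρ + 1 by ring] at h1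
  have h3 := h1.add h2
  rw [sub_add_sub_cancel] at h3
  refine h3.mono ?_
  have h4 : (t - s) ^ (β - 1 / 2) ≤ (t - s) ^ ε :=
    Real.rpow_le_rpow_of_exponent_ge' hts (by linarith) hε0.le (by linarith)
  calc M₁ * (K * C) * (t - s) ^ (β - 1 / 2) + (t - s) ^ ε * (M₂ * (K * C))
      ≤ M₁ * (K * C) * (t - s) ^ ε + (t - s) ^ ε * (M₂ * (K * C)) := by gcongr
    _ = _ := by ring

theorem ContPath.exists_bound {s T : ℝ} {f : ℝ → L2} (hf : ContPath s T f) :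
    ∃ R, 0 ≤ R ∧ ∀ t ∈ Icc 0 T, SobBound s (f t) R := by
  refine isCompact_Icc.induction_on
    (p := fun S => ∃ R, 0 ≤ R ∧ ∀ t ∈ S, SobBound s (f t) R) ⟨0, le_rfl, by simp⟩ ?_ ?_ ?_
  · rintro S S' hSS' ⟨R, hR, h⟩
    exact ⟨R, hR, fun t ht => h t (hSS' ht)⟩
  · rintro S S' ⟨R, hR, h⟩ ⟨R', hR', h'⟩
    refine ⟨R + R', by positivity, fun t ht => ?_⟩
    rcases ht with ht | ht
    · exact (h t ht).mono (by linarith)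
    · exact (h' t ht).mono (by linarith)
  · intro t ht
    have h1 : ∀ᶠ r in 𝓝[Icc 0 T] t, sobolevNorm s (f r - f t) < 1 :=
      (hf.2 t ht).eventually_lt_const zero_lt_one
    refine ⟨_, h1, 1 + (sobolevNorm s (f t)).toReal, by positivity, fun r hr => ?_⟩
    have h2 : SobBound s (f r - f t) 1 := by
      refine (sobolevNorm_le_iff zero_le_one _).1 ?_
      rw [ENNReal.ofReal_one]
      exact le_of_lt hr
    have h3 := h2.add (hf.1 t ht).sobBound
    rwa [sub_add_cancel] at h3

theorem continuousOn_advection {s T : ℝ} (hs : 1 ≤ s) {f : ℝ → L2} (hf : ContPath s T f) :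
    ContinuousOn (fun t => advection (f t) (f t)) (Icc 0 T) := by
  intro t ht
  rw [ContinuousWithinAt, tendsto_iff_norm_sub_tendsto_zero]
  set A : ℝ := 4 * 2 ^ (|(0 : ℝ)| / 2) * wienerConst 1
  set e : ℝ → ℝ := fun r => (sobolevNorm s (f r - f t)).toReal
  set R : ℝ := (sobolevNorm s (f t)).toReal
  have he : Tendsto e (𝓝[Icc 0 T] t) (𝓝 0) := by
    have := (ENNReal.tendsto_toReal ENNReal.zero_ne_top).comp (hf.2 t ht)
    rwa [ENNReal.toReal_zero] at this
  have hbound : Tendsto (fun r => A * e r * e r + A * e r * R + A * R * e r) (𝓝[Icc 0 T] t)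
      (𝓝 0) := by
    have := (((he.const_mul A).mul he).add ((he.const_mul A).mul_const R)).add
      (he.const_mul (A * R))
    simpa using this
  refine squeeze_zero' (Eventually.of_forall fun _ => norm_nonneg _) ?_ hbound
  filter_upwards [self_mem_nhdsWithin] with r hr
  have hd : MemSobolev s (f r - f t) := (hf.1 r hr).sub (hf.1 t ht)
  have hd1 := hd.mono hs
  have ht1 := (hf.1 t ht).mono hs
  have hr1 := (hf.1 r hr).mono hs
  have main : ∀ {g h : L2} {a b : ℝ}, SobBound s g a → SobBound s h b →
      SobBound 0 (advection g h) (A * a * b) := by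
    intro g h a b hg hh
    refine SobBound.advection one_pos (hg.mono_exponent (by simpa using hs))
      (hh.memSobolev.mono hs) (hh.mono_exponent (by simpa using hs))
  have hsplit : advection (f r) (f r) - advection (f t) (f t) =
      advection (f r - f t) (f r - f t) + advection (f r - f t) (f t) +
        advection (f t) (f r - f t) := by
    have e1 := advection_add_left (g := f r) one_pos hd1 ht1
    have e2 := advection_add_right one_pos ht1 hd1 ht1
    have e3 := advection_add_right one_pos hd1 hd1 ht1
    rw [sub_add_cancel] at e1 e2 e3
    rw [e1, e2, e3]
    abel
  rw [hsplit]
  exact (((main hd.sobBound hd.sobBound).add (main hd.sobBound (hf.1 t ht).sobBound)).add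
    (main (hf.1 t ht).sobBound hd.sobBound)).norm_le le_rfl

theorem continuousOn_heat_comp {t : ℝ} {F : ℝ → L2} (hF : ContinuousOn F (Icc 0 t)) :
    ContinuousOn (fun s => heat (t - s) (F s)) (Icc 0 t) := by
  intro s hs
  have hts : 0 ≤ t - s := sub_nonneg.2 hs.2
  have h1 : Tendsto (fun r => heat (t - r) (F s)) (𝓝[Icc 0 t] s) (𝓝 (heat (t - s) (F s))) := by
    have h2 : Tendsto (fun r => heat r (F s)) (𝓝[Ici 0] (t - s)) (𝓝 (heat (t - s) (F s))) :=
      tendsto_of_tendsto_sobolevNorm le_rfl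
        (tendsto_sobolevNorm_heat_sub (memSobolev_zero_exponent (F s)) hts)
    refine h2.comp (tendsto_nhdsWithin_iff.2 ⟨?_, ?_⟩)
    · exact ((continuous_const.sub continuous_id).tendsto s).mono_left nhdsWithin_le_nhds
    · filter_upwards [self_mem_nhdsWithin] with r hr
      exact sub_nonneg.2 hr.2
  rw [ContinuousWithinAt, tendsto_iff_norm_sub_tendsto_zero]
  have h3 := tendsto_iff_norm_sub_tendsto_zero.1 (hF s hs)
  have h4 := h3.add (tendsto_iff_norm_sub_tendsto_zero.1 h1)
  rw [add_zero] at h4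
  refine squeeze_zero' (Eventually.of_forall fun _ => norm_nonneg _) ?_ h4
  filter_upwards [self_mem_nhdsWithin] with r hr
  have htr : 0 ≤ t - r := sub_nonneg.2 hr.2
  rw [← sub_add_sub_cancel (heat (t - r) (F r)) (heat (t - r) (F s)), ← heat_sub htr]
  refine (norm_add_le _ _).trans (add_le_add ?_ le_rfl)
  exact ((sobBound_norm _).heat htr).norm_le le_rfl

/-- Dyadic left Riemann sums of a continuous function converge to its integral. -/
theorem tendsto_dyadic_riemannSum {E : Type*} [NormedAddCommGroup E] [NormedSpace ℝ E]
    [CompleteSpace E]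
    {g : ℝ → E} {t : ℝ} (ht : 0 ≤ t) (hg : ContinuousOn g (Icc 0 t)) :
    Tendsto (fun k : ℕ => ∑ n ∈ Finset.range ⌊t * 2 ^ k⌋₊,
      (1 / 2 ^ k : ℝ) • g ((n : ℝ) / 2 ^ k)) atTop (𝓝 (∫ s in (0 : ℝ)..t, g s)) := by
  obtain ⟨B, hB⟩ := isCompact_Icc.exists_bound_of_continuousOn hg
  have hB0 : 0 ≤ B := (norm_nonneg _).trans (hB 0 ⟨le_rfl, ht⟩)
  have huc := Metric.uniformContinuousOn_iff.1 (isCompact_Icc.uniformContinuousOn_of_continuous hg)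
  rw [Metric.tendsto_atTop]
  intro ε hε
  obtain ⟨δ, hδ, hδ'⟩ := huc (ε / (2 * (t + 1))) (by positivity)
  have hpow : Tendsto (fun k : ℕ => (1 / 2 : ℝ) ^ k) atTop (𝓝 0) :=
    tendsto_pow_atTop_nhds_zero_of_lt_one (by norm_num) (by norm_num)
  have hη : 0 < min δ (ε / (2 * (B + 1))) := by positivity
  obtain ⟨k₀, hk₀⟩ := (hpow.eventually_lt_const hη).exists_forall_of_atTop
  refine ⟨k₀, fun k hk => ?_⟩
  have hmesh := hk₀ k hk
  rw [one_div_pow] at hmesh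
  set N := ⌊t * 2 ^ k⌋₊ with hN
  set a : ℕ → ℝ := fun n => (n : ℝ) / 2 ^ k with ha
  have h2k : (0 : ℝ) < 2 ^ k := by positivity
  have ha0 : ∀ n, 0 ≤ a n := fun n => by positivity
  have hstep : ∀ n, a (n + 1) - a n = 1 / 2 ^ k := fun n => by
    simp only [ha]; push_cast; ring
  have haN : a N ≤ t := by
    rw [ha, div_le_iff₀ h2k]
    exact Nat.floor_le (by positivity)
  have hmono : Monotone a := fun m n hmn => by simp only [ha]; gcongr
  have hat : ∀ n, n ≤ N → a n ≤ t := fun n hn => (hmono hn).trans haN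
  have htN : t - a N ≤ 1 / 2 ^ k := by
    rw [sub_le_iff_le_add, ← add_div, le_div_iff₀ h2k]
    linarith [Nat.lt_floor_add_one (t * 2 ^ k)]
  have hint : ∀ x y, 0 ≤ x → x ≤ y → y ≤ t → IntervalIntegrable g volume x y :=
    fun x y hx hxy hy => (hg.mono (by
      rw [uIcc_of_le hxy]; exact Icc_subset_Icc hx hy)).intervalIntegrable
  have hsum : ∑ n ∈ Finset.range N, ∫ s in a n..a (n + 1), g s = ∫ s in a 0..a N, g s :=
    intervalIntegral.sum_integral_adjacent_intervals fun n hn =>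
      hint _ _ (ha0 n) (hmono (Nat.le_succ n)) (hat _ hn)
  have hsplit : ∫ s in (0 : ℝ)..t, g s =
      ∑ n ∈ Finset.range N, (∫ s in a n..a (n + 1), g s) + ∫ s in a N..t, g s := by
    rw [hsum, show a 0 = 0 by simp [ha], intervalIntegral.integral_add_adjacent_intervals
      (hint _ _ le_rfl (ha0 N) haN) (hint _ _ (ha0 N) haN le_rfl)]
  have hlast : ‖∫ s in a N..t, g s‖ ≤ B * (1 / 2 ^ k) := by
    refine (intervalIntegral.norm_integral_le_of_norm_le_const (C := B) fun x hx => ?_).trans ?_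
    · rw [uIoc_of_le haN] at hx
      exact hB x ⟨(ha0 N).trans hx.1.le, hx.2⟩
    · rw [abs_of_nonneg (sub_nonneg.2 haN)]
      gcongr
  have hpiece : ∀ n ∈ Finset.range N,
      ‖(∫ s in a n..a (n + 1), g s) - (1 / 2 ^ k : ℝ) • g (a n)‖ ≤
        ε / (2 * (t + 1)) * (1 / 2 ^ k) := by
    intro n hn
    have hn' := Finset.mem_range.1 hn
    have hle := hmono (Nat.le_succ n)
    have hc : (1 / 2 ^ k : ℝ) • g (a n) = ∫ _ in a n..a (n + 1), g (a n) := by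
      rw [intervalIntegral.integral_const, hstep]
    rw [hc, ← intervalIntegral.integral_sub (hint _ _ (ha0 n) hle (hat _ hn'))
      intervalIntegrable_const]
    refine (intervalIntegral.norm_integral_le_of_norm_le_const (C := ε / (2 * (t + 1)))
      fun x hx => ?_).trans (le_of_eq ?_)
    · rw [uIoc_of_le hle] at hx
      rw [← dist_eq_norm]
      refine (hδ' x ⟨(ha0 n).trans hx.1.le, hx.2.trans (hat _ hn')⟩ (a n)
        ⟨ha0 n, hat _ hn'.le⟩ ?_).le
      rw [Real.dist_eq, abs_of_nonneg (sub_nonneg.2 hx.1.le)]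
      calc x - a n ≤ a (n + 1) - a n := by linarith [hx.2]
        _ = 1 / 2 ^ k := hstep n
        _ < δ := hmesh.trans_le (min_le_left _ _)
    · rw [hstep, abs_of_nonneg (by positivity)]
  rw [dist_comm, dist_eq_norm, hsplit, add_sub_right_comm, ← Finset.sum_sub_distrib]
  have hNt : (N : ℝ) * (1 / 2 ^ k) ≤ t := by rw [mul_one_div]; exact haN
  have hsum_le : ‖∑ n ∈ Finset.range N,
      ((∫ s in a n..a (n + 1), g s) - (1 / 2 ^ k : ℝ) • g (a n))‖ ≤ ε / 2 := by
    refine (norm_sum_le_of_le _ hpiece).trans ?_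
    rw [Finset.sum_const, Finset.card_range, nsmul_eq_mul]
    calc (N : ℝ) * (ε / (2 * (t + 1)) * (1 / 2 ^ k))
        = ε / (2 * (t + 1)) * (N * (1 / 2 ^ k)) := by ring
      _ ≤ ε / (2 * (t + 1)) * (t + 1) := by gcongr; linarith
      _ = ε / 2 := by field_simp
  have hlast' : ‖∫ s in a N..t, g s‖ < ε / 2 := by
    refine hlast.trans_lt ?_
    have h1 : (1 : ℝ) / 2 ^ k < ε / (2 * (B + 1)) := hmesh.trans_le (min_le_right _ _)
    calc B * (1 / 2 ^ k) ≤ (B + 1) * (1 / 2 ^ k) := by gcongr; linarith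
      _ < (B + 1) * (ε / (2 * (B + 1))) := by gcongr
      _ = ε / 2 := by field_simp
  calc _ ≤ _ := norm_add_le _ _
    _ < ε / 2 + ε / 2 := add_lt_add_of_le_of_lt hsum_le hlast'
    _ = ε := add_halves ε

theorem integral_eq_youngInt {t : ℝ} (ht : 0 ≤ t) {F : ℝ → L2} (hF : ContinuousOn F (Icc 0 t)) :
    IntervalIntegrable (fun s => heat (t - s) (F s)) volume 0 t ∧
      ∫ s in (0 : ℝ)..t, heat (t - s) (F s) = youngInt timeDriver F t := by
  have hc := continuousOn_heat_comp hF
  refine ⟨(hc.mono (by rw [uIcc_of_le ht])).intervalIntegrable, ?_⟩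
  refine (Tendsto.limUnder_eq ?_).symm
  have h := tendsto_dyadic_riemannSum ht hc
  refine h.congr fun k => ?_
  rw [youngSum_eq]
  simp only [dyadicIncr_timeDriver]

section

/-! ### Mild solutions as fixed points -/

variable {α β γ : ℝ} {ξ : Fin 2 → L2}

theorem MemV.exists_pathBound {T : ℝ} {f : ℝ → L2} (h : MemV α γ T f) :
    ∃ R, PathBound (2 * α) γ T f R := by
  obtain ⟨R, hR, hb⟩ := h.2.1.exists_bound
  obtain ⟨-, C, hC⟩ := h.2.2
  refine ⟨R + C, by positivity, fun t ht0 ht => (hb t ⟨ht0, ht⟩).mono (by simp),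
    fun s t hs hst ht => ?_⟩
  have hts : 0 ≤ t - s := sub_nonneg.2 hst
  have h1 := hC s ⟨hs, hst.trans ht⟩ t ⟨hs.trans hst, ht⟩
  rw [abs_of_nonneg hts, ← ENNReal.ofReal_coe_nnreal, ← ENNReal.ofReal_mul (by positivity)] at h1
  refine ((sobolevNorm_le_iff (by positivity) _).1 h1).mono ?_
  gcongr
  linarith

theorem IsMildSolution.fixedPoint (hα : 1 < α) {T : ℝ} {ω₀ : L2} {W : ℝ≥0 → ℝ} {f : ℝ → L2}
    (h : IsMildSolution α γ ξ ω₀ W T f) {t : ℝ} (ht0 : 0 ≤ t) (ht : t ≤ T) : f t = mildMap ξ ω₀ W f t := by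
  obtain ⟨hV, hs⟩ := h
  obtain ⟨-, I, hI, heq⟩ := hs t ⟨ht0, ht⟩
  have h1 := (integral_eq_youngInt ht0 ((continuousOn_advection (by linarith) hV.2.1).mono
    (Icc_subset_Icc_right ht))).2
  have h2 : youngInt W (fun s => transport ξ (f s)) t = I :=
    (tendsto_of_tendsto_sobolevNorm (by linarith) hI.2).limUnder_eq
  rw [heq, mildMap, h2, ← h1]
  rfl

/-- A real-valued fixed point of `mildMap` that obeys a `PathBound` is a mild solution: the fixed
point equation upgrades its boundedness in `H^{2α}` to continuity. -/
theorem isMildSolution_of_fixedPoint (hα : 1 < α) (hγ : 1 / 2 < γ) (hγβ : γ < β) (hβ1 : β ≤ 1)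
    (hξ : ∀ j, MemSmooth (ξ j)) {K R T : ℝ} {ω₀ : L2} {W : ℝ≥0 → ℝ}
    (hω₀ : MemSobolev (2 * α) ω₀) (hW : DyadicHolder β K W)
    (hT : T ≤ 1) {f : ℝ → L2} (hf : PathBound (2 * α) γ T f R)
    (hreal : ∀ t, 0 ≤ t → t ≤ T → IsReal (f t))
    (hfix : ∀ t, 0 ≤ t → t ≤ T → f t = mildMap ξ ω₀ W f t) :
    IsMildSolution α γ ξ ω₀ W T f := by
  have hγ1 : γ < 1 := by linarith
  have hρ : 0 ≤ 2 * α - 1 := by linarith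
  obtain ⟨A₁, hA₁, h₁⟩ := exists_pathBound_advection hα (by linarith : 0 < γ) hγ1
  obtain ⟨A₂, hA₂, h₂⟩ := exists_pathBound_transport (γ := γ) hα hξ
  have hY₁ := h₁ T R R f f hf hf
  have hY₂ := h₂ T R f hf
  have hcont : ContPath (2 * α) T f := by
    have c₁ := contPath_youngInt hγ hγβ hβ1 hρ (dyadicHolder_timeDriver hβ1) hY₁ hT
    have c₂ := contPath_youngInt hγ hγβ hβ1 hρ hW hY₂ hT
    rw [sub_add_cancel] at c₁ c₂
    exact (((contPath_heat hω₀).sub c₁).sub c₂).congr fun t ht => hfix t ht.1 ht.2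
  refine ⟨⟨fun t ht => hreal t ht.1 ht.2, hcont, ?_, R.toNNReal, fun r hr t ht => ?_⟩,
    fun t ht => ?_⟩
  · exact fun t ht => (hcont.1 t ht).mono (by linarith)
  · have hb : SobBound (2 * α - 2 * γ) (f t - f r) (R * |t - r| ^ γ) := by
      rcases le_total r t with hrt | hrt
      · rw [abs_of_nonneg (sub_nonneg.2 hrt)]
        exact hf.holder r t hr.1 hrt ht.2
      · rw [abs_sub_comm, abs_of_nonneg (sub_nonneg.2 hrt)]
        exact (hf.holder t r ht.1 hrt hr.2).sub_comm
    have := hb.sobolevNorm_le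
    rwa [ENNReal.ofReal_mul hf.nonneg] at this
  · have h1 := integral_eq_youngInt ht.1 ((continuousOn_advection (by linarith) hcont).mono
      (Icc_subset_Icc_right ht.2))
    refine ⟨h1.1, youngInt W (fun s => transport ξ (f s)) t, ?_, ?_⟩
    · have h3 := isYoungIntegral_youngInt (θ := 1 / 2) (by linarith) hγ1.le hβ1 (by linarith)
        (by norm_num) (by linarith) hρ hW hY₂ hT ht.1 ht.2
      rwa [show 2 * α - 1 + 2 * (1 / 2) = 2 * α by ring] at h3
    · have h2 := hfix t ht.1 ht.2
      rw [mildMap, ← h1.2] at h2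
      exact h2

theorem isReal_youngInt {W : ℝ≥0 → ℝ} {Y : ℝ → L2} {t : ℝ} (ht : 0 ≤ t)
    (hlim : Tendsto (youngSum W Y t) atTop (𝓝 (youngInt W Y t)))
    (hY : ∀ r, 0 ≤ r → r ≤ t → IsReal (Y r)) : IsReal (youngInt W Y t) := by
  refine IsReal.of_tendsto hlim fun k => ?_
  rw [youngSum_eq]
  refine IsReal.sum _ fun n hn => ?_
  have h1 := dyadic_le_of_lt_floor ht (Finset.mem_range.1 hn)
  have h2 : (n : ℝ) / 2 ^ k ≤ t := by
    refine le_trans ?_ h1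
    gcongr; linarith
  exact ((hY _ (by positivity) h2).heat (sub_nonneg.2 h2)).real_smul _

theorem isReal_mildMap (hα : 1 < α) (hγ : 1 / 2 < γ) (hγβ : γ < β) (hβ1 : β ≤ 1)
    (hξ : ∀ j, MemSmooth (ξ j)) (hξr : ∀ j, IsReal (ξ j)) {K R T : ℝ} {ω₀ : L2} {W : ℝ≥0 → ℝ}
    (hω₀ : IsReal ω₀) (hW : DyadicHolder β K W) (hT : T ≤ 1) {f : ℝ → L2}
    (hf : PathBound (2 * α) γ T f R) (hreal : ∀ t, 0 ≤ t → t ≤ T → IsReal (f t)) {t : ℝ}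
    (ht0 : 0 ≤ t) (ht : t ≤ T) : IsReal (mildMap ξ ω₀ W f t) := by
  have hγ1 : γ < 1 := by linarith
  have hρ : 0 ≤ 2 * α - 1 := by linarith
  obtain ⟨A₁, hA₁, h₁⟩ := exists_pathBound_advection hα (by linarith : 0 < γ) hγ1
  obtain ⟨A₂, hA₂, h₂⟩ := exists_pathBound_transport (γ := γ) hα hξ
  have hm : ∀ r, 0 ≤ r → r ≤ t → MemSobolev 1 (f r) := fun r hr hrt =>
    hf.memSobolev_one hα hr (hrt.trans ht)
  refine ((hω₀.heat ht0).sub (isReal_youngInt ht0 ?_ fun r hr hrt => ?_)).sub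
    (isReal_youngInt ht0 ?_ fun r hr hrt => ?_)
  · exact tendsto_youngSum (by linarith) hγ1.le (by linarith) hβ1 (by linarith) hρ
      (dyadicHolder_timeDriver hβ1) (h₁ T R R f f hf hf) hT ht0 ht
  · have hr' := hreal r hr (hrt.trans ht)
    exact IsReal.transport (fun j => hr'.biotSavart j) hr' (hm r hr hrt)
  · exact tendsto_youngSum (by linarith) hγ1.le (by linarith) hβ1 (by linarith) hρ
      hW (h₂ T R f hf) hT ht0 ht
  · exact IsReal.transport hξr (hreal r hr (hrt.trans ht)) (hm r hr hrt)

/-! ### Conservation of the mean and the curl of the velocity -/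

/-- Transport by a divergence-free field has zero mean. -/
theorem coeff_transport_zero {v : Fin 2 → L2} (hv : ∀ j, Summable fun m => ‖coeff (v j) m‖)
    (hv1 : ∀ j, MemSobolev 1 (v j)) (hdiv : divergence v = 0) {f : L2} (hf : MemSobolev 1 f) :
    coeff (transport v f) 0 = 0 := by
  refine (hasSum_coeff_transport hv hf 0).unique ?_
  refine HasSum.congr_fun hasSum_zero fun m => ?_
  have h := congrArg (fun g => coeff g m) hdiv
  simp only [divergence, coeff_add, coeff_zero, coeff_partialDeriv (hv1 0),
    coeff_partialDeriv (hv1 1)] at h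
  simp only [Fin.sum_univ_two, Pi.sub_apply, Pi.zero_apply, zero_sub, Int.cast_neg]
  linear_combination (-coeff f (-m)) * h

theorem memSobolev_one_biotSavart {f : L2} (hf : MemSobolev 1 f) (j : Fin 2) :
    MemSobolev 1 (biotSavart f j) := by
  obtain ⟨C, hC⟩ := memSobolev_iff.1 hf
  exact ((hC.biotSavart j).mono_exponent (by norm_num)).memSobolev

theorem divergence_biotSavart {f : L2} (hf : MemSobolev 1 f) : divergence (biotSavart f) = 0 := by
  refine ext_coeff fun k => ?_
  rw [divergence, coeff_add, coeff_partialDeriv (memSobolev_one_biotSavart hf 0),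
    coeff_partialDeriv (memSobolev_one_biotSavart hf 1), coeff_biotSavart, coeff_biotSavart,
    coeff_zero]
  simp only [biotSavartSymbol, Matrix.cons_val_zero, Matrix.cons_val_one]
  ring

theorem curl_biotSavart {f : L2} (hf : MemSobolev 1 f) (h0 : coeff f 0 = 0) :
    curl (biotSavart f) = f := by
  refine ext_coeff fun k => ?_
  rw [curl, coeff_sub, coeff_partialDeriv (memSobolev_one_biotSavart hf 0),
    coeff_partialDeriv (memSobolev_one_biotSavart hf 1), coeff_biotSavart, coeff_biotSavart]
  simp only [biotSavartSymbol, Matrix.cons_val_zero, Matrix.cons_val_one]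
  rcases eq_or_ne k 0 with rfl | hk
  · simp [h0]
  · have hl : (eigenvalue k : ℂ) ≠ 0 := by
      have := one_le_eigenvalue hk
      exact_mod_cast (by linarith : eigenvalue k ≠ 0)
    have he : (eigenvalue k : ℂ) = 4 * (Real.pi : ℂ) ^ 2 * ((k 0 : ℂ) ^ 2 + (k 1 : ℂ) ^ 2) := by
      simp [eigenvalue, Fin.sum_univ_two]
    rw [invLaplaceSymbol, if_neg hk]
    field_simp
    rw [he]
    linear_combination (-4 * (Real.pi : ℂ) ^ 2 * ((k 0 : ℂ) ^ 2 + (k 1 : ℂ) ^ 2) * coeff f k) *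
      Complex.I_sq

theorem coeff_youngInt_zero {W : ℝ≥0 → ℝ} {Y : ℝ → L2} {t : ℝ} (ht : 0 ≤ t)
    (hlim : Tendsto (youngSum W Y t) atTop (𝓝 (youngInt W Y t)))
    (hY : ∀ r, 0 ≤ r → r ≤ t → coeff (Y r) 0 = 0) : coeff (youngInt W Y t) 0 = 0 := by
  refine tendsto_nhds_unique (tendsto_coeff hlim 0) ?_
  have : ∀ k, coeff (youngSum W Y t k) 0 = 0 := fun k => by
    rw [youngSum_eq, coeff_sum]
    refine Finset.sum_eq_zero fun n hn => ?_
    have h1 := dyadic_le_of_lt_floor ht (Finset.mem_range.1 hn)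
    have h2 : (n : ℝ) / 2 ^ k ≤ t := by
      refine le_trans ?_ h1
      gcongr; linarith
    rw [coeff_real_smul, coeff_heat (sub_nonneg.2 h2), hY _ (by positivity) h2, mul_zero, mul_zero]
  simp only [this, tendsto_const_nhds]

/-- The mean is conserved by mild solutions. -/
theorem coeff_mildMap_zero (hα : 1 < α) (hγ : 1 / 2 < γ) (hγβ : γ < β) (hβ1 : β ≤ 1)
    (hξ : ∀ j, MemSmooth (ξ j)) (hξdiv : divergence ξ = 0) {K R T : ℝ} {ω₀ : L2} {W : ℝ≥0 → ℝ}
    (hω₀ : coeff ω₀ 0 = 0) (hW : DyadicHolder β K W) (hT : T ≤ 1) {f : ℝ → L2}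
    (hf : PathBound (2 * α) γ T f R) {t : ℝ} (ht0 : 0 ≤ t) (ht : t ≤ T) :
    coeff (mildMap ξ ω₀ W f t) 0 = 0 := by
  have hγ1 : γ < 1 := by linarith
  have hρ : 0 ≤ 2 * α - 1 := by linarith
  obtain ⟨A₁, hA₁, h₁⟩ := exists_pathBound_advection hα (by linarith : 0 < γ) hγ1
  obtain ⟨A₂, hA₂, h₂⟩ := exists_pathBound_transport (γ := γ) hα hξ
  have hm : ∀ r, 0 ≤ r → r ≤ t → MemSobolev 1 (f r) := fun r hr hrt =>
    hf.memSobolev_one hα hr (hrt.trans ht)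
  have e1 := coeff_youngInt_zero ht0 (tendsto_youngSum (by linarith) hγ1.le (by linarith) hβ1
    (by linarith) hρ (dyadicHolder_timeDriver hβ1) (h₁ T R R f f hf hf) hT ht0 ht)
    fun r hr hrt => coeff_transport_zero (summable_coeff_biotSavart one_pos (hm r hr hrt))
      (memSobolev_one_biotSavart (hm r hr hrt)) (divergence_biotSavart (hm r hr hrt))
      (hm r hr hrt)
  have e2 := coeff_youngInt_zero ht0 (tendsto_youngSum (by linarith) hγ1.le (by linarith) hβ1
    (by linarith) hρ hW (h₂ T R f hf) hT ht0 ht)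
    fun r hr hrt => coeff_transport_zero (fun j => (hξ j).summable)
      (fun j => hξ j 1 zero_le_one) hξdiv (hm r hr hrt)
  rw [mildMap, coeff_sub, coeff_sub, coeff_heat ht0, hω₀, e1, e2]
  simp

/-- Local well-posedness along a single driver.  The life span depends on the driver only through
its Hölder constant `K`. -/
theorem exists_lifespan_mildSolution (hα : 1 < α) (hγ : 1 / 2 < γ) (hγβ : γ < β) (hβ1 : β ≤ 1)
    (hξ : ∀ j, MemSmooth (ξ j)) (hξr : ∀ j, IsReal (ξ j)) (hξdiv : divergence ξ = 0) {ω₀ : L2}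
    (hω₀r : IsReal ω₀) (hω₀ : MemSobolev (2 * α) ω₀) :
    ∃ Q : ℝ, 0 ≤ Q ∧ ∀ (K T : ℝ) (W : ℝ≥0 → ℝ), DyadicHolder β K W →
      0 ≤ T → T ≤ lifespan (β - γ) (Q * (1 + K)) →
      IsMildSolution α γ ξ ω₀ W T (mildSolution α ξ ω₀ W) ∧
      (∀ f, IsMildSolution α γ ξ ω₀ W T f → ∀ t ∈ Icc 0 T, f t = mildSolution α ξ ω₀ W t) ∧
      (coeff ω₀ 0 = 0 → ∀ t ∈ Icc 0 T,
        curl (biotSavart (mildSolution α ξ ω₀ W t)) = mildSolution α ξ ω₀ W t) := by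
  obtain ⟨M, hM, H⟩ := exists_mildMap_estimates hα hγ hγβ hβ1 hξ
  obtain ⟨C₀, hC₀⟩ := memSobolev_iff.1 hω₀
  have hC₀0 := hC₀.1
  -- `mildMap` maps the ball of radius `R` into the ball of radius `C₀ + R / 2`
  set R : ℝ := 2 * C₀ with hR
  have hR0 : 0 ≤ R := by positivity
  have hε : 0 < β - γ := sub_pos.2 hγβ
  refine ⟨M * (1 + R), by positivity, fun K T W hW hT0 hT => ?_⟩
  have hK := hW.nonneg
  have hT1 : T ≤ 1 := hT.trans (lifespan_le_one _ _)
  have hsmall : M * (1 + K) * (1 + R) * T ^ (β - γ) ≤ 1 / 2 := by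
    have := mul_rpow_lifespan_le hε (by positivity) hT0 hT
    calc _ = M * (1 + R) * (1 + K) * T ^ (β - γ) := by ring
      _ ≤ _ := this
  obtain ⟨hball, hcontr⟩ := H K R T ω₀ W hW hT1
  obtain ⟨hbd, hfix, hlim, hpic⟩ := mildSolution_fixedPoint (ξ := ξ) (ω₀ := ω₀) (W := W)
    (γ := γ) (T := T) hα hR0
    (fun f hf => (hball C₀ f hT0 hC₀ hf).mono (by
      have := mul_le_mul_of_nonneg_right hsmall hR0
      rw [hR] at this ⊢
      linarith))
    (fun C f g hf hg hfg => (hcontr 0 C f g le_rfl hT0 hf hg hfg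
      fun r hr hr' => absurd hr' (not_lt.2 hr)).mono (by
        rw [sub_zero, mul_comm C]
        exact mul_le_mul_of_nonneg_right hsmall hfg.nonneg))
  have hreal : ∀ n t, 0 ≤ t → t ≤ T → IsReal (picard α ξ ω₀ W n t) := by
    intro n
    induction n with
    | zero => exact fun _ _ _ => isReal_zero
    | succ n ih =>
      intro t ht0 ht
      rw [(hpic n).2 t ht0 ht]
      exact isReal_mildMap hα hγ hγβ hβ1 hξ hξr hω₀r hW hT1 (hpic n).1 ih ht0 ht
  refine ⟨?_, ?_, ?_⟩
  · exact isMildSolution_of_fixedPoint hα hγ hγβ hβ1 hξ hω₀ hW hT1 hbd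
      (fun t ht0 ht => IsReal.of_tendsto (hlim t ht0 ht) fun n => hreal n t ht0 ht) hfix
  · intro f hf t ht
    obtain ⟨R', hR'⟩ := hf.1.exists_pathBound
    exact mildMap_fixedPoint_unique hα hγ hγβ hβ1 hξ hW hT1
      (hR'.mono (le_max_left R' R)) (hbd.mono (le_max_right R' R))
      (fun t ht0 ht => hf.fixedPoint hα ht0 ht) hfix ht.1 ht.2
  · intro h0 t ht
    refine curl_biotSavart (hbd.memSobolev_one hα ht.1 ht.2) ?_
    rw [hfix t ht.1 ht.2]
    exact coeff_mildMap_zero hα hγ hγβ hβ1 hξ hξdiv h0 hW hT1 hbd ht.1 ht.2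

end

section

/-! ### Measurable dependence on the noise -/

variable {Ω : Type*} [MeasurableSpace Ω]

theorem stronglyMeasurable_coeff {g : Ω → L2} (hg : StronglyMeasurable g) (k : Fin 2 → ℤ) :
    StronglyMeasurable fun w => coeff (g w) k := by
  simp only [← coeffL_apply]
  exact (coeffL k).continuous.comp_stronglyMeasurable hg

theorem stronglyMeasurable_of_coeff {g : Ω → L2}
    (h : ∀ k, StronglyMeasurable fun w => coeff (g w) k) : StronglyMeasurable g := by
  refine stronglyMeasurable_of_tendsto (atTop : Filter (Finset (Fin 2 → ℤ)))
    (f := fun F w => ∑ k ∈ F, coeff (g w) k • mode k) (fun F => ?_)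
    (tendsto_pi_nhds.2 fun w => hasSum_coeff_smul_mode (g w))
  exact Finset.stronglyMeasurable_fun_sum F fun k _ => (h k).smul_const _

theorem stronglyMeasurable_transport {v : Ω → Fin 2 → L2} {f : Ω → L2}
    (hv : ∀ w j, Summable fun m => ‖coeff (v w j) m‖) (hf : ∀ w, MemSobolev 1 (f w))
    (hvm : ∀ j m, StronglyMeasurable fun w => coeff (v w j) m) (hfm : StronglyMeasurable f) :
    StronglyMeasurable fun w => transport (v w) (f w) := by
  refine stronglyMeasurable_of_coeff fun k => ?_
  refine stronglyMeasurable_of_tendsto (atTop : Filter (Finset (Fin 2 → ℤ)))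
    (fun F => ?_) (tendsto_pi_nhds.2 fun w => hasSum_coeff_transport (hv w) (hf w) k)
  exact Finset.stronglyMeasurable_fun_sum F fun m _ =>
    Finset.stronglyMeasurable_fun_sum _ fun j _ =>
      (hvm j m).mul ((stronglyMeasurable_coeff hfm (k - m)).const_mul _)

theorem stronglyMeasurable_advection {f : Ω → L2} (hf : ∀ w, MemSobolev 1 (f w))
    (hfm : StronglyMeasurable f) : StronglyMeasurable fun w => advection (f w) (f w) := by
  refine stronglyMeasurable_transport (fun w => summable_coeff_biotSavart one_pos (hf w)) hf
    (fun j m => ?_) hfm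
  simp only [coeff_biotSavart]
  exact (stronglyMeasurable_coeff hfm m).const_mul _

theorem stronglyMeasurable_regularPart (s : ℝ) {f : Ω → L2} (hf : StronglyMeasurable f) :
    StronglyMeasurable fun w => regularPart s (f w) := by
  have h1 : Measurable fun w => sobolevNorm s (f w) := by
    unfold sobolevNorm
    refine (Measurable.tsum fun k => ?_).pow_const _
    exact ((((stronglyMeasurable_coeff hf k).measurable.norm).pow_const 2).const_mul _).ennreal_ofReal
  exact StronglyMeasurable.ite (measurableSet_lt h1 measurable_const) hf stronglyMeasurable_const

theorem stronglyMeasurable_youngInt {W : ℝ≥0 → Ω → ℝ} (hW : ∀ t, Measurable (W t))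
    {Y : ℝ → Ω → L2} (hY : ∀ r, StronglyMeasurable (Y r)) (t : ℝ) :
    StronglyMeasurable fun w => youngInt (fun r => W r w) (fun r => Y r w) t := by
  refine StronglyMeasurable.limUnder (f := fun k w => youngSum (fun r => W r w) (fun r => Y r w) t k)
    fun k => ?_
  simp only [youngSum_eq]
  refine Finset.stronglyMeasurable_fun_sum _ fun n hn => ?_
  have hn' := Finset.mem_range.1 hn
  have ht : 0 ≤ t := by
    by_contra! h
    rw [Nat.floor_of_nonpos (mul_nonpos_of_nonpos_of_nonneg h.le (by positivity))] at hn'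
    exact absurd hn' (Nat.not_lt_zero n)
  have h1 := dyadic_le_of_lt_floor ht hn'
  have h2 : 0 ≤ t - (n : ℝ) / 2 ^ k := by
    refine sub_nonneg.2 (le_trans ?_ h1)
    gcongr; linarith
  refine StronglyMeasurable.smul ((hW _).sub (hW _)).stronglyMeasurable ?_
  simp only [← heatL_apply h2]
  exact (heatL _ h2).continuous.comp_stronglyMeasurable (hY _)

theorem stronglyMeasurable_picard {α : ℝ} (hα : 1 < α) {ξ : Fin 2 → L2}
    (hξ : ∀ j, MemSmooth (ξ j)) (ω₀ : L2) {W : ℝ≥0 → Ω → ℝ} (hW : ∀ t, Measurable (W t)) (n : ℕ) :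
    ∀ t, StronglyMeasurable fun w => picard α ξ ω₀ (fun r => W r w) n t := by
  induction n with
  | zero => exact fun t => stronglyMeasurable_const
  | succ n ih =>
    intro t
    have hmem : ∀ r w, MemSobolev 1 (picard α ξ ω₀ (fun r => W r w) n r) := by
      intro r w
      cases n with
      | zero => exact (SobBound.zero 1).memSobolev
      | succ n => exact (memSobolev_regularPart (2 * α) _).mono (by linarith)
    refine stronglyMeasurable_regularPart (2 * α) ?_
    refine (stronglyMeasurable_const.sub ?_).sub ?_
    · exact stronglyMeasurable_youngInt (W := fun r _ => timeDriver r) (fun _ => measurable_const)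
        (fun r => stronglyMeasurable_advection (hmem r) (ih r)) t
    · exact stronglyMeasurable_youngInt hW
        (fun r => stronglyMeasurable_transport (fun _ j => (hξ j).summable) (hmem r)
          (fun _ _ => stronglyMeasurable_const) (ih r)) t

theorem stronglyMeasurable_mildSolution {α : ℝ} (hα : 1 < α) {ξ : Fin 2 → L2}
    (hξ : ∀ j, MemSmooth (ξ j)) (ω₀ : L2) {W : ℝ≥0 → Ω → ℝ} (hW : ∀ t, Measurable (W t)) (t : ℝ) :
    StronglyMeasurable fun w => mildSolution α ξ ω₀ (fun r => W r w) t :=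
  StronglyMeasurable.limUnder (f := fun n w => picard α ξ ω₀ (fun r => W r w) n t)
    fun n => stronglyMeasurable_picard hα hξ ω₀ hW n t

/-! ### Regularity of fractional Brownian motion -/

/-- The optimal constant in the dyadic Hölder bound of exponent `β`, possibly infinite. -/
def dyadicHolderConst (β : ℝ) (W : ℝ≥0 → ℝ) : ℝ≥0∞ :=
  ⨆ (k : ℕ) (n : ℕ) (_ : n < 2 ^ k), ENNReal.ofReal (|dyadicIncr W k n| * ((2 : ℝ) ^ k) ^ β)

theorem dyadicHolder_of_const_ne_top {β : ℝ} {W : ℝ≥0 → ℝ} (h : dyadicHolderConst β W ≠ ∞) :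
    DyadicHolder β (dyadicHolderConst β W).toReal W := by
  intro k n hn
  have h2 : (0 : ℝ) < 2 ^ k := by positivity
  have h1 : ENNReal.ofReal (|dyadicIncr W k n| * ((2 : ℝ) ^ k) ^ β) ≤ dyadicHolderConst β W :=
    le_iSup_of_le k (le_iSup₂_of_le (f := fun n (_ : n < 2 ^ k) =>
      ENNReal.ofReal (|dyadicIncr W k n| * ((2 : ℝ) ^ k) ^ β)) n hn le_rfl)
  have h3 := (ENNReal.ofReal_le_iff_le_toReal h).1 h1
  rwa [Real.rpow_neg h2.le, ← div_eq_mul_inv, le_div_iff₀ (by positivity)]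

theorem dyadicHolderConst_ne_top {β : ℝ} {W : ℝ≥0 → ℝ} {k₀ : ℕ}
    (h : ∀ k, k₀ ≤ k → ∀ n < 2 ^ k, |dyadicIncr W k n| < ((2 : ℝ) ^ k) ^ (-β)) :
    dyadicHolderConst β W ≠ ∞ := by
  set a : ℕ → ℕ → ℝ≥0∞ := fun k n => ENNReal.ofReal (|dyadicIncr W k n| * ((2 : ℝ) ^ k) ^ β)
  have hS : ∑ k ∈ Finset.range k₀, ∑ n ∈ Finset.range (2 ^ k), a k n ≠ ∞ :=
    ENNReal.sum_ne_top.2 fun k _ => ENNReal.sum_ne_top.2 fun n _ => ENNReal.ofReal_ne_top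
  refine ne_top_of_le_ne_top (ENNReal.add_ne_top.2 ⟨ENNReal.one_ne_top, hS⟩) ?_
  refine iSup_le fun k => iSup₂_le fun n hn => ?_
  rcases le_or_gt k₀ k with hk | hk
  · refine le_add_right ?_
    rw [← ENNReal.ofReal_one]
    refine ENNReal.ofReal_le_ofReal ?_
    have h2 : (0 : ℝ) < 2 ^ k := by positivity
    have h3 := (h k hk n hn).le
    rwa [Real.rpow_neg h2.le, ← one_div, le_div_iff₀ (by positivity)] at h3
  · refine le_add_left ?_
    calc a k n ≤ ∑ n ∈ Finset.range (2 ^ k), a k n :=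
          Finset.single_le_sum (f := a k) (fun _ _ => zero_le) (Finset.mem_range.2 hn)
      _ ≤ _ := Finset.single_le_sum (f := fun k => ∑ n ∈ Finset.range (2 ^ k), a k n)
          (fun _ _ => zero_le) (Finset.mem_range.2 hk)

theorem measurable_dyadicHolderConst (β : ℝ) {W : ℝ≥0 → Ω → ℝ} (hW : ∀ t, Measurable (W t)) :
    Measurable fun w => dyadicHolderConst β fun t => W t w := by
  refine Measurable.iSup fun k => Measurable.iSup fun n => Measurable.iSup fun _ => ?_
  have h : Measurable fun w => dyadicIncr (fun t => W t w) k n := (hW _).sub (hW _)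
  exact ((continuous_abs.measurable.comp h).mul_const _).ennreal_ofReal

/-- The increments of fractional Brownian motion are Gaussian with variance `h^{2H}`. -/
theorem IsFBM.map_dyadicIncr {H : ℝ} {W : ℝ≥0 → Ω → ℝ} {P : Measure Ω} [IsProbabilityMeasure P]
    (hH : 0 < H) (hW : IsFBM H W P) (k n : ℕ) :
    P.map (fun w => dyadicIncr (fun t => W t w) k n) =
      gaussianReal 0 (((2 : ℝ) ^ k) ^ (-(2 * H))).toNNReal := by
  set s : ℝ≥0 := (n : ℝ≥0) / 2 ^ k with hs
  set t : ℝ≥0 := ((n : ℝ≥0) + 1) / 2 ^ k with ht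
  have h := (hW.gaussian.hasGaussianLaw_fun_sub (s := t) (t := s)).map_eq_gaussianReal
  have hm : ∀ r, MemLp (W r) 2 P := fun r => (hW.gaussian.hasGaussianLaw_eval r).memLp_two
  have hint : ∀ r, Integrable (W r) P := fun r => (hm r).integrable one_le_two
  have hmean : ∫ w, (W t w - W s w) ∂P = 0 := by
    rw [integral_sub (hint t) (hint s), hW.centred, hW.centred, sub_zero]
  have hvar : ∀ r : ℝ≥0, Var[W r; P] = (r : ℝ) ^ (2 * H) := fun r => by
    rw [← covariance_self (hW.measurable r).aemeasurable, hW.covariance_eq, sub_self, abs_zero,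
      Real.zero_rpow (by positivity)]
    ring
  have hdiff : (t : ℝ) - s = ((2 : ℝ) ^ k)⁻¹ := by
    rw [hs, ht]; push_cast; ring
  have hv : Var[fun w => W t w - W s w; P] = ((2 : ℝ) ^ k) ^ (-(2 * H)) := by
    rw [variance_fun_sub (hm t) (hm s), hvar, hvar, hW.covariance_eq, abs_sub_comm, hdiff,
      abs_of_nonneg (by positivity), Real.inv_rpow (by positivity), Real.rpow_neg (by positivity)]
    ring
  rw [hmean, hv] at h
  exact h

/-- Moment bound for the tail of a centred Gaussian variable with standard deviation `σ`. -/
theorem exists_gaussianReal_tail_le (p : ℕ) :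
    ∃ m : ℝ≥0∞, m ≠ ∞ ∧ ∀ σ x : ℝ, 0 < σ → 0 < x →
      gaussianReal 0 (σ ^ 2).toNNReal {z | x ≤ |z|} ≤ m * ENNReal.ofReal ((σ / x) ^ p) := by
  refine ⟨∫⁻ z, ENNReal.ofReal (|z| ^ p) ∂(gaussianReal 0 1), ?_, fun σ x hσ hx => ?_⟩
  · have h1 := memLp_id_gaussianReal (μ := 0) (v := 1) (p : ℝ≥0)
    rcases eq_or_ne p 0 with rfl | hp
    · simp
    · have h2 := h1.integrable_norm_rpow (by simpa using hp) (by simp)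
      have h3 := h2.lintegral_lt_top
      simpa using h3.ne
  · have hmap : gaussianReal 0 (σ ^ 2).toNNReal = (gaussianReal 0 1).map (σ * ·) := by
      rw [gaussianReal_map_const_mul, mul_zero, mul_one]
      congr 1
      ext
      simp [Real.coe_toNNReal _ (sq_nonneg σ)]
    have hset : MeasurableSet {z : ℝ | x ≤ |z|} :=
      measurableSet_le measurable_const continuous_abs.measurable
    rw [hmap, Measure.map_apply (by fun_prop) hset]
    have hsub : (fun z => σ * z) ⁻¹' {z | x ≤ |z|} ⊆
        {z | ENNReal.ofReal ((x / σ) ^ p) ≤ ENNReal.ofReal (|z| ^ p)} := by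
      intro z hz
      simp only [mem_preimage, mem_ofPred_eq, abs_mul, abs_of_pos hσ] at hz
      refine ENNReal.ofReal_le_ofReal ?_
      gcongr
      rw [div_le_iff₀ hσ]
      linarith
    refine (measure_mono hsub).trans ?_
    have hmarkov := mul_meas_ge_le_lintegral (μ := gaussianReal 0 1)
      (f := fun z : ℝ => ENNReal.ofReal (|z| ^ p)) (by fun_prop) (ENNReal.ofReal ((x / σ) ^ p))
    have hpos : 0 < (x / σ) ^ p := by positivity
    rw [← inv_div x σ, inv_pow, ENNReal.ofReal_inv_of_pos hpos, ← ENNReal.div_eq_inv_mul.trans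
      (mul_comm _ _), ENNReal.le_div_iff_mul_le (Or.inl (by simpa using hpos))
      (Or.inl ENNReal.ofReal_ne_top), mul_comm]
    exact hmarkov

/-- Almost surely the dyadic increments of fractional Brownian motion satisfy a Hölder bound of any
exponent `β < H`. -/
theorem IsFBM.ae_dyadicHolderConst_ne_top {H β : ℝ} {W : ℝ≥0 → Ω → ℝ} {P : Measure Ω}
    [IsProbabilityMeasure P] (hH : 0 < H) (hβ : β < H) (hW : IsFBM H W P) :
    ∀ᵐ w ∂P, dyadicHolderConst β (fun t => W t w) ≠ ∞ := by
  -- for `p (H - β) > 1` the union bound over the `2 ^ k` increments of level `k` is summable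
  obtain ⟨p, hp⟩ := exists_nat_gt (1 / (H - β))
  have hp1 : 1 < p * (H - β) := (div_lt_iff₀ (sub_pos.2 hβ)).1 hp
  obtain ⟨m, hm, htail⟩ := exists_gaussianReal_tail_le p
  set bad : ℕ → Set Ω := fun k => ⋃ n ∈ Finset.range (2 ^ k),
    {w | ((2 : ℝ) ^ k) ^ (-β) ≤ |dyadicIncr (fun t => W t w) k n|} with hbad
  set r : ℝ := 2 ^ (1 - p * (H - β)) with hr
  have hr1 : r < 1 := Real.rpow_lt_one_of_one_lt_of_neg (by norm_num) (by linarith)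
  have hr0 : 0 ≤ r := by positivity
  have hmeas : ∀ k, P (bad k) ≤ m * ENNReal.ofReal (r ^ k) := by
    intro k
    have h2 : (0 : ℝ) < 2 ^ k := by positivity
    have hone : ∀ n, P {w | ((2 : ℝ) ^ k) ^ (-β) ≤ |dyadicIncr (fun t => W t w) k n|} ≤
        m * ENNReal.ofReal ((((2 : ℝ) ^ k) ^ (-H) / ((2 : ℝ) ^ k) ^ (-β)) ^ p) := by
      intro n
      have hd : Measurable fun w => dyadicIncr (fun t => W t w) k n :=
        (hW.measurable _).sub (hW.measurable _)
      have h3 := htail (((2 : ℝ) ^ k) ^ (-H)) (((2 : ℝ) ^ k) ^ (-β)) (by positivity) (by positivity)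
      rw [← Real.rpow_mul_natCast h2.le, show -H * ((2 : ℕ) : ℝ) = -(2 * H) by push_cast; ring,
        ← hW.map_dyadicIncr hH k n, Measure.map_apply hd
        (measurableSet_le measurable_const continuous_abs.measurable)] at h3
      exact h3
    calc P (bad k) ≤ ∑ n ∈ Finset.range (2 ^ k),
          P {w | ((2 : ℝ) ^ k) ^ (-β) ≤ |dyadicIncr (fun t => W t w) k n|} :=
          measure_biUnion_finset_le _ _
      _ ≤ ∑ _n ∈ Finset.range (2 ^ k),
          m * ENNReal.ofReal ((((2 : ℝ) ^ k) ^ (-H) / ((2 : ℝ) ^ k) ^ (-β)) ^ p) :=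
          Finset.sum_le_sum fun n _ => hone n
      _ = m * ENNReal.ofReal (r ^ k) := by
          rw [Finset.sum_const, Finset.card_range, nsmul_eq_mul, mul_left_comm]
          congr 1
          rw [show (((2 ^ k : ℕ) : ℝ≥0∞)) = ENNReal.ofReal ((2 : ℝ) ^ k) by
            rw [ENNReal.ofReal_pow (by norm_num)]; simp, ← ENNReal.ofReal_mul h2.le]
          congr 1
          rw [← Real.rpow_sub h2, ← Real.rpow_mul_natCast h2.le, hr, ← Real.rpow_mul_natCast
            (by norm_num), ← Real.rpow_natCast 2 k, ← Real.rpow_mul (by norm_num),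
            ← Real.rpow_add (by norm_num)]
          congr 1
          ring
  have hsum : ∑' k, P (bad k) ≠ ∞ := by
    refine ne_top_of_le_ne_top ?_ (ENNReal.tsum_le_tsum hmeas)
    rw [ENNReal.tsum_mul_left]
    refine ENNReal.mul_ne_top hm ?_
    rw [← ENNReal.ofReal_tsum_of_nonneg (fun k => by positivity)
      (summable_geometric_of_lt_one hr0 hr1)]
    exact ENNReal.ofReal_ne_top
  filter_upwards [ae_eventually_notMem hsum] with w hw
  obtain ⟨k₀, hk₀⟩ := eventually_atTop.1 hw
  refine dyadicHolderConst_ne_top (k₀ := k₀) fun k hk n hn => ?_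
  have h1 := hk₀ k hk
  simp only [hbad, mem_iUnion, Finset.mem_range, mem_ofPred_eq, not_exists, not_le] at h1
  exact h1 n hn

theorem measurable_lifespan (ε : ℝ) {q : Ω → ℝ} (hq : Measurable q) :
    Measurable fun w => lifespan ε (q w) :=
  measurable_const.min (((measurable_const.add hq).const_mul 2).inv.pow_const _)

end

end Vorticity
end

theorem mainTheorem1 {Ω : Type*} [MeasurableSpace Ω] (P : Measure Ω) [IsProbabilityMeasure P]
    (H : ℝ) (hH : H ∈ Ioo (1 / 2 : ℝ) 1) (W : ℝ≥0 → Ω → ℝ) (hW : Vorticity.IsFBM H W P)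
    (α γ : ℝ) (hα : 1 < α) (hγ : γ ∈ Ioo (1 / 2 : ℝ) H)
    (ξ : Fin 2 → Vorticity.L2) (hξ_real : ∀ j, Vorticity.IsReal (ξ j))
    (hξ_smooth : ∀ j, Vorticity.MemSmooth (ξ j)) (hξ_div : Vorticity.divergence ξ = 0)
    (ω₀ : Vorticity.L2) (hω₀_real : Vorticity.IsReal ω₀)
    (hω₀ : Vorticity.MemSobolev (2 * α) ω₀) :
    ∃ (τ : Ω → ℝ) (ω : ℝ → Ω → Vorticity.L2),
      Measurable τ ∧ (∀ t, StronglyMeasurable (ω t)) ∧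
      ∀ᵐ w ∂P, 0 < τ w ∧
        (∀ T : ℝ, 0 < T → T ≤ τ w →
          Vorticity.IsMildSolution α γ ξ ω₀ (fun t => W t w) T (fun t => ω t w) ∧
          ∀ ω' : ℝ → Vorticity.L2,
            Vorticity.IsMildSolution α γ ξ ω₀ (fun t => W t w) T ω' →
              ∀ t ∈ Icc 0 T, ω' t = ω t w) ∧
        (Vorticity.coeff ω₀ 0 = 0 →
          ∀ t ∈ Icc 0 (τ w),
            Vorticity.curl (Vorticity.biotSavart (ω t w)) = ω t w) := by
  -- an exponent strictly between `γ` and `H`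
  obtain ⟨β, hγβ, hβH⟩ := exists_between hγ.2
  have hβ1 : β ≤ 1 := (hβH.trans hH.2).le
  obtain ⟨Q, hQ, key⟩ := Vorticity.exists_lifespan_mildSolution hα hγ.1 hγβ hβ1 hξ_smooth hξ_real
    hξ_div hω₀_real hω₀
  refine ⟨fun w => Vorticity.lifespan (β - γ)
      (Q * (1 + (Vorticity.dyadicHolderConst β fun t => W t w).toReal)),
    fun t w => Vorticity.mildSolution α ξ ω₀ (fun r => W r w) t, ?_,
    Vorticity.stronglyMeasurable_mildSolution hα hξ_smooth ω₀ hW.measurable, ?_⟩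
  · exact Vorticity.measurable_lifespan _ ((measurable_const.add
      (Vorticity.measurable_dyadicHolderConst β hW.measurable).ennreal_toReal).const_mul Q)
  · filter_upwards [hW.ae_dyadicHolderConst_ne_top (by linarith [hH.1]) hβH] with w hw
    have hWw := Vorticity.dyadicHolder_of_const_ne_top hw
    have hK := hWw.nonneg
    have hτ := Vorticity.lifespan_pos (ε := β - γ)
      (q := Q * (1 + (Vorticity.dyadicHolderConst β fun t => W t w).toReal)) (by positivity)
    refine ⟨hτ, fun T hT0 hT => ?_, fun h0 => (key _ _ _ hWw hτ.le le_rfl).2.2 h0⟩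
    have h := key _ T _ hWw hT0.le hT
    exact ⟨h.1, h.2.1⟩
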